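/- **Theorem 4.1.** Let $2\le\kappa<\frac{3+\sqrt5}{2}$ and let $\Gamma=(\Gamma_1,\dots,\Gamma_m)$ be a finite collection of simple plane curves, each either open (an arc including its end points) or closed. Each $\Gamma_k$ has finite positive length, is of class $C^2$, and is $C^\infty$ (up to the end points) with nonzero curvature except at finitely many points, at each of which the curvature vanishes to some order $\beta-2$ with $2<\beta\le\kappa$. This means that, with this point as origin and in a suitable orthonormal frame, $\Gamma_k$ is locally the graph of $g(x)=|x|^{\beta}h(x)$ or $g(x)=\operatorname{sgn}(x)|x|^{\beta}h(x)$ with $h\in C^\infty[-r,r]$ nowhere zero (a one-sided condition at an end point of an open curve). For $\kappa=2$ there are no exceptional points. *Notation.* Let $n_k$ be a continuous unit normal of $\Gamma_k$, $P_k$ the nearest point projection to $\Gamma_k$, $d_k(x)=n_k(P_kx)\cdot(x-P_kx)$ the signed distance, and for $\varepsilon>0$ let $T_{k,\varepsilon}=\{x+u\,n_k(x): x\in\Gamma_k,\ |u|\le\varepsilon\}$. Let $J_k(x)=1-d_k(x)\,c_k(x)$, where $c_k(x)$ is the signed curvature at $x$ of the level curve of $d_k$ through $x$ (the sign is such that a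 circle of radius $R$ with outward normal has curvature $1/R$). Call $\varepsilon_0>0$ admissible if, for every $k$, every point of $T_{k,\varepsilon_0}$ has exactly one nearest point on $\Gamma_k$ and $1+u\,c_k(x)>0$ for all $x\in\Gamma_k$, $|u|\le\varepsilon_0$. For an integer $q\ge0$ let $\theta:\mathbb R\to\mathbb R$ be a weight of regularity order $q$: $\operatorname{supp}\theta=[-1,1]$, $\int_{-1}^{1}\theta=1$, $\theta\in C^{q-1}(\mathbb R)$ (no condition if $q=0$), and $\theta^{(q)}$ is piecewise $C^1$ (for $q=0$, $\theta$ itself is piecewise $C^1$). Put $\theta_\varepsilon(s)=\varepsilon^{-1}\theta(\varepsilon^{-1}s)$. Let $f$ be a real function on $\bigcup_k\Gamma_k$ whose restriction to each $\Gamma_k$ extends to a $C^\infty$ function on $\mathbb R^2$. Put $$\mathcal I(f)=\sum_{k=1}^m\int_{\Gamma_k}f\,d\sigma,\qquad \mathcal I_h(f)=h^2\sum_{k=1}^m\ \sum_{z\in(h\mathbb Z)^2\cap T_{k,\varepsilon}}f(P_kz)\,\theta_\varepsilon(d_k(z))\,J_k(z).$$ For $\eta\in\mathrm{SO}(2)$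 and $\xi\in[0,1]^2$ let $\mathcal I_h(f;\eta,\xi)$ be the same sum for the moved collection $\eta\Gamma+h\xi$, the function $f$ and the normals being carried along by the rigid motion. *Claim.* There is an admissible $\varepsilon_0$. Moreover, let $\varepsilon_0$ be any admissible number, $q$, $\theta$, $f$ as above, $\alpha\in[0,1]$, and let the tube widths $\varepsilon=\varepsilon(h)$ satisfy $\varepsilon(h)=\Theta(h^\alpha)$ as $h\to0^+$ and $0<\varepsilon(h)\le\varepsilon_0$ for all small $h>0$. Then for all small $h>0$ the squared error $|\mathcal I(f)-\mathcal I_h(f;\eta,\xi)|^2$ is integrable in $(\eta,\xi)$, and $$\int_{\mathrm{SO}(2)}\int_{[0,1]^2}\big|\mathcal I(f)-\mathcal I_h(f;\eta,\xi)\big|^2\,d\xi\,d\eta=O\!\left(h^{\frac2\kappa+\frac{2}{\kappa-1}(1-\alpha)}\right)\qquad(h\to0^+),$$ where $d\eta$ is the normalized Haar measure of $\mathrm{SO}(2)$. -/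

import Mathlib

open Set Filter Topology MeasureTheory Asymptotics
open scoped ContDiff

noncomputable section

/-- The Euclidean plane. -/
abbrev Plane := EuclideanSpace ℝ (Fin 2)

/-- Rotation of the plane by the angle `φ`. -/
def planeRotation (φ : ℝ) (x : Plane) : Plane :=
  !₂[Real.cos φ * x 0 - Real.sin φ * x 1, Real.sin φ * x 0 + Real.cos φ * x 1]

/-- The data of a parametrized plane curve: an open arc `param '' [0, len]`, or, if `isLoop`
holds, a closed curve with a `len`-periodic parametrization. For an open arc only the values of
`param` on `[0, len]` matter. The laws are in `PlaneCurve.IsAdmissible`. -/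
structure PlaneCurve where
  param : ℝ → Plane
  len : ℝ
  isLoop : Prop

namespace PlaneCurve

/-- The point set of the curve. -/
def trace (Γ : PlaneCurve) : Set Plane := Γ.param '' Icc 0 Γ.len

/-- The parameters that represent points of the curve: all of `ℝ` for a closed curve, and
`[0, len]` for an open one. -/
def domain (Γ : PlaneCurve) : Set ℝ := {t | Γ.isLoop ∨ t ∈ Icc 0 Γ.len}

/-- The unit normal: the unit tangent turned clockwise by a right angle. This is the outward
normal of a closed curve that is traversed counterclockwise; traversing the curve in the opposite
direction gives the opposite choice of the normal. -/
def normal (Γ : PlaneCurve) (t : ℝ) : Plane :=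
  !₂[deriv Γ.param t 1, -(deriv Γ.param t 0)]

/-- The signed curvature of a unit speed curve; a counterclockwise circle of radius `R` has
curvature `1 / R`. -/
def curvature (Γ : PlaneCurve) (t : ℝ) : ℝ :=
  deriv Γ.param t 0 * deriv (deriv Γ.param) t 1 - deriv Γ.param t 1 * deriv (deriv Γ.param) t 0

/-- The curvature vanishes at `param t₀` to order `β - 2`: with that point as origin and in a
suitable orthonormal frame, the curve is locally the graph of `|x| ^ β * h x` or of
`sign x * |x| ^ β * h x`, with `h` smooth and without zeros. At an end point of an open
curve this is a one-sided condition. -/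
def IsFlatAt (Γ : PlaneCurve) (β t₀ : ℝ) : Prop :=
  ∃ e₁ e₂ : Plane, ‖e₁‖ = 1 ∧ ‖e₂‖ = 1 ∧ inner ℝ e₁ e₂ = 0 ∧
    ∃ (r : ℝ) (g h : ℝ → ℝ), 0 < r ∧ ContDiffOn ℝ ∞ h (Icc (-r) r) ∧
      (∀ x ∈ Icc (-r) r, h x ≠ 0) ∧
      ((∀ x ∈ Icc (-r) r, g x = |x| ^ β * h x) ∨
        (∀ x ∈ Icc (-r) r, g x = Real.sign x * |x| ^ β * h x)) ∧
      ∀ᶠ t in 𝓝[Γ.domain] t₀,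
        inner ℝ (Γ.param t - Γ.param t₀) e₁ ∈ Icc (-r) r ∧
        inner ℝ (Γ.param t - Γ.param t₀) e₂ = g (inner ℝ (Γ.param t - Γ.param t₀) e₁)

/-- A simple plane curve, open or closed, parametrized by arc length, that is smooth with nonzero
curvature except at finitely many points, at which the curvature vanishes to an order of at most
`κ - 2`. For `κ = 2` there are no exceptional points. -/
structure IsAdmissible (Γ : PlaneCurve) (κ : ℝ) : Prop where
  len_pos : 0 < Γ.len
  contDiff_two : ContDiff ℝ 2 Γ.param
  unit_speed : ∀ t ∈ Γ.domain, ‖deriv Γ.param t‖ = 1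
  simple_open : ¬ Γ.isLoop → InjOn Γ.param (Icc 0 Γ.len)
  simple_closed : Γ.isLoop → Function.Periodic Γ.param Γ.len ∧ InjOn Γ.param (Ico 0 Γ.len)
  smooth : ∀ t ∈ Γ.domain, Γ.curvature t ≠ 0 → ContDiffWithinAt ℝ ∞ Γ.param Γ.domain t
  finite_flat : {t ∈ Icc 0 Γ.len | Γ.curvature t = 0}.Finite
  flat : ∀ t ∈ Γ.domain, Γ.curvature t = 0 → ∃ β : ℝ, 2 < β ∧ β ≤ κ ∧ Γ.IsFlatAt β t

/-- The segmented tube `{x + u n(x) : x ∈ Γ, |u| ≤ ε}`. -/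
def tube (Γ : PlaneCurve) (ε : ℝ) : Set Plane :=
  {x | ∃ t ∈ Icc 0 Γ.len, ∃ u ∈ Icc (-ε) ε, x = Γ.param t + u • Γ.normal t}

/-- The projection and its Jacobian are well defined on the tube of half-width `ε`: every point of
the tube has exactly one nearest point on the curve, and the level curves at signed distance
at most `ε` are regular (no focal points). -/
def TubeRegular (Γ : PlaneCurve) (ε : ℝ) : Prop :=
  (∀ x ∈ Γ.tube ε, ∃! y, y ∈ Γ.trace ∧ ∀ z ∈ Γ.trace, dist x y ≤ dist x z) ∧
  ∀ t ∈ Icc 0 Γ.len, ∀ u ∈ Icc (-ε) ε, 0 < 1 + u * Γ.curvature t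

/-- A parameter in `[0, len]` of a point of the curve that is nearest to `x`. -/
def projParam (Γ : PlaneCurve) (x : Plane) : ℝ :=
  Classical.epsilon fun t =>
    t ∈ Icc 0 Γ.len ∧ ∀ s ∈ Icc 0 Γ.len, dist x (Γ.param t) ≤ dist x (Γ.param s)

/-- The nearest point projection to the curve. -/
def proj (Γ : PlaneCurve) (x : Plane) : Plane := Γ.param (Γ.projParam x)

/-- The signed distance to the curve. -/
def signedDist (Γ : PlaneCurve) (x : Plane) : ℝ :=
  inner ℝ (Γ.normal (Γ.projParam x)) (x - Γ.proj x)

/-- The signed curvature at `x` of the level curve of the signed distance through `x`; the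
parallel curve at signed distance `u` from a curve of curvature `k` has curvature
`k / (1 + u * k)`. -/
def levelCurvature (Γ : PlaneCurve) (x : Plane) : ℝ :=
  Γ.curvature (Γ.projParam x) / (1 + Γ.signedDist x * Γ.curvature (Γ.projParam x))

/-- The Jacobian of the projection on the level curves. -/
def jacobian (Γ : PlaneCurve) (x : Plane) : ℝ := 1 - Γ.signedDist x * Γ.levelCurvature x

/-- The integrand `f(P x) θ_ε(d(x)) J(x)`, where `θ_ε(s) = ε⁻¹ θ(ε⁻¹ s)`. -/
def integrand (Γ : PlaneCurve) (f : Plane → ℝ) (θ : ℝ → ℝ) (ε : ℝ) (x : Plane) : ℝ :=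
  f (Γ.proj x) * (ε⁻¹ * θ (ε⁻¹ * Γ.signedDist x)) * Γ.jacobian x

/-- The image of the curve under the rotation by `φ` followed by the translation by `v`. -/
def move (Γ : PlaneCurve) (φ : ℝ) (v : Plane) : PlaneCurve where
  param := fun t => planeRotation φ (Γ.param t) + v
  len := Γ.len
  isLoop := Γ.isLoop

end PlaneCurve

/-- The weight functions of regularity order `q`: supported on `[-1, 1]`, of integral one, `C^(q-1)`
(no condition for `q = 0`), with piecewise `C^1` derivative of order `q`. -/
structure IsWeight (q : ℕ) (θ : ℝ → ℝ) : Prop where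
  support_eq : tsupport θ = Icc (-1) 1
  integral_eq : ∫ s in (-1 : ℝ)..1, θ s = 1
  contDiff : ∀ p : ℕ, p + 1 = q → ContDiff ℝ p θ
  piecewise : ∃ B : Finset ℝ, (∀ s ∉ B, ContDiffAt ℝ (q + 1 : ℕ) θ s) ∧
    ∀ s ∈ B, ∀ j : ℕ, j = q ∨ j = q + 1 →
      (∃ l, Tendsto (iteratedDeriv j θ) (𝓝[<] s) (𝓝 l)) ∧
      (∃ l, Tendsto (iteratedDeriv j θ) (𝓝[>] s) (𝓝 l))

/-- The integral of `f` along a finite collection of unit speed curves. -/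
def lineIntegral {m : ℕ} (Γ : Fin m → PlaneCurve) (f : Plane → ℝ) : ℝ :=
  ∑ k, ∫ t in (0 : ℝ)..(Γ k).len, f ((Γ k).param t)

/-- The point of `(h ℤ)²` with index `w`. -/
def latticePoint (h : ℝ) (w : Fin 2 → ℤ) : Plane := !₂[h * w 0, h * w 1]

/-- The generalized implicit boundary integral
`h² ∑ₖ ∑_{z ∈ (h ℤ)² ∩ Tₖ} Qₖ(z)`, where `Tₖ` is the tube of half-width `ε` of the `k`-th curve. -/
def ibim {m : ℕ} (Γ : Fin m → PlaneCurve) (f : Plane → ℝ) (θ : ℝ → ℝ) (h ε : ℝ) : ℝ :=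
  h ^ 2 * ∑ k, ∑' w : Fin 2 → ℤ,
    ((Γ k).tube ε).indicator ((Γ k).integrand f θ ε) (latticePoint h w)

/-- The generalized implicit boundary integral on the collection rotated by `φ` and translated by
`h ξ`; the function `f` is carried along by this rigid motion. -/
def ibimMoved {m : ℕ} (Γ : Fin m → PlaneCurve) (f : Plane → ℝ) (θ : ℝ → ℝ) (h ε φ : ℝ)
    (ξ : Plane) : ℝ :=
  ibim (fun k => (Γ k).move φ (h • ξ)) (fun x => f (planeRotation (-φ) (x - h • ξ))) θ h ε

/-- The unit square `[0, 1]²`. -/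
def unitSquare : Set Plane := {ξ | ∀ i, ξ i ∈ Icc (0 : ℝ) 1}

/-- The squared quadrature error for the rotation by `φ` and the translation by `h ξ`. -/
def squaredError {m : ℕ} (Γ : Fin m → PlaneCurve) (f : Plane → ℝ) (θ : ℝ → ℝ) (h ε φ : ℝ)
    (ξ : Plane) : ℝ :=
  |lineIntegral Γ f - ibimMoved Γ f θ h ε φ ξ| ^ 2

/-- The mean of the squared quadrature error over all rotations, for the normalized Haar measure
of `SO(2)`, which is `dφ / 2π` in terms of the angle, and over all `ξ ∈ [0, 1]²`. -/
def meanSquaredError {m : ℕ} (Γ : Fin m → PlaneCurve) (f : Plane → ℝ) (θ : ℝ → ℝ) (h ε : ℝ) : ℝ :=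
  (2 * Real.pi)⁻¹ * ∫ φ in (0 : ℝ)..(2 * Real.pi), ∫ ξ in unitSquare, squaredError Γ f θ h ε φ ξ

end

/-! Extended by zero off the tube, the integrand of each curve becomes a function on the plane, and
moving the curves is the same as moving the lattice under the sum `g` of these functions. In normal
coordinates `(t, u)` (arc length and signed height) the factor `J` is the reciprocal of the area
element `1 + u c(t)`. It cancels, so `∫ g` is the line integral, and the Fourier transform of `g` is
a sum of oscillatory integrals over rectangles in `(t, u)` with density `f(γ(t)) θ_ε(u)`. For a
fixed rotation the error is periodic in the translation. By Parseval (`hasSum_sq_periodization`) its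
mean square is the sum of `|ĝ|²` over the nonzero dual lattice, and averaging over rotations turns
each term into an integral of `|ĝ|²` over a circle of radius `R = 2π|n|/h`. If these circle
integrals are `O(ε⁻² R⁻³)`, then, because `∑ |n|⁻³` converges in the plane, the mean squared error
is `O(h³/ε²) = O(h^(3 - 2α))` (`integral_sq_latticeSum_le`). For `κ ≥ 2` the claimed exponent is at
most `3 - 2α`, with equality at `κ = 2`.

The core is thus the decay of circle means (`exists_weightInt_bound`). Integrating by parts across
the strip against a primitive replaces the weight by unweighted strips and costs a factor `ε⁻¹`. For
an unweighted strip (`exists_stripInt_bound`) let `nor` and `tan` be the components of the frequency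
direction along the normal and the tangent of the curve. Their squares sum to one, so on small boxes
in `(t, φ)` one of them stays away from zero. Where `nor` does, the integral in `u` is elementary
and leaves two integrals along parallel curves, with a gain `R⁻¹`. Their mean square over directions
is `O(R⁻¹)`: expand the square and integrate over `φ` first. The phase difference of two points is
then nonstationary at rate `|s - t|`, which gives a kernel `(1 + R² (s - t)²)⁻¹`. Where `tan` does,
integration by parts in `t` gains `R⁻¹`, the integral in `u` gains `(1 + R |nor|)⁻¹`, and the square
of the latter has integral `O(R⁻¹)` over `φ` because `nor` varies with `φ` at rate `tan`. Neither
case needs a lower bound on the curvature.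

What the second case needs is that the derivative of the curvature is integrable along the curve
(`intervalIntegrable_deriv_curvature`). At a flat point of order `β - 2` it is `O(1 + |t - s|^(β -
3))`, integrable because `β > 2`.

Regular tubes exist by a quadratic chord estimate (`exists_tubeRegular`). In any regular tube a
continuity argument along each normal segment shows that its foot is the nearest point
(`dist_foot_le`), so normal coordinates compute the projection, the signed distance and `J`. -/

noncomputable section

/-! ### Oscillatory integrals -/

/-- The oscillation `e^{-ix}`. -/
def osc (x : ℝ) : ℂ := Complex.exp (((-x : ℝ) : ℂ) * Complex.I)

lemma norm_osc (x : ℝ) : ‖osc x‖ = 1 := Complex.norm_exp_ofReal_mul_I _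

lemma osc_add (x y : ℝ) : osc (x + y) = osc x * osc y := by
  unfold osc; rw [← Complex.exp_add]; push_cast; ring_nf

lemma continuous_osc : Continuous osc := by unfold osc; fun_prop

lemma conj_osc (x : ℝ) : (starRingEnd ℂ) (osc x) = osc (-x) := by
  unfold osc; rw [← Complex.exp_conj]; simp

lemma HasDerivAt.osc {f : ℝ → ℝ} {f' t : ℝ} (hf : HasDerivAt f f' t) :
    HasDerivAt (fun s => osc (f s)) (-(f' : ℂ) * Complex.I * osc (f t)) t := by
  have h1 : HasDerivAt (fun s => (((-(f s) : ℝ) : ℂ) * Complex.I)) (((-f' : ℝ) : ℂ) * Complex.I) t :=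
    (hf.neg.ofReal_comp).mul_const _
  have := h1.cexp
  refine this.congr_deriv ?_
  unfold _root_.osc; push_cast; ring

/-- Integration by parts against an oscillating factor, up to a countable exceptional set. -/
lemma integral_deriv_mul_osc {a b : ℝ} (hab : a ≤ b) {A A' ψ ψ' : ℝ → ℝ} {S : Set ℝ}
    (hS : S.Countable) (hA : ContinuousOn A (Icc a b))
    (hA' : ∀ t ∈ Ioo a b \ S, HasDerivAt A (A' t) t) (hAi : IntervalIntegrable A' volume a b)
    (hψ : ∀ t ∈ Icc a b, HasDerivAt ψ (ψ' t) t) (hψc : ContinuousOn ψ' (Icc a b)) :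
    Complex.I * ∫ t in a..b, ((A t * ψ' t : ℝ) : ℂ) * osc (ψ t) =
      (∫ t in a..b, (A' t : ℂ) * osc (ψ t)) - (A b * osc (ψ b) - A a * osc (ψ a)) := by
  have hψcont : ContinuousOn ψ (Icc a b) := fun t ht => (hψ t ht).continuousAt.continuousWithinAt
  have hosc : ContinuousOn (fun t => osc (ψ t)) (Icc a b) := continuous_osc.comp_continuousOn hψcont
  have hi1 : IntervalIntegrable (fun t => (A' t : ℂ) * osc (ψ t)) volume a b := by
    refine (IntervalIntegrable.mul_continuousOn (f := fun t => (A' t : ℂ)) ?_ ?_)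
    · exact ⟨hAi.1.ofReal, hAi.2.ofReal⟩
    · rwa [uIcc_of_le hab]
  have hi2 : IntervalIntegrable (fun t => ((A t * ψ' t : ℝ) : ℂ) * osc (ψ t)) volume a b := by
    apply ContinuousOn.intervalIntegrable
    rw [uIcc_of_le hab]
    exact (Complex.continuous_ofReal.comp_continuousOn (hA.mul hψc)).mul hosc
  have key := integral_eq_of_hasDerivAt_off_countable_of_le (fun t => (A t : ℂ) * osc (ψ t))
    (fun t => (A' t : ℂ) * osc (ψ t) - Complex.I * (((A t * ψ' t : ℝ) : ℂ) * osc (ψ t))) hab hS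
    ((Complex.continuous_ofReal.comp_continuousOn hA).mul hosc) ?_ (hi1.sub (hi2.const_mul _))
  · rw [intervalIntegral.integral_sub hi1 (hi2.const_mul _),
      intervalIntegral.integral_const_mul] at key
    rw [← key]; ring
  · intro t ht
    have h1 := (hA' t ht).ofReal_comp.mul (hψ t ⟨ht.1.1.le, ht.1.2.le⟩).osc
    refine h1.congr_deriv ?_
    push_cast; ring

lemma norm_integral_mul_osc_le {a b B : ℝ} (hab : a ≤ b) {w ψ : ℝ → ℝ}
    (hw : ∀ u ∈ Icc a b, |w u| ≤ B) :
    ‖∫ u in a..b, (w u : ℂ) * osc (ψ u)‖ ≤ B * (b - a) := by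
  have := intervalIntegral.norm_integral_le_of_norm_le_const (a := a) (b := b) (C := B)
    (f := fun u => (w u : ℂ) * osc (ψ u)) (fun u hu => by
      rw [uIoc_of_le hab] at hu
      rw [norm_mul, norm_osc, mul_one, Complex.norm_real]
      exact hw u ⟨hu.1.le, hu.2⟩)
  rwa [abs_of_nonneg (sub_nonneg.2 hab)] at this

/-- First order decay of an oscillatory integral with linear phase. -/
lemma norm_integral_mul_osc_linear_le {a b B s s₀ : ℝ} (hab : a ≤ b) {w w' : ℝ → ℝ}
    (hw : ∀ u ∈ Icc a b, HasDerivAt w (w' u) u) (hwc : ContinuousOn w' (Icc a b))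
    (hB : ∀ u ∈ Icc a b, |w u| ≤ B) (hB' : ∀ u ∈ Icc a b, |w' u| ≤ B) :
    ‖∫ u in a..b, (w u : ℂ) * osc (s₀ + u * s)‖ ≤ 2 * B * (1 + (b - a)) * (1 + |s|)⁻¹ := by
  have hB0 : 0 ≤ B := (abs_nonneg _).trans (hB a (left_mem_Icc.2 hab))
  have hψ : ∀ t ∈ Icc a b, HasDerivAt (fun u => s₀ + u * s) ((fun _ => s) t) t := fun t _ => by
    simpa using ((hasDerivAt_id t).mul_const s).const_add s₀
  have h := integral_deriv_mul_osc hab (S := ∅) countable_empty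
    (fun u hu => (hw u hu).continuousAt.continuousWithinAt)
    (fun t ht => hw t ⟨ht.1.1.le, ht.1.2.le⟩)
    (by apply ContinuousOn.intervalIntegrable; rwa [uIcc_of_le hab]) hψ continuousOn_const
  have h1 : ∫ t in a..b, ((w t * s : ℝ) : ℂ) * osc (s₀ + t * s) =
      s * ∫ t in a..b, (w t : ℂ) * osc (s₀ + t * s) := by
    rw [← intervalIntegral.integral_const_mul]
    congr 1; ext t; push_cast; ring
  rw [h1] at h
  have h2 : |s| * ‖∫ t in a..b, (w t : ℂ) * osc (s₀ + t * s)‖ ≤ B * (b - a) + (B + B) := by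
    have := congrArg norm h
    rw [norm_mul, norm_mul, Complex.norm_I, one_mul, Complex.norm_real, Real.norm_eq_abs] at this
    rw [this]
    refine (norm_sub_le _ _).trans (add_le_add (norm_integral_mul_osc_le hab hB') ?_)
    refine (norm_sub_le _ _).trans (add_le_add ?_ ?_) <;>
      rw [norm_mul, norm_osc, mul_one, Complex.norm_real]
    exacts [hB _ (right_mem_Icc.2 hab), hB _ (left_mem_Icc.2 hab)]
  -- Adding the trivial bound to the one obtained by parts replaces `|s|` by `1 + |s|`.
  have h3 := norm_integral_mul_osc_le (ψ := fun u => s₀ + u * s) hab hB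
  rw [← div_eq_mul_inv, le_div_iff₀ (by positivity)]
  nlinarith

/-- Second order decay of an oscillatory integral without stationary points, whose amplitude
vanishes to second order at the end points. -/
lemma norm_integral_mul_osc_le_sq {α β B C c ℓ R : ℝ} (hαβ : α ≤ β) {A₀ A₁ A₂ ψ P₀ P₁ P₂ : ℝ → ℝ}
    (hA₀ : ∀ u ∈ Icc α β, HasDerivAt A₀ (A₁ u) u) (hA₁ : ∀ u ∈ Icc α β, HasDerivAt A₁ (A₂ u) u)
    (hA₂ : ContinuousOn A₂ (Icc α β))
    (hψ : ∀ u ∈ Icc α β, HasDerivAt ψ (P₀ u) u)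
    (hP₀ : ∀ u ∈ Icc α β, HasDerivAt P₀ (P₁ u) u) (hP₁ : ∀ u ∈ Icc α β, HasDerivAt P₁ (P₂ u) u)
    (hP₂ : ContinuousOn P₂ (Icc α β))
    (hαA : A₀ α = 0 ∧ A₁ α = 0) (hβA : A₀ β = 0 ∧ A₁ β = 0)
    (hAB : ∀ u ∈ Icc α β, |A₀ u| ≤ B ∧ |A₁ u| ≤ B ∧ |A₂ u| ≤ B)
    (hPC : ∀ u ∈ Icc α β, |P₀ u| ≤ C * ℓ ∧ |P₁ u| ≤ C * ℓ ∧ |P₂ u| ≤ C * ℓ)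
    (hc : 0 < c) (hℓ : 0 < ℓ) (hPc : ∀ u ∈ Icc α β, c * ℓ ≤ |P₀ u|) :
    R ^ 2 * ℓ ^ 2 * ‖∫ u in α..β, (A₀ u : ℂ) * osc (R * ψ u)‖ ≤ 8 * B * C ^ 2 / c ^ 4 * (β - α) := by
  have hne : ∀ u ∈ Icc α β, P₀ u ≠ 0 := fun u hu h0 => by
    have := hPc u hu; rw [h0, abs_zero] at this; nlinarith [mul_pos hc hℓ]
  -- `D₁` and `D₂` are the amplitudes left by one and by two integrations by parts, namely the
  -- derivatives of `A₀ / P₀` and of `D₁ / P₀`. All end-point terms vanish because `A₀` and `A₁` do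
  -- there.
  set D₁ : ℝ → ℝ := fun u => (A₁ u * P₀ u - A₀ u * P₁ u) / P₀ u ^ 2 with hD₁
  set D₂ : ℝ → ℝ := fun u => ((A₂ u * P₀ u - A₀ u * P₂ u) * P₀ u
      - 3 * (A₁ u * P₀ u - A₀ u * P₁ u) * P₁ u) / P₀ u ^ 4 with hD₂
  have d1 : ∀ u ∈ Icc α β, HasDerivAt (fun u => A₀ u / P₀ u) (D₁ u) u := fun u hu =>
    (hA₀ u hu).div (hP₀ u hu) (hne u hu)
  have d2 : ∀ u ∈ Icc α β, HasDerivAt (fun u => D₁ u / P₀ u) (D₂ u) u := fun u hu => by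
    have n0 := hne u hu
    have e1 := (((hA₁ u hu).mul (hP₀ u hu)).sub ((hA₀ u hu).mul (hP₁ u hu))).div
      ((hP₀ u hu).pow 2) (pow_ne_zero 2 n0)
    have e2 := e1.div (hP₀ u hu) n0
    refine e2.congr_deriv ?_
    simp only [hD₂, Pi.sub_apply, Pi.mul_apply, Pi.pow_apply, Pi.div_apply]
    field_simp
    ring
  have cont : ∀ {f f' : ℝ → ℝ}, (∀ u ∈ Icc α β, HasDerivAt f (f' u) u) → ContinuousOn f (Icc α β) :=
    fun h u hu => (h u hu).continuousAt.continuousWithinAt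
  have cA0 := cont hA₀
  have cA1 := cont hA₁
  have cP0 := cont hP₀
  have cP1 := cont hP₁
  have cD1 : ContinuousOn D₁ (Icc α β) :=
    ((cA1.mul cP0).sub (cA0.mul cP1)).div (cP0.pow 2) fun u hu => pow_ne_zero 2 (hne u hu)
  have cD2 : ContinuousOn D₂ (Icc α β) :=
    ((((hA₂.mul cP0).sub (cA0.mul hP₂)).mul cP0).sub
      ((continuousOn_const.mul ((cA1.mul cP0).sub (cA0.mul cP1))).mul cP1)).div (cP0.pow 4)
      fun u hu => pow_ne_zero 4 (hne u hu)
  have hRψ : ∀ u ∈ Icc α β, HasDerivAt (fun u => R * ψ u) (R * P₀ u) u := fun u hu =>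
    (hψ u hu).const_mul R
  have ii : ∀ {f : ℝ → ℝ}, ContinuousOn f (Icc α β) → IntervalIntegrable f volume α β := fun h => by
    apply ContinuousOn.intervalIntegrable; rwa [uIcc_of_le hαβ]
  have k1 := integral_deriv_mul_osc hαβ (S := ∅) countable_empty (cont d1)
    (fun t ht => d1 t ⟨ht.1.1.le, ht.1.2.le⟩) (ii cD1) hRψ (continuousOn_const.mul cP0)
  have k2 := integral_deriv_mul_osc hαβ (S := ∅) countable_empty (cont d2)
    (fun t ht => d2 t ⟨ht.1.1.le, ht.1.2.le⟩) (ii cD2) hRψ (continuousOn_const.mul cP0)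
  have z1 : D₁ α = 0 := by simp [hD₁, hαA.1, hαA.2]
  have z2 : D₁ β = 0 := by simp [hD₁, hβA.1, hβA.2]
  have s1 : ∫ t in α..β, ((A₀ t / P₀ t * (R * P₀ t) : ℝ) : ℂ) * osc (R * ψ t) =
      R * ∫ t in α..β, (A₀ t : ℂ) * osc (R * ψ t) := by
    rw [← intervalIntegral.integral_const_mul]
    apply intervalIntegral.integral_congr
    intro t ht
    rw [uIcc_of_le hαβ] at ht
    have := hne t ht
    have e : A₀ t / P₀ t * (R * P₀ t) = R * A₀ t := by field_simp
    simp only [e]; push_cast; ring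
  have s2 : ∫ t in α..β, ((D₁ t / P₀ t * (R * P₀ t) : ℝ) : ℂ) * osc (R * ψ t) =
      R * ∫ t in α..β, (D₁ t : ℂ) * osc (R * ψ t) := by
    rw [← intervalIntegral.integral_const_mul]
    apply intervalIntegral.integral_congr
    intro t ht
    rw [uIcc_of_le hαβ] at ht
    have := hne t ht
    have e : D₁ t / P₀ t * (R * P₀ t) = R * D₁ t := by field_simp
    simp only [e]; push_cast; ring
  simp only [s1, hαA.1, hβA.1, zero_div, Complex.ofReal_zero, zero_mul, sub_zero] at k1
  simp only [s2, z1, z2, zero_div, Complex.ofReal_zero, zero_mul, sub_zero] at k2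
  rw [← k1] at k2
  have k3 := congrArg norm k2
  simp only [norm_mul, Complex.norm_I, one_mul, Complex.norm_real, Real.norm_eq_abs] at k3
  -- The numerator of `D₂` consists of `2 + 3 * 2 = 8` products, each at most `B (C ℓ)²`. The
  -- denominator is at least `(c ℓ)⁴`.
  have hD2b : ∀ u ∈ Icc α β, |D₂ u| ≤ 8 * B * C ^ 2 / c ^ 4 / ℓ ^ 2 := by
    intro u hu
    obtain ⟨a0, a1, a2⟩ := hAB u hu
    obtain ⟨p0, p1, p2⟩ := hPC u hu
    have pc := hPc u hu
    have hCℓ : 0 ≤ C * ℓ := (abs_nonneg _).trans p0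
    have hB0 : 0 ≤ B := (abs_nonneg _).trans a0
    have m : ∀ {x y X Y : ℝ}, |x| ≤ X → |y| ≤ Y → |x * y| ≤ X * Y := fun {x y X Y} hx hy => by
      rw [abs_mul]; exact mul_le_mul hx hy (abs_nonneg _) ((abs_nonneg _).trans hx)
    have sb : ∀ {x y X Y : ℝ}, |x| ≤ X → |y| ≤ Y → |x - y| ≤ X + Y := fun hx hy =>
      (abs_sub _ _).trans (add_le_add hx hy)
    have n1 := sb (m (sb (m a2 p0) (m a0 p2)) p0)
      (m (m (show |(3 : ℝ)| ≤ 3 by norm_num) (sb (m a1 p0) (m a0 p1))) p1)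
    rw [hD₂]; simp only []
    rw [abs_div, abs_pow, div_div, div_le_div_iff₀ (by have := hne u hu; positivity) (by positivity)]
    have e4 : (c * ℓ) ^ 4 ≤ |P₀ u| ^ 4 := pow_le_pow_left₀ (by positivity) pc 4
    calc _ ≤ (8 * B * C ^ 2 * ℓ ^ 2) * (c ^ 4 * ℓ ^ 2) :=
          mul_le_mul_of_nonneg_right (n1.trans (le_of_eq (by ring))) (by positivity)
      _ = 8 * B * C ^ 2 * (c * ℓ) ^ 4 := by ring
      _ ≤ _ := mul_le_mul_of_nonneg_left e4 (by positivity)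
  have k4 := norm_integral_mul_osc_le (ψ := fun u => R * ψ u) hαβ hD2b
  rw [← k3] at k4
  have : R ^ 2 * ℓ ^ 2 * ‖∫ u in α..β, (A₀ u : ℂ) * osc (R * ψ u)‖ =
      ℓ ^ 2 * (|R| * (|R| * ‖∫ u in α..β, (A₀ u : ℂ) * osc (R * ψ u)‖)) := by
    rw [← sq_abs R]; ring
  rw [this]
  calc _ ≤ ℓ ^ 2 * (8 * B * C ^ 2 / c ^ 4 / ℓ ^ 2 * (β - α)) :=
        mul_le_mul_of_nonneg_left k4 (by positivity)
    _ = _ := by field_simp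

/-! ### Real integral inequalities -/

/-- The Cauchy-Schwarz inequality for a weighted integral. -/
lemma sq_integral_mul_le {Ω : Type*} [MeasurableSpace Ω] {μ : Measure Ω} {m k : Ω → ℝ}
    (hm0 : ∀ᵐ x ∂μ, 0 ≤ m x) (hm : Integrable m μ) (hmk : Integrable (fun x => m x * k x) μ)
    (hmk2 : Integrable (fun x => m x * k x ^ 2) μ) :
    (∫ x, m x * k x ∂μ) ^ 2 ≤ (∫ x, m x ∂μ) * ∫ x, m x * k x ^ 2 ∂μ := by
  have h : ∀ l : ℝ, 0 ≤ (∫ x, m x ∂μ) * (l * l) + (-2 * ∫ x, m x * k x ∂μ) * l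
      + ∫ x, m x * k x ^ 2 ∂μ := by
    intro l
    have h0 : 0 ≤ ∫ x, m x * (k x - l) ^ 2 ∂μ :=
      integral_nonneg_of_ae (hm0.mono fun x hx => mul_nonneg hx (sq_nonneg _))
    have h1 : ∫ x, m x * (k x - l) ^ 2 ∂μ = ∫ x, ((m x * k x ^ 2 - 2 * l * (m x * k x))
        + l ^ 2 * m x) ∂μ := by congr 1; ext x; ring
    have i1 : Integrable (fun x => m x * k x ^ 2 - 2 * l * (m x * k x)) μ :=
      hmk2.sub (hmk.const_mul _)
    rw [h1, integral_add i1 (hm.const_mul _),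
      integral_sub hmk2 (hmk.const_mul _), integral_const_mul, integral_const_mul] at h0
    linarith
  have := discrim_le_zero h
  unfold discrim at this
  nlinarith

/-- The primitive is an arctangent. The bound is uniform in `t` and in the interval, as Schur's test
for the kernel in `exists_dualCurveInt_bound` requires. -/
lemma integral_one_div_one_add_sq_le {R a b t : ℝ} (hR : 0 < R) :
    ∫ s in a..b, 1 / (1 + R ^ 2 * (t - s) ^ 2) ≤ Real.pi / R := by
  have h : ∀ s ∈ uIcc a b, HasDerivAt (fun s => -(Real.arctan (R * (t - s)) / R))
      (1 / (1 + R ^ 2 * (t - s) ^ 2)) s := by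
    intro s _
    have h1 : HasDerivAt (fun s => R * (t - s)) (R * (0 - 1)) s :=
      ((hasDerivAt_const s t).sub (hasDerivAt_id s)).const_mul R
    refine ((h1.arctan).div_const R).neg.congr_deriv ?_
    have : 1 + R ^ 2 * (t - s) ^ 2 ≠ 0 := by positivity
    rw [mul_pow]; field_simp; ring
  rw [intervalIntegral.integral_eq_sub_of_hasDerivAt h]
  · have h1 := Real.arctan_lt_pi_div_two (R * (t - a))
    have h2 := Real.neg_pi_div_two_lt_arctan (R * (t - b))
    have : -(Real.arctan (R * (t - b)) / R) - -(Real.arctan (R * (t - a)) / R)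
      = (Real.arctan (R * (t - a)) - Real.arctan (R * (t - b))) / R := by ring
    rw [this]
    exact div_le_div_of_nonneg_right (by linarith) hR.le
  · apply Continuous.intervalIntegrable
    exact continuous_const.div (by fun_prop) fun s => by positivity

/-- A function whose derivative stays away from zero spends little time near its zeros. -/
lemma integral_one_div_one_add_sq_comp_le {R a b d : ℝ} (hR : 0 < R) (hab : a ≤ b) (hd : 0 < d)
    {g g' : ℝ → ℝ} (hg : ∀ s ∈ Icc a b, HasDerivAt g (g' s) s) (hgc : ContinuousOn g' (Icc a b))
    {σ : ℝ} (hσ : |σ| = 1) (hg' : ∀ s ∈ Icc a b, d ≤ σ * g' s) :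
    ∫ s in a..b, 1 / (1 + R ^ 2 * g s ^ 2) ≤ Real.pi / (d * R) := by
  have cg : ContinuousOn g (Icc a b) := fun s hs => (hg s hs).continuousAt.continuousWithinAt
  have c1 : ContinuousOn (fun s => 1 / (1 + R ^ 2 * g s ^ 2)) (Icc a b) :=
    continuousOn_const.div (continuousOn_const.add (continuousOn_const.mul (cg.pow 2)))
      fun s _ => by positivity
  have c2 : ContinuousOn (fun s => σ * g' s / (d * (1 + R ^ 2 * g s ^ 2))) (Icc a b) :=
    (continuousOn_const.mul hgc).div (continuousOn_const.mul
      (continuousOn_const.add (continuousOn_const.mul (cg.pow 2)))) fun s _ => by positivity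
  have ii : ∀ {f : ℝ → ℝ}, ContinuousOn f (Icc a b) → IntervalIntegrable f volume a b := fun h => by
    apply ContinuousOn.intervalIntegrable; rwa [uIcc_of_le hab]
  have h : ∀ s ∈ uIcc a b, HasDerivAt (fun s => σ * (Real.arctan (R * g s) / (d * R)))
      (σ * g' s / (d * (1 + R ^ 2 * g s ^ 2))) s := by
    intro s hs
    rw [uIcc_of_le hab] at hs
    refine ((((hg s hs).const_mul R).arctan).div_const (d * R)).const_mul σ |>.congr_deriv ?_
    have : 1 + R ^ 2 * g s ^ 2 ≠ 0 := by positivity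
    rw [mul_pow]; field_simp
  calc ∫ s in a..b, 1 / (1 + R ^ 2 * g s ^ 2)
      ≤ ∫ s in a..b, σ * g' s / (d * (1 + R ^ 2 * g s ^ 2)) := by
        apply intervalIntegral.integral_mono_on hab (ii c1) (ii c2)
        intro s hs
        rw [div_le_div_iff₀ (by positivity) (by positivity), one_mul]
        exact mul_le_mul_of_nonneg_right (hg' s hs) (by positivity)
    _ = σ * ((Real.arctan (R * g b) - Real.arctan (R * g a)) / (d * R)) := by
        rw [intervalIntegral.integral_eq_sub_of_hasDerivAt h (ii c2)]; ring
    _ ≤ |σ * ((Real.arctan (R * g b) - Real.arctan (R * g a)) / (d * R))| := le_abs_self _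
    _ ≤ Real.pi / (d * R) := by
        rw [abs_mul, hσ, one_mul, abs_div, abs_of_pos (mul_pos hd hR)]
        refine div_le_div_of_nonneg_right ?_ (by positivity)
        have h1 := Real.arctan_lt_pi_div_two (R * g a)
        have h2 := Real.neg_pi_div_two_lt_arctan (R * g a)
        have h3 := Real.arctan_lt_pi_div_two (R * g b)
        have h4 := Real.neg_pi_div_two_lt_arctan (R * g b)
        rw [abs_le]; constructor <;> linarith

/-! ### Iterated interval integrals -/

lemma intervalIntegral_swap {E : Type*} [NormedAddCommGroup E] [NormedSpace ℝ E]
    {f : ℝ → ℝ → E} {a b c d : ℝ} (hab : a ≤ b) (hcd : c ≤ d)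
    (h : Integrable (Function.uncurry f)
      ((volume.restrict (Ioc a b)).prod (volume.restrict (Ioc c d)))) :
    ∫ x in a..b, ∫ y in c..d, f x y = ∫ y in c..d, ∫ x in a..b, f x y := by
  simp only [intervalIntegral.integral_of_le hab, intervalIntegral.integral_of_le hcd]
  exact integral_integral_swap h

lemma ContinuousOn.integrable_prod_Ioc {E : Type*} [NormedAddCommGroup E]
    {f : ℝ × ℝ → E} {a b c d : ℝ} (h : ContinuousOn f (Icc a b ×ˢ Icc c d)) :
    Integrable f ((volume.restrict (Ioc a b)).prod (volume.restrict (Ioc c d))) := by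
  rw [Measure.prod_restrict]
  have : IntegrableOn f (Icc a b ×ˢ Icc c d) (volume.prod volume) :=
    h.integrableOn_compact (isCompact_Icc.prod isCompact_Icc)
  exact this.mono_set (prod_mono Ioc_subset_Icc_self Ioc_subset_Icc_self)

/-- The mean value theorem in the form of an equation. -/
lemma exists_sub_eq_deriv_mul {h h' : ℝ → ℝ} {a b : ℝ}
    (hh : ∀ t ∈ Icc a b, HasDerivAt h (h' t) t) {s t : ℝ} (hs : s ∈ Icc a b) (ht : t ∈ Icc a b) :
    ∃ r ∈ Icc a b, h s - h t = h' r * (s - t) := by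
  have main : ∀ s ∈ Icc a b, ∀ t ∈ Icc a b, s < t → ∃ r ∈ Icc a b, h s - h t = h' r * (s - t) := by
    intro s hs t ht hst
    have sub : Icc s t ⊆ Icc a b := Icc_subset_Icc hs.1 ht.2
    obtain ⟨r, hr, e⟩ := exists_hasDerivAt_eq_slope h h' hst
      (fun x hx => (hh x (sub hx)).continuousAt.continuousWithinAt)
      (fun x hx => hh x (sub (Ioo_subset_Icc_self hx)))
    refine ⟨r, sub (Ioo_subset_Icc_self hr), ?_⟩
    rw [e]; have : t - s ≠ 0 := by linarith
    field_simp; ring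
  rcases lt_trichotomy s t with hst | rfl | hst
  · exact main s hs t ht hst
  · exact ⟨s, hs, by simp⟩
  · obtain ⟨r, hr, e⟩ := main t ht s hs hst
    exact ⟨r, hr, by linarith⟩

/-! ### Functions with bounded first and second derivatives -/

/-- `f₁` and `f₂` are the first two derivatives of `f` on `s`, and all are bounded by `B`. -/
structure BoundedTwoJet (s : Set ℝ) (B : ℝ) (f f₁ f₂ : ℝ → ℝ) : Prop where
  deriv_one : ∀ u ∈ s, HasDerivAt f (f₁ u) u
  deriv_two : ∀ u ∈ s, HasDerivAt f₁ (f₂ u) u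
  cont : ContinuousOn f₂ s
  bound : ∀ u ∈ s, |f u| ≤ B ∧ |f₁ u| ≤ B ∧ |f₂ u| ≤ B

lemma BoundedTwoJet.mul {s : Set ℝ} {B C : ℝ} {f f₁ f₂ g g₁ g₂ : ℝ → ℝ}
    (hf : BoundedTwoJet s B f f₁ f₂) (hg : BoundedTwoJet s C g g₁ g₂) :
    BoundedTwoJet s (4 * B * C) (fun u => f u * g u) (fun u => f₁ u * g u + f u * g₁ u)
      (fun u => f₂ u * g u + 2 * (f₁ u * g₁ u) + f u * g₂ u) := by
  have cont : ∀ {f f' : ℝ → ℝ}, (∀ u ∈ s, HasDerivAt f (f' u) u) → ContinuousOn f s :=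
    fun h u hu => (h u hu).continuousAt.continuousWithinAt
  refine ⟨fun u hu => (hf.1 u hu).mul (hg.1 u hu), fun u hu => ?_, ?_, fun u hu => ?_⟩
  · refine (((hf.2 u hu).mul (hg.1 u hu)).add ((hf.1 u hu).mul (hg.2 u hu))).congr_deriv ?_
    ring
  · exact ((hf.3.mul (cont hg.1)).add (continuousOn_const.mul ((cont hf.2).mul (cont hg.2)))).add
      ((cont hf.1).mul hg.3)
  · obtain ⟨a0, a1, a2⟩ := hf.4 u hu
    obtain ⟨b0, b1, b2⟩ := hg.4 u hu
    have hB := (abs_nonneg _).trans a0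
    have hC := (abs_nonneg _).trans b0
    have m : ∀ {x y : ℝ}, |x| ≤ B → |y| ≤ C → |x * y| ≤ B * C := fun {x y} hx hy => by
      rw [abs_mul]; exact mul_le_mul hx hy (abs_nonneg _) hB
    have hBC : 0 ≤ B * C := mul_nonneg hB hC
    refine ⟨(m a0 b0).trans (by linarith), ?_, ?_⟩
    · refine (abs_add_le _ _).trans ?_
      linarith [m a1 b0, m a0 b1]
    · refine (abs_add_le _ _).trans ((add_le_add_left (abs_add_le _ _) _).trans ?_)
      rw [abs_mul 2, abs_two]
      linarith [m a2 b0, m a1 b1, m a0 b2]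

/-- The square of the quadratic bump vanishing at `α` and `β`. -/
lemma boundedTwoJet_bump {α β : ℝ} (hαβ : α ≤ β) (h7 : β - α ≤ 7) :
    BoundedTwoJet (Icc α β) 2401 (fun u => ((u - α) * (β - u)) ^ 2)
      (fun u => 2 * ((u - α) * (β - u)) * (α + β - 2 * u))
      (fun u => 2 * (α + β - 2 * u) ^ 2 - 4 * ((u - α) * (β - u))) := by
  have d0 : ∀ u, HasDerivAt (fun u => (u - α) * (β - u)) (α + β - 2 * u) u := fun u => by
    refine (((hasDerivAt_id u).sub_const α).mul ((hasDerivAt_id u).const_sub β)).congr_deriv ?_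
    simp; ring
  have d1 : ∀ u, HasDerivAt (fun u => (α + β - 2 * u)) (-2) u := fun u => by
    simpa using ((hasDerivAt_id u).const_mul 2).const_sub (α + β)
  refine ⟨fun u _ => ?_, fun u _ => ?_, by fun_prop, fun u hu => ?_⟩
  · refine ((d0 u).pow 2).congr_deriv ?_
    simp
  · refine (((d0 u).const_mul 2).mul (d1 u)).congr_deriv ?_
    ring
  -- The quadratic factor is at most `7² = 49`, so its square is at most `2401`; this also exceeds
  -- the bounds `2 * 49 * 7` and `2 * 49 + 4 * 49` for the two derivatives.
  · have h1 : 0 ≤ u - α := by linarith [hu.1]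
    have h2 : 0 ≤ β - u := by linarith [hu.2]
    have h3 : u - α ≤ 7 := by linarith [hu.2]
    have h4 : β - u ≤ 7 := by linarith [hu.1]
    have h5 : 0 ≤ (u - α) * (β - u) := mul_nonneg h1 h2
    have h6 : (u - α) * (β - u) ≤ 49 := by nlinarith
    have h8 : |α + β - 2 * u| ≤ 7 := by rw [abs_le]; constructor <;> linarith
    have h9 : (α + β - 2 * u) ^ 2 ≤ 49 := by rw [← sq_abs]; nlinarith [abs_nonneg (α + β - 2 * u)]
    refine ⟨?_, ?_, ?_⟩
    · rw [abs_of_nonneg (sq_nonneg _)]; nlinarith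
    · rw [abs_mul, abs_of_nonneg (by linarith : 0 ≤ 2 * ((u - α) * (β - u)))]
      nlinarith [abs_nonneg (α + β - 2 * u)]
    · rw [abs_le]; constructor <;> nlinarith [sq_nonneg (α + β - 2 * u)]

/-! ### The normal coordinates of a curve -/

/-- The normal strip of half-width `width` of the unit speed curve `(X, Y)` with tangent `(p, q)`,
normal `(q, -p)` and curvature `c`, together with a density `F` along the curve. -/
structure NormalStrip where
  (X Y p q c c' F F' : ℝ → ℝ)
  (len width : ℝ)
  S : Set ℝ
  len_pos : 0 < len
  width_pos : 0 < width
  cont_X : Continuous X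
  cont_Y : Continuous Y
  cont_p : Continuous p
  cont_q : Continuous q
  cont_c : Continuous c
  cont_F : Continuous F
  cont_F' : Continuous F'
  deriv_X : ∀ t ∈ Icc 0 len, HasDerivAt X (p t) t
  deriv_Y : ∀ t ∈ Icc 0 len, HasDerivAt Y (q t) t
  deriv_p : ∀ t ∈ Icc 0 len, HasDerivAt p (-(c t * q t)) t
  deriv_q : ∀ t ∈ Icc 0 len, HasDerivAt q (c t * p t) t
  deriv_F : ∀ t ∈ Icc 0 len, HasDerivAt F (F' t) t
  unit : ∀ t ∈ Icc 0 len, p t ^ 2 + q t ^ 2 = 1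
  countable : S.Countable
  deriv_c : ∀ t ∈ Ioo 0 len \ S, HasDerivAt c (c' t) t
  int_c' : IntervalIntegrable c' volume 0 len
  regular : ∀ t ∈ Icc 0 len, ∀ u ∈ Icc (-width) width, 0 < 1 + u * c t

namespace NormalStrip

variable (A : NormalStrip)

/-- The normal component of the direction `φ`. -/
def nor (t φ : ℝ) : ℝ := Real.cos φ * A.q t - Real.sin φ * A.p t

/-- The tangential component of the direction `φ`. -/
def tan (t φ : ℝ) : ℝ := Real.cos φ * A.p t + Real.sin φ * A.q t

/-- The phase in direction `φ` at the point with normal coordinates `(t, u)`. -/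
def phase (u t φ : ℝ) : ℝ :=
  Real.cos φ * (A.X t + u * A.q t) + Real.sin φ * (A.Y t - u * A.p t)

/-- The derivative of the phase with respect to the direction. -/
def phase' (u t φ : ℝ) : ℝ :=
  -Real.sin φ * (A.X t + u * A.q t) + Real.cos φ * (A.Y t - u * A.p t)

/-- The oscillatory integral over the part `[t₁, t₂]` of a parallel curve. -/
def curveInt (R t₁ t₂ u φ : ℝ) : ℂ := ∫ t in t₁..t₂, (A.F t : ℂ) * osc (R * A.phase u t φ)

/-- The oscillatory integral over a rectangle in normal coordinates. -/
def stripInt (R t₁ t₂ a b φ : ℝ) : ℂ := ∫ u in a..b, A.curveInt R t₁ t₂ u φ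

lemma nor_sq_add_tan_sq {t : ℝ} (ht : t ∈ Icc 0 A.len) (φ : ℝ) : A.nor t φ ^ 2 + A.tan t φ ^ 2 = 1 := by
  have h1 := A.unit t ht
  have h2 := Real.cos_sq_add_sin_sq φ
  unfold nor tan
  calc _ = (Real.cos φ ^ 2 + Real.sin φ ^ 2) * (A.p t ^ 2 + A.q t ^ 2) := by ring
    _ = 1 := by rw [h1, h2, one_mul]

lemma abs_nor_le {t : ℝ} (ht : t ∈ Icc 0 A.len) (φ : ℝ) : |A.nor t φ| ≤ 1 := by
  rw [← sq_le_one_iff_abs_le_one]; nlinarith [A.nor_sq_add_tan_sq ht φ, sq_nonneg (A.tan t φ)]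

lemma abs_tan_le {t : ℝ} (ht : t ∈ Icc 0 A.len) (φ : ℝ) : |A.tan t φ| ≤ 1 := by
  rw [← sq_le_one_iff_abs_le_one]; nlinarith [A.nor_sq_add_tan_sq ht φ, sq_nonneg (A.nor t φ)]

lemma hasDerivAt_nor (t φ : ℝ) : HasDerivAt (A.nor t) (-A.tan t φ) φ := by
  refine (((Real.hasDerivAt_cos φ).mul_const _).sub
    ((Real.hasDerivAt_sin φ).mul_const _)).congr_deriv ?_
  unfold tan; ring

lemma hasDerivAt_tan (t φ : ℝ) : HasDerivAt (A.tan t) (A.nor t φ) φ := by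
  refine (((Real.hasDerivAt_cos φ).mul_const _).add
    ((Real.hasDerivAt_sin φ).mul_const _)).congr_deriv ?_
  unfold nor; ring

lemma hasDerivAt_phase (u t φ : ℝ) : HasDerivAt (A.phase u t) (A.phase' u t φ) φ :=
  ((Real.hasDerivAt_cos φ).mul_const _).add ((Real.hasDerivAt_sin φ).mul_const _)

lemma hasDerivAt_phase' (u t φ : ℝ) : HasDerivAt (A.phase' u t) (-A.phase u t φ) φ := by
  refine (((Real.hasDerivAt_sin φ).neg.mul_const _).add
    ((Real.hasDerivAt_cos φ).mul_const _)).congr_deriv ?_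
  unfold phase; ring

/-- The parallel curve at height `u` has velocity `1 + u c` times the unit tangent of the base
curve. Along it the phase is therefore stationary only in normal directions, and there the angular
derivative of the phase (next lemma) is strictly monotone. The two cases of the estimate rest on
this. -/
lemma hasDerivAt_phase_param (u φ : ℝ) {t : ℝ} (ht : t ∈ Icc 0 A.len) :
    HasDerivAt (fun t => A.phase u t φ) ((1 + u * A.c t) * A.tan t φ) t := by
  refine ((((A.deriv_X t ht).add ((A.deriv_q t ht).const_mul u)).const_mul _).add
    (((A.deriv_Y t ht).sub ((A.deriv_p t ht).const_mul u)).const_mul _)).congr_deriv ?_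
  unfold tan; ring

lemma hasDerivAt_phase'_param (u φ : ℝ) {t : ℝ} (ht : t ∈ Icc 0 A.len) :
    HasDerivAt (fun t => A.phase' u t φ) ((1 + u * A.c t) * A.nor t φ) t := by
  refine ((((A.deriv_X t ht).add ((A.deriv_q t ht).const_mul u)).const_mul _).add
    (((A.deriv_Y t ht).sub ((A.deriv_p t ht).const_mul u)).const_mul _)).congr_deriv ?_
  unfold nor; ring

lemma hasDerivAt_tan_param (φ : ℝ) {t : ℝ} (ht : t ∈ Icc 0 A.len) :
    HasDerivAt (fun t => A.tan t φ) (-(A.c t * A.nor t φ)) t := by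
  refine (((A.deriv_p t ht).const_mul _).add ((A.deriv_q t ht).const_mul _)).congr_deriv ?_
  unfold nor; ring

/-- Across the strip the phase is linear with slope `nor`, so integrals in `u` at fixed `t` have a
linear phase. -/
lemma phase_eq (u t φ : ℝ) : A.phase u t φ = A.phase 0 t φ + u * A.nor t φ := by
  unfold phase nor; ring

lemma continuous_nor : Continuous fun z : ℝ × ℝ => A.nor z.1 z.2 := by
  have := A.cont_p; have := A.cont_q
  unfold nor; fun_prop

lemma continuous_tan : Continuous fun z : ℝ × ℝ => A.tan z.1 z.2 := by
  have := A.cont_p; have := A.cont_q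
  unfold tan; fun_prop

lemma continuous_phase : Continuous fun z : ℝ × ℝ × ℝ => A.phase z.1 z.2.1 z.2.2 := by
  have := A.cont_p; have := A.cont_q; have := A.cont_X; have := A.cont_Y
  unfold phase; fun_prop

lemma continuous_curveInt (R t₁ t₂ : ℝ) : Continuous fun z : ℝ × ℝ => A.curveInt R t₁ t₂ z.1 z.2 := by
  unfold curveInt
  apply intervalIntegral.continuous_parametric_intervalIntegral_of_continuous'
  have h := A.continuous_phase
  have h1 : Continuous fun z : (ℝ × ℝ) × ℝ => A.phase z.1.1 z.2 z.1.2 :=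
    h.comp (f := fun z : (ℝ × ℝ) × ℝ => (z.1.1, z.2, z.1.2)) (by fun_prop)
  have h2 := continuous_osc
  have h3 := A.cont_F
  have h4 : Continuous fun z : (ℝ × ℝ) × ℝ => osc (R * A.phase z.1.1 z.2 z.1.2) :=
    h2.comp (continuous_const.mul h1)
  exact (Complex.continuous_ofReal.comp (h3.comp continuous_snd)).mul h4

lemma continuous_stripInt (R t₁ t₂ a b : ℝ) : Continuous (A.stripInt R t₁ t₂ a b) := by
  unfold stripInt
  apply intervalIntegral.continuous_parametric_intervalIntegral_of_continuous'
  exact (A.continuous_curveInt R t₁ t₂).comp (f := fun z : ℝ × ℝ => (z.2, z.1)) (by fun_prop)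

/-- Uniform bounds for the data of a normal strip. -/
lemma exists_bounds : ∃ M d : ℝ, 1 ≤ M ∧ 0 < d ∧ (∀ t ∈ Icc 0 A.len, |A.F t| ≤ M ∧ |A.F' t| ≤ M ∧
    |A.c t| ≤ M) ∧ ∀ t ∈ Icc 0 A.len, ∀ u ∈ Icc (-A.width) A.width,
      d ≤ 1 + u * A.c t ∧ 1 + u * A.c t ≤ M := by
  have bd : ∀ f : ℝ → ℝ, Continuous f → ∃ M, ∀ t ∈ Icc 0 A.len, |f t| ≤ M := fun f hf => by
    obtain ⟨M, hM⟩ := isCompact_Icc.exists_bound_of_continuousOn (s := Icc 0 A.len) hf.continuousOn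
    exact ⟨M, hM⟩
  obtain ⟨M₁, h1⟩ := bd A.F A.cont_F
  obtain ⟨M₂, h2⟩ := bd A.F' A.cont_F'
  obtain ⟨M₃, h3⟩ := bd A.c A.cont_c
  have hcont : Continuous fun z : ℝ × ℝ => 1 + z.2 * A.c z.1 := by
    have := A.cont_c; fun_prop
  have hcomp : IsCompact (Icc 0 A.len ×ˢ Icc (-A.width) A.width) := isCompact_Icc.prod isCompact_Icc
  have hne : (Icc 0 A.len ×ˢ Icc (-A.width) A.width).Nonempty :=
    (nonempty_Icc.2 A.len_pos.le).prod (nonempty_Icc.2 (by linarith [A.width_pos]))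
  obtain ⟨z, hz, hmin⟩ := hcomp.exists_isMinOn hne hcont.continuousOn
  obtain ⟨w, hw, hmax⟩ := hcomp.exists_isMaxOn hne hcont.continuousOn
  refine ⟨max 1 (max M₁ (max M₂ (max M₃ (1 + w.2 * A.c w.1)))), 1 + z.2 * A.c z.1, le_max_left _ _,
    A.regular z.1 hz.1 z.2 hz.2, fun t ht => ⟨(h1 t ht).trans (by simp), (h2 t ht).trans (by simp),
      (h3 t ht).trans (by simp)⟩, fun t ht u hu => ⟨?_, ?_⟩⟩
  · exact hmin (show (t, u) ∈ _ from ⟨ht, hu⟩)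
  · exact (show 1 + u * A.c t ≤ 1 + w.2 * A.c w.1 from
      hmax (show (t, u) ∈ _ from ⟨ht, hu⟩)).trans (by simp)

end NormalStrip

/-! ### Nearly tangential directions: pointwise decay. -/

namespace NormalStrip

variable (A : NormalStrip)

/-- The transversal integral of the amplitudes that occur in the integration by parts. -/
lemma norm_transversal_integral_le {x M d w a b A₁ A₂ s s₀ : ℝ} (hd : 0 < d) (hw : 0 ≤ w)
    (hx : |x| ≤ M) (hab : a ≤ b) (ha : -w ≤ a) (hb : b ≤ w)
    (hreg : ∀ u ∈ Icc a b, d ≤ 1 + u * x) :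
    ‖∫ u in a..b, ((A₁ / (1 + u * x) + A₂ * (u / (1 + u * x) ^ 2) : ℝ) : ℂ) * osc (s₀ + u * s)‖ ≤
      2 * ((|A₁| + |A₂|) * (1 / d + M / d ^ 2 + w / d ^ 2 + 1 / d ^ 2 + 2 * w * M / d ^ 3))
        * (1 + 2 * w) * (1 + |s|)⁻¹ := by
  have hM : 0 ≤ M := (abs_nonneg _).trans hx
  set D := 1 / d + M / d ^ 2 + w / d ^ 2 + 1 / d ^ 2 + 2 * w * M / d ^ 3 with hD
  have q1 : 0 ≤ 1 / d := by positivity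
  have q2 : 0 ≤ M / d ^ 2 := by positivity
  have q3 : 0 ≤ w / d ^ 2 := by positivity
  have q4 : 0 ≤ 1 / d ^ 2 := by positivity
  have q5 : 0 ≤ 2 * w * M / d ^ 3 := by positivity
  have hD0 : 0 ≤ D := by positivity
  have hpos : ∀ u ∈ Icc a b, 0 < 1 + u * x := fun u hu => hd.trans_le (hreg u hu)
  have hu' : ∀ u ∈ Icc a b, |u| ≤ w := fun u hu => abs_le.2 ⟨ha.trans hu.1, hu.2.trans hb⟩
  have hlin : ∀ u, HasDerivAt (fun u : ℝ => 1 + u * x) x u := fun u => by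
    simpa using ((hasDerivAt_id u).mul_const x).const_add 1
  have inv : ∀ n : ℕ, ∀ u ∈ Icc a b, 1 / (1 + u * x) ^ n ≤ 1 / d ^ n := fun n u hu =>
    one_div_le_one_div_of_le (by positivity) (pow_le_pow_left₀ hd.le (hreg u hu) n)
  have key := norm_integral_mul_osc_linear_le (B := (|A₁| + |A₂|) * D) (s := s) (s₀ := s₀) hab
    (w := fun u => A₁ / (1 + u * x) + A₂ * (u / (1 + u * x) ^ 2))
    (w' := fun u => A₁ * (-x / (1 + u * x) ^ 2)
      + A₂ * (1 / (1 + u * x) ^ 2 - 2 * u * x / (1 + u * x) ^ 3)) ?_ ?_ ?_ ?_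
  · refine key.trans ?_
    gcongr
    linarith
  · intro u hu
    have h0 := (hpos u hu).ne'
    refine (((hasDerivAt_const u A₁).div (hlin u) h0).add
      (((hasDerivAt_id u).div ((hlin u).pow 2) (pow_ne_zero 2 h0)).const_mul A₂)).congr_deriv ?_
    simp only [Pi.pow_apply, id]
    field_simp
    ring
  · have h1 : ContinuousOn (fun u : ℝ => 1 + u * x) (Icc a b) := by fun_prop
    exact (continuousOn_const.mul (continuousOn_const.div (h1.pow 2)
      fun u hu => pow_ne_zero 2 (hpos u hu).ne')).add
      (continuousOn_const.mul ((continuousOn_const.div (h1.pow 2)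
        fun u hu => pow_ne_zero 2 (hpos u hu).ne').sub
        (ContinuousOn.div (by fun_prop) (h1.pow 3) fun u hu => pow_ne_zero 3 (hpos u hu).ne')))
  · intro u hu
    have h0 := hpos u hu
    have e1 : |A₁ / (1 + u * x)| ≤ |A₁| * D := by
      rw [abs_div, abs_of_pos h0, div_eq_mul_one_div]
      refine mul_le_mul_of_nonneg_left ?_ (abs_nonneg _)
      have := inv 1 u hu; simp only [pow_one] at this; linarith
    have e2 : |A₂ * (u / (1 + u * x) ^ 2)| ≤ |A₂| * D := by
      rw [abs_mul, abs_div, abs_of_pos (pow_pos h0 2)]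
      refine mul_le_mul_of_nonneg_left ?_ (abs_nonneg _)
      have : |u| / (1 + u * x) ^ 2 ≤ w / d ^ 2 :=
        div_le_div₀ hw (hu' u hu) (by positivity) (pow_le_pow_left₀ hd.le (hreg u hu) 2)
      linarith
    exact (abs_add_le _ _).trans (by linarith)
  · intro u hu
    have h0 := hpos u hu
    have e1 : |A₁ * (-x / (1 + u * x) ^ 2)| ≤ |A₁| * D := by
      rw [abs_mul, abs_div, abs_of_pos (pow_pos h0 2), abs_neg]
      refine mul_le_mul_of_nonneg_left ?_ (abs_nonneg _)
      have : |x| / (1 + u * x) ^ 2 ≤ M / d ^ 2 :=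
        div_le_div₀ hM hx (by positivity) (pow_le_pow_left₀ hd.le (hreg u hu) 2)
      linarith
    have e2 : |A₂ * (1 / (1 + u * x) ^ 2 - 2 * u * x / (1 + u * x) ^ 3)| ≤ |A₂| * D := by
      rw [abs_mul]
      refine mul_le_mul_of_nonneg_left ?_ (abs_nonneg _)
      refine (abs_sub _ _).trans ?_
      rw [abs_of_pos (by positivity : 0 < 1 / (1 + u * x) ^ 2), abs_div, abs_of_pos (pow_pos h0 3)]
      have i1 := inv 2 u hu
      have : |2 * u * x| / (1 + u * x) ^ 3 ≤ 2 * w * M / d ^ 3 := by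
        refine div_le_div₀ (by positivity) ?_ (by positivity) (pow_le_pow_left₀ hd.le (hreg u hu) 3)
        rw [abs_mul, abs_mul, abs_two]
        have := hu' u hu
        gcongr
      linarith
    exact (abs_add_le _ _).trans (by linarith)

/-- In nearly tangential directions the oscillatory integral over a rectangle in normal
coordinates is controlled by the decay across the strip. -/
lemma exists_norm_stripInt_le : ∃ C : ℝ, 0 ≤ C ∧ ∀ t₁ t₂ : ℝ, 0 ≤ t₁ → t₁ ≤ t₂ → t₂ ≤ A.len →
    ∀ φ, (∀ t ∈ Icc t₁ t₂, 1 / 4 ≤ |A.tan t φ|) → ∀ R : ℝ, 0 < R → ∀ a b : ℝ, -A.width ≤ a → a ≤ b →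
    b ≤ A.width → R * ‖A.stripInt R t₁ t₂ a b φ‖ ≤
      C * ((1 + |R * A.nor t₁ φ|)⁻¹ + (1 + |R * A.nor t₂ φ|)⁻¹ +
        ∫ t in t₁..t₂, (1 + |A.c' t|) * (1 + |R * A.nor t φ|)⁻¹) := by
  obtain ⟨M, d, hM, hd, hbd, hreg⟩ := A.exists_bounds
  have hM0 : 0 ≤ M := by linarith
  set w := A.width
  have hw : 0 ≤ w := A.width_pos.le
  set D := 1 / d + M / d ^ 2 + w / d ^ 2 + 1 / d ^ 2 + 2 * w * M / d ^ 3
  have hD0 : 0 ≤ D := by positivity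
  -- The number 24 comes from `|a₁| ≤ 20 M²` and `|a₂| ≤ 4 M` below; it also covers the end-point
  -- amplitude `|F / tan| ≤ 4 M`.
  refine ⟨2 * (24 * M ^ 2 * D) * (1 + 2 * w), by positivity, ?_⟩
  intro t₁ t₂ ht₁ ht ht₂ φ hT R hR a b ha hab hb
  have hsub : Icc t₁ t₂ ⊆ Icc 0 A.len := Icc_subset_Icc ht₁ ht₂
  have hsubu : Icc a b ⊆ Icc (-w) w := Icc_subset_Icc ha hb
  have hT0 : ∀ t ∈ Icc t₁ t₂, A.tan t φ ≠ 0 := fun t h h0 => by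
    have := hT t h; rw [h0, abs_zero] at this; linarith
  have hpos : ∀ t ∈ Icc t₁ t₂, ∀ u ∈ Icc a b, 0 < 1 + u * A.c t := fun t h u hu =>
    A.regular t (hsub h) u (hsubu hu)
  -- the amplitudes
  set a₁ : ℝ → ℝ := fun t => A.F' t / A.tan t φ + A.F t * A.c t * A.nor t φ / A.tan t φ ^ 2 with ha₁
  set a₂ : ℝ → ℝ := fun t => -(A.F t / A.tan t φ) with ha₂
  have hTinv : ∀ t ∈ Icc t₁ t₂, 1 / |A.tan t φ| ≤ 4 := fun t h => by
    have := hT t h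
    rw [div_le_iff₀ (by linarith)]; linarith
  have hFT : ∀ t ∈ Icc t₁ t₂, |A.F t / A.tan t φ| ≤ 4 * M := fun t h => by
    rw [abs_div, div_eq_mul_one_div, mul_comm]
    exact mul_le_mul (hTinv t h) (hbd t (hsub h)).1 (abs_nonneg _) (by norm_num)
  have ha₁b : ∀ t ∈ Icc t₁ t₂, |a₁ t| ≤ 20 * M ^ 2 := fun t h => by
    have e1 : |A.F' t / A.tan t φ| ≤ 4 * M := by
      rw [abs_div, div_eq_mul_one_div, mul_comm]
      exact mul_le_mul (hTinv t h) (hbd t (hsub h)).2.1 (abs_nonneg _) (by norm_num)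
    have e2 : |A.F t * A.c t * A.nor t φ / A.tan t φ ^ 2| ≤ 16 * M ^ 2 := by
      have : A.F t * A.c t * A.nor t φ / A.tan t φ ^ 2 =
        (A.F t * A.c t) * A.nor t φ * (1 / A.tan t φ * (1 / A.tan t φ)) := by
        have := hT0 t h
        field_simp
      rw [this, abs_mul, abs_mul, abs_mul, abs_mul, abs_div, abs_one]
      have b1 := (hbd t (hsub h)).1
      have b2 := (hbd t (hsub h)).2.2
      have b3 := A.abs_nor_le (hsub h) φ
      have b4 := hTinv t h
      calc _ ≤ (M * M) * 1 * (4 * 4) := by gcongr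
        _ = _ := by ring
    refine (abs_add_le _ _).trans ?_
    nlinarith
  -- This is the `t`-derivative of `F / (tan * (1 + u c))`, arranged so that `c'`, which need not be
  -- bounded, enters linearly, and so that for fixed `t` it is an amplitude of the kind treated in
  -- `norm_transversal_integral_le`.
  set W : ℝ → ℝ → ℝ := fun u t => a₁ t / (1 + u * A.c t) + A.c' t * a₂ t * (u / (1 + u * A.c t) ^ 2)
    with hW
  -- continuity
  have cT : ContinuousOn (fun t => A.tan t φ) (Icc t₁ t₂) :=
    (A.continuous_tan.comp (f := fun t => (t, φ)) (by fun_prop)).continuousOn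
  have cN : ContinuousOn (fun t => A.nor t φ) (Icc t₁ t₂) :=
    (A.continuous_nor.comp (f := fun t => (t, φ)) (by fun_prop)).continuousOn
  have ca₁ : ContinuousOn a₁ (Icc t₁ t₂) := (A.cont_F'.continuousOn.div cT hT0).add
    (((A.cont_F.continuousOn.mul A.cont_c.continuousOn).mul cN).div (cT.pow 2)
      fun t h => pow_ne_zero 2 (hT0 t h))
  have ca₂ : ContinuousOn a₂ (Icc t₁ t₂) := (A.cont_F.continuousOn.div cT hT0).neg
  have cphase : Continuous fun z : ℝ × ℝ => osc (R * A.phase z.1 z.2 φ) :=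
    continuous_osc.comp (continuous_const.mul
      (A.continuous_phase.comp (f := fun z : ℝ × ℝ => (z.1, z.2, φ)) (by fun_prop)))
  have cden : Continuous fun z : ℝ × ℝ => 1 + z.1 * A.c z.2 := by
    have := A.cont_c; fun_prop
  have csnd : ∀ {f : ℝ → ℝ}, ContinuousOn f (Icc t₁ t₂) →
      ContinuousOn (fun z : ℝ × ℝ => f z.2) (Icc a b ×ˢ Icc t₁ t₂) := fun hf =>
    hf.comp continuous_snd.continuousOn fun z hz => hz.2
  have hdenne : ∀ z ∈ Icc a b ×ˢ Icc t₁ t₂, 1 + z.1 * A.c z.2 ≠ 0 := fun z hz =>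
    (hpos z.2 hz.2 z.1 hz.1).ne'
  have i1 : Integrable (fun z : ℝ × ℝ => ((a₁ z.2 / (1 + z.1 * A.c z.2) : ℝ) : ℂ)
      * osc (R * A.phase z.1 z.2 φ)) ((volume.restrict (Ioc a b)).prod (volume.restrict (Ioc t₁ t₂))) :=
    ContinuousOn.integrable_prod_Ioc ((Complex.continuous_ofReal.comp_continuousOn
      ((csnd ca₁).div cden.continuousOn hdenne)).mul cphase.continuousOn)
  have i2' : ContinuousOn (fun z : ℝ × ℝ => ((a₂ z.2 * (z.1 / (1 + z.1 * A.c z.2) ^ 2) : ℝ) : ℂ)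
      * osc (R * A.phase z.1 z.2 φ)) (Icc a b ×ˢ Icc t₁ t₂) :=
    ((Complex.continuous_ofReal.comp_continuousOn
      ((csnd ca₂).mul (continuousOn_fst.div (cden.continuousOn.pow 2)
        fun z hz => pow_ne_zero 2 (hdenne z hz)))).mul cphase.continuousOn)
  have hc'i : IntegrableOn A.c' (Ioc t₁ t₂) := by
    have := A.int_c'.1
    exact this.mono_set (Ioc_subset_Ioc ht₁ ht₂)
  have i2 : Integrable (fun z : ℝ × ℝ => (A.c' z.2 : ℂ) * (((a₂ z.2 * (z.1 / (1 + z.1 * A.c z.2) ^ 2) : ℝ) : ℂ)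
      * osc (R * A.phase z.1 z.2 φ))) ((volume.restrict (Ioc a b)).prod (volume.restrict (Ioc t₁ t₂))) := by
    have h1 : Integrable (fun z : ℝ × ℝ => (A.c' z.2 : ℂ))
        ((volume.restrict (Ioc a b)).prod (volume.restrict (Ioc t₁ t₂))) :=
      (Integrable.comp_snd (f := A.c') hc'i _).ofReal
    obtain ⟨B, hB⟩ := (isCompact_Icc.prod isCompact_Icc).exists_bound_of_continuousOn i2'
    refine h1.mul_bdd (c := B) (ContinuousOn.integrable_prod_Ioc i2').aestronglyMeasurable ?_
    rw [Measure.prod_restrict]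
    refine (ae_restrict_mem (measurableSet_Ioc.prod measurableSet_Ioc)).mono fun z hz => ?_
    exact hB z ⟨Ioc_subset_Icc_self hz.1, Ioc_subset_Icc_self hz.2⟩
  have iW : Integrable (fun z : ℝ × ℝ => (W z.1 z.2 : ℂ) * osc (R * A.phase z.1 z.2 φ))
      ((volume.restrict (Ioc a b)).prod (volume.restrict (Ioc t₁ t₂))) := by
    refine (i1.add i2).congr (Eventually.of_forall fun z => ?_)
    simp only [hW, Pi.add_apply]; push_cast; ring
  -- integration by parts along the curve
  have parts : ∀ u ∈ Icc a b, Complex.I * R * A.curveInt R t₁ t₂ u φ =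
      (∫ t in t₁..t₂, (W u t : ℂ) * osc (R * A.phase u t φ)) -
      (((A.F t₂ / A.tan t₂ φ / (1 + u * A.c t₂) + 0 * (u / (1 + u * A.c t₂) ^ 2) : ℝ) : ℂ)
          * osc (R * A.phase 0 t₂ φ + u * (R * A.nor t₂ φ)) -
        ((A.F t₁ / A.tan t₁ φ / (1 + u * A.c t₁) + 0 * (u / (1 + u * A.c t₁) ^ 2) : ℝ) : ℂ)
          * osc (R * A.phase 0 t₁ φ + u * (R * A.nor t₁ φ))) := by
    intro u hu
    have cu : ContinuousOn (fun t => 1 + u * A.c t) (Icc t₁ t₂) := by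
      have := A.cont_c; fun_prop
    have une : ∀ t ∈ Icc t₁ t₂, 1 + u * A.c t ≠ 0 := fun t h => (hpos t h u hu).ne'
    have hWi : IntervalIntegrable (W u) volume t₁ t₂ := by
      apply IntervalIntegrable.add
      · apply ContinuousOn.intervalIntegrable
        rw [uIcc_of_le ht]; exact ca₁.div cu une
      · have e : (fun t => A.c' t * a₂ t * (u / (1 + u * A.c t) ^ 2)) =
          fun t => A.c' t * (a₂ t * (u / (1 + u * A.c t) ^ 2)) := by ext t; ring
        rw [e]
        apply IntervalIntegrable.mul_continuousOn
        · rw [intervalIntegrable_iff_integrableOn_Ioc_of_le ht]; exact hc'i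
        · rw [uIcc_of_le ht]
          exact ca₂.mul (continuousOn_const.div (cu.pow 2) fun t h => pow_ne_zero 2 (une t h))
    have key := integral_deriv_mul_osc ht A.countable
      (A := fun t => A.F t / (A.tan t φ * (1 + u * A.c t))) (A' := W u)
      (ψ := fun t => R * A.phase u t φ) (ψ' := fun t => R * ((1 + u * A.c t) * A.tan t φ))
      (A.cont_F.continuousOn.div (cT.mul cu) fun t h => mul_ne_zero (hT0 t h) (une t h)) ?_ hWi
      (fun t h => (A.hasDerivAt_phase_param u φ (hsub h)).const_mul R)
      (continuousOn_const.mul (cu.mul cT))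
    · rw [A.phase_eq u t₂ φ, A.phase_eq u t₁ φ] at key
      have l : Complex.I * R * A.curveInt R t₁ t₂ u φ = Complex.I * ∫ t in t₁..t₂,
          ((A.F t / (A.tan t φ * (1 + u * A.c t)) * (R * ((1 + u * A.c t) * A.tan t φ)) : ℝ) : ℂ)
            * osc (R * A.phase u t φ) := by
        unfold curveInt
        rw [mul_assoc, ← intervalIntegral.integral_const_mul (R : ℂ)]
        congr 1
        apply intervalIntegral.integral_congr
        intro t h
        rw [uIcc_of_le ht] at h
        have e : A.F t / (A.tan t φ * (1 + u * A.c t)) * (R * ((1 + u * A.c t) * A.tan t φ)) =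
            R * A.F t := by
          have := hT0 t h; have := une t h; field_simp
        simp only [e]; push_cast; ring
      have n1 := hT0 t₁ (left_mem_Icc.2 ht)
      have n2 := hT0 t₂ (right_mem_Icc.2 ht)
      rw [l, key]
      simp only [zero_mul, add_zero, div_div]
      simp only [mul_add R, mul_left_comm R u]
    · intro t h
      have h' : t ∈ Icc t₁ t₂ := ⟨h.1.1.le, h.1.2.le⟩
      have n1 := hT0 t h'
      have n2 := une t h'
      have hdc : HasDerivAt A.c (A.c' t) t :=
        A.deriv_c t ⟨⟨ht₁.trans_lt h.1.1, h.1.2.trans_le ht₂⟩, h.2⟩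
      refine ((A.deriv_F t (hsub h')).div ((A.hasDerivAt_tan_param φ (hsub h')).mul
        ((hdc.const_mul u).const_add 1)) (mul_ne_zero n1 n2)).congr_deriv ?_
      simp only [hW, ha₁, ha₂, Pi.mul_apply]
      field_simp
      ring
  -- the bound for the inner transversal integrals
  have trans_bound : ∀ t ∈ Icc t₁ t₂, ∀ A₁ A₂ : ℝ,
      ‖∫ u in a..b, ((A₁ / (1 + u * A.c t) + A₂ * (u / (1 + u * A.c t) ^ 2) : ℝ) : ℂ)
        * osc (R * A.phase 0 t φ + u * (R * A.nor t φ))‖ ≤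
      2 * ((|A₁| + |A₂|) * D) * (1 + 2 * w) * (1 + |R * A.nor t φ|)⁻¹ := fun t h A₁ A₂ =>
    norm_transversal_integral_le hd hw (hbd t (hsub h)).2.2 hab ha hb
      fun u hu => (hreg t (hsub h) u (hsubu hu)).1
  -- End-point terms are the case `A₂ = 0` of `trans_bound`; the vanishing summand is kept to match
  -- its form.
  have bdry : ∀ t ∈ Icc t₁ t₂,
      ‖∫ u in a..b, ((A.F t / A.tan t φ / (1 + u * A.c t) + 0 * (u / (1 + u * A.c t) ^ 2) : ℝ) : ℂ)
        * osc (R * A.phase 0 t φ + u * (R * A.nor t φ))‖ ≤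
      2 * (24 * M ^ 2 * D) * (1 + 2 * w) * (1 + |R * A.nor t φ|)⁻¹ := fun t h => by
    refine (trans_bound t h _ 0).trans ?_
    have : |A.F t / A.tan t φ| + |(0 : ℝ)| ≤ 24 * M ^ 2 := by
      rw [abs_zero, add_zero]; exact (hFT t h).trans (by nlinarith)
    gcongr
  have inner : ∀ t ∈ Icc t₁ t₂, ‖∫ u in a..b, (W u t : ℂ) * osc (R * A.phase u t φ)‖ ≤
      2 * (24 * M ^ 2 * D) * (1 + 2 * w) * ((1 + |A.c' t|) * (1 + |R * A.nor t φ|)⁻¹) := fun t h => by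
    have e : ∫ u in a..b, (W u t : ℂ) * osc (R * A.phase u t φ) =
        ∫ u in a..b, ((a₁ t / (1 + u * A.c t) + A.c' t * a₂ t * (u / (1 + u * A.c t) ^ 2) : ℝ) : ℂ)
        * osc (R * A.phase 0 t φ + u * (R * A.nor t φ)) := by
      congr 1; ext u
      rw [A.phase_eq u t φ, mul_add, mul_left_comm R u]
    rw [e]
    refine (trans_bound t h _ _).trans ?_
    have : |a₁ t| + |A.c' t * a₂ t| ≤ 24 * M ^ 2 * (1 + |A.c' t|) := by
      rw [abs_mul]
      have h1 := ha₁b t h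
      have h2 : |a₂ t| ≤ 4 * M := by rw [ha₂]; simp only [abs_neg]; exact hFT t h
      have h3 : |A.c' t| * |a₂ t| ≤ |A.c' t| * (4 * M) := mul_le_mul_of_nonneg_left h2 (abs_nonneg _)
      nlinarith [abs_nonneg (A.c' t), mul_nonneg (abs_nonneg (A.c' t)) (sub_nonneg.2 hM)]
    calc _ ≤ 2 * (24 * M ^ 2 * (1 + |A.c' t|) * D) * (1 + 2 * w) * (1 + |R * A.nor t φ|)⁻¹ := by
          gcongr
      _ = _ := by ring
  have hkc : ContinuousOn (fun t => (1 + |R * A.nor t φ|)⁻¹) (Icc t₁ t₂) :=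
    (continuousOn_const.add (continuousOn_const.mul cN).abs).inv₀ fun t _ =>
      (add_pos_of_pos_of_nonneg one_pos (abs_nonneg (R * A.nor t φ))).ne'
  have ik : IntervalIntegrable (fun t => (1 + |A.c' t|) * (1 + |R * A.nor t φ|)⁻¹) volume t₁ t₂ := by
    apply IntervalIntegrable.mul_continuousOn
    · apply IntervalIntegrable.add _root_.intervalIntegrable_const
      exact ((intervalIntegrable_iff_integrableOn_Ioc_of_le ht).2 hc'i).abs
    · rwa [uIcc_of_le ht]
  have cbd : ∀ t ∈ Icc t₁ t₂, IntervalIntegrable (fun u =>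
      ((A.F t / A.tan t φ / (1 + u * A.c t) + 0 * (u / (1 + u * A.c t) ^ 2) : ℝ) : ℂ)
        * osc (R * A.phase 0 t φ + u * (R * A.nor t φ))) volume a b := fun t h => by
    apply ContinuousOn.intervalIntegrable
    rw [uIcc_of_le hab]
    have h1 : ContinuousOn (fun u => 1 + u * A.c t) (Icc a b) := by fun_prop
    have h2 : Continuous fun u => osc (R * A.phase 0 t φ + u * (R * A.nor t φ)) :=
      continuous_osc.comp (by fun_prop)
    refine (Complex.continuous_ofReal.comp_continuousOn ?_).mul h2.continuousOn
    exact (continuousOn_const.div h1 fun u hu => (hpos t h u hu).ne').add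
      (continuousOn_const.mul (continuousOn_id.div (h1.pow 2)
        fun u hu => pow_ne_zero 2 (hpos t h u hu).ne'))
  have hiu : IntervalIntegrable (fun u => ∫ t in t₁..t₂, (W u t : ℂ) * osc (R * A.phase u t φ))
      volume a b := by
    rw [intervalIntegrable_iff_integrableOn_Ioc_of_le hab]
    simp only [intervalIntegral.integral_of_le ht]
    exact iW.integral_prod_left
  -- After the integration by parts in `t`, Fubini lets the integral in `u` be taken first, so that
  -- the decay across the strip multiplies the factor `R⁻¹` already gained.
  have total : Complex.I * R * A.stripInt R t₁ t₂ a b φ =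
      (∫ t in t₁..t₂, ∫ u in a..b, (W u t : ℂ) * osc (R * A.phase u t φ)) -
      ((∫ u in a..b, ((A.F t₂ / A.tan t₂ φ / (1 + u * A.c t₂)
            + 0 * (u / (1 + u * A.c t₂) ^ 2) : ℝ) : ℂ)
          * osc (R * A.phase 0 t₂ φ + u * (R * A.nor t₂ φ))) -
        ∫ u in a..b, ((A.F t₁ / A.tan t₁ φ / (1 + u * A.c t₁)
            + 0 * (u / (1 + u * A.c t₁) ^ 2) : ℝ) : ℂ)
          * osc (R * A.phase 0 t₁ φ + u * (R * A.nor t₁ φ))) := by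
    have m1 := left_mem_Icc.2 ht
    have m2 := right_mem_Icc.2 ht
    unfold stripInt
    rw [← intervalIntegral_swap hab ht (f := fun u t => (W u t : ℂ) * osc (R * A.phase u t φ)) iW,
      ← intervalIntegral.integral_sub (cbd t₂ m2) (cbd t₁ m1),
      ← intervalIntegral.integral_sub hiu ((cbd t₂ m2).sub (cbd t₁ m1)),
      ← intervalIntegral.integral_const_mul]
    apply intervalIntegral.integral_congr
    intro u hu
    rw [uIcc_of_le hab] at hu
    exact parts u hu
  have fin := congrArg norm total
  rw [norm_mul, norm_mul, Complex.norm_I, one_mul, Complex.norm_real, Real.norm_eq_abs,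
    abs_of_pos hR] at fin
  rw [fin]
  refine (norm_sub_le _ _).trans ?_
  have f1 : ‖∫ t in t₁..t₂, ∫ u in a..b, (W u t : ℂ) * osc (R * A.phase u t φ)‖ ≤
      2 * (24 * M ^ 2 * D) * (1 + 2 * w) *
        ∫ t in t₁..t₂, (1 + |A.c' t|) * (1 + |R * A.nor t φ|)⁻¹ := by
    rw [← intervalIntegral.integral_const_mul]
    exact intervalIntegral.norm_integral_le_of_norm_le ht
      (Eventually.of_forall fun t h => inner t (Ioc_subset_Icc_self h)) (ik.const_mul _)
  have f2 := (norm_sub_le _ _).trans (add_le_add (bdry t₂ (right_mem_Icc.2 ht))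
    (bdry t₁ (left_mem_Icc.2 ht)))
  linarith

end NormalStrip

/-! ### Mean squares over directions. -/

namespace NormalStrip

variable (A : NormalStrip)

/-- The kernel `k t φ = (1 + |R nor|)⁻¹` of the pointwise estimate satisfies `∫ k² dφ ≤ 4π / R` for
each fixed `t`, since `nor` has derivative `-tan` in `φ`, which stays away from zero. Cauchy-Schwarz
with the weight `1 + |c'|` keeps `c'` to the first power, so that its integral is all that enters.
The factor `R⁻²` from the squared pointwise bound completes `R⁻³`. -/
lemma exists_tangential_bound : ∃ C : ℝ, 0 ≤ C ∧ ∀ t₁ t₂ : ℝ, 0 ≤ t₁ → t₁ ≤ t₂ → t₂ ≤ A.len →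
    ∀ α β σ : ℝ, α ≤ β → |σ| = 1 → (∀ t ∈ Icc t₁ t₂, ∀ φ ∈ Icc α β, 1 / 4 ≤ σ * A.tan t φ) →
    ∀ R : ℝ, 0 < R → ∀ a b : ℝ, -A.width ≤ a → a ≤ b → b ≤ A.width →
    R ^ 3 * ∫ φ in α..β, ‖A.stripInt R t₁ t₂ a b φ‖ ^ 2 ≤ C := by
  obtain ⟨C, hC, hpt⟩ := A.exists_norm_stripInt_le
  set N := ∫ t in (0 : ℝ)..A.len, (1 + |A.c' t|) with hN
  have hmi : IntervalIntegrable (fun t => 1 + |A.c' t|) volume 0 A.len :=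
    _root_.intervalIntegrable_const.add A.int_c'.abs
  have hN0 : 0 ≤ N := intervalIntegral.integral_nonneg A.len_pos.le fun t _ => by positivity
  -- The 3 comes from the square of a sum of three terms. The two end points contribute `4π` each,
  -- the integral term `4π N²`.
  refine ⟨3 * C ^ 2 * (8 * Real.pi + 4 * Real.pi * N ^ 2), by positivity, ?_⟩
  intro t₁ t₂ ht₁ ht ht₂ α β σ hαβ hσ hT R hR a b ha hab hb
  have hsub : Icc t₁ t₂ ⊆ Icc 0 A.len := Icc_subset_Icc ht₁ ht₂
  set k : ℝ → ℝ → ℝ := fun t φ => (1 + |R * A.nor t φ|)⁻¹ with hk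
  set m : ℝ → ℝ := fun t => 1 + |A.c' t| with hm
  have hk0 : ∀ t φ, 0 < k t φ := fun t φ => by
    rw [hk]; simp only [inv_pos]; positivity
  have hk1 : ∀ t φ, k t φ ≤ 1 := fun t φ => inv_le_one_of_one_le₀ (by
    linarith [abs_nonneg (R * A.nor t φ)])
  have hm0 : ∀ t, 0 ≤ m t := fun t => by rw [hm]; positivity
  have ck : Continuous fun z : ℝ × ℝ => k z.1 z.2 :=
    (continuous_const.add (continuous_const.mul A.continuous_nor).abs).inv₀ fun z =>
      (add_pos_of_pos_of_nonneg one_pos (abs_nonneg (R * A.nor z.1 z.2))).ne'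
  have ckφ : ∀ t, Continuous (k t) := fun t => ck.comp (f := fun φ => (t, φ)) (by fun_prop)
  have ckt : ∀ φ, Continuous fun t => k t φ := fun φ => ck.comp (f := fun t => (t, φ)) (by fun_prop)
  have hksq : ∀ t ∈ Icc t₁ t₂, ∫ φ in α..β, k t φ ^ 2 ≤ 4 * Real.pi / R := by
    intro t h
    have cn : Continuous (A.nor t) := A.continuous_nor.comp (f := fun φ => (t, φ)) (by fun_prop)
    calc ∫ φ in α..β, k t φ ^ 2 ≤ ∫ φ in α..β, 1 / (1 + R ^ 2 * A.nor t φ ^ 2) := by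
          apply intervalIntegral.integral_mono_on hαβ
          · exact ((ckφ t).pow 2).intervalIntegrable _ _
          · exact (continuous_const.div (by fun_prop) fun φ => by positivity).intervalIntegrable _ _
          · intro φ _
            rw [hk]; simp only [inv_pow, one_div]
            apply inv_anti₀ (by positivity)
            nlinarith [abs_nonneg (R * A.nor t φ), sq_abs (R * A.nor t φ)]
      _ ≤ Real.pi / (1 / 4 * R) := by
          refine integral_one_div_one_add_sq_comp_le hR hαβ (by norm_num)
            (fun s _ => A.hasDerivAt_nor t s) ?_ (σ := -σ) (by rwa [abs_neg]) fun s hs => ?_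
          · exact (A.continuous_tan.comp (f := fun φ => (t, φ)) (by fun_prop)).neg.continuousOn
          · have := hT t h s hs; linarith
      _ = 4 * Real.pi / R := by field_simp
  have hmi' : IntegrableOn m (Ioc t₁ t₂) :=
    ((intervalIntegrable_iff_integrableOn_Ioc_of_le A.len_pos.le).1 hmi).mono_set
      (Ioc_subset_Ioc ht₁ ht₂)
  have hmN : ∫ t in t₁..t₂, m t ≤ N := by
    apply intervalIntegral.integral_mono_interval ht₁ ht ht₂ (Eventually.of_forall hm0) hmi
  have hmN0 : 0 ≤ ∫ t in t₁..t₂, m t := intervalIntegral.integral_nonneg ht fun t _ => hm0 t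
  have bmk : ∀ n : ℕ, ∀ φ, Integrable (fun t => m t * k t φ ^ n) (volume.restrict (Ioc t₁ t₂)) :=
    fun n φ => hmi'.mul_bdd (c := 1) ((ckt φ).pow n).aestronglyMeasurable
      (Eventually.of_forall fun t => by
        rw [norm_pow, Real.norm_of_nonneg (hk0 t φ).le]
        exact pow_le_one₀ (hk0 t φ).le (hk1 t φ))
  -- the integral of the weighted kernel
  have imk : Integrable (Function.uncurry fun φ t => m t * k t φ ^ 2)
      ((volume.restrict (Ioc α β)).prod (volume.restrict (Ioc t₁ t₂))) := by
    have h1 : Integrable (fun z : ℝ × ℝ => m z.2)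
        ((volume.restrict (Ioc α β)).prod (volume.restrict (Ioc t₁ t₂))) :=
      Integrable.comp_snd (f := m) hmi' _
    refine h1.mul_bdd (c := 1) ?_ (Eventually.of_forall fun z => ?_)
    · exact ((ck.comp (f := fun z : ℝ × ℝ => (z.2, z.1)) (by fun_prop)).pow 2).aestronglyMeasurable
    · rw [norm_pow, Real.norm_of_nonneg (hk0 _ _).le]
      exact pow_le_one₀ (hk0 _ _).le (hk1 _ _)
  have hI : ∫ φ in α..β, ∫ t in t₁..t₂, m t * k t φ ^ 2 ≤ N * (4 * Real.pi / R) := by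
    rw [intervalIntegral_swap hαβ ht imk]
    calc _ ≤ ∫ t in t₁..t₂, m t * (4 * Real.pi / R) := by
          apply intervalIntegral.integral_mono_on ht
          · rw [intervalIntegrable_iff_integrableOn_Ioc_of_le ht]
            simp only [intervalIntegral.integral_of_le hαβ]
            exact imk.integral_prod_right
          · exact ((intervalIntegrable_iff_integrableOn_Ioc_of_le ht).2 hmi').mul_const _
          · intro t h
            rw [intervalIntegral.integral_const_mul]
            exact mul_le_mul_of_nonneg_left (hksq t h) (hm0 t)
      _ ≤ _ := by
          rw [intervalIntegral.integral_mul_const]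
          exact mul_le_mul_of_nonneg_right hmN (by positivity)
  have hIint : IntervalIntegrable (fun φ => ∫ t in t₁..t₂, m t * k t φ ^ 2) volume α β := by
    rw [intervalIntegrable_iff_integrableOn_Ioc_of_le hαβ]
    simp only [intervalIntegral.integral_of_le ht]
    exact imk.integral_prod_left
  have i1 : ∀ t, IntervalIntegrable (fun φ => k t φ ^ 2) volume α β := fun t =>
    ((ckφ t).pow 2).intervalIntegrable _ _
  have pt : ∀ φ ∈ Icc α β, R ^ 2 * ‖A.stripInt R t₁ t₂ a b φ‖ ^ 2 ≤
      3 * C ^ 2 * (k t₁ φ ^ 2 + k t₂ φ ^ 2 + N * ∫ t in t₁..t₂, m t * k t φ ^ 2) := by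
    intro φ hφ
    have h := hpt t₁ t₂ ht₁ ht ht₂ φ (fun t h => by
      refine (hT t h φ hφ).trans ((le_abs_self _).trans ?_)
      rw [abs_mul, hσ, one_mul]) R hR a b ha hab hb
    change _ ≤ C * (k t₁ φ + k t₂ φ + ∫ t in t₁..t₂, m t * k t φ) at h
    have cs : (∫ t in t₁..t₂, m t * k t φ) ^ 2 ≤ N * ∫ t in t₁..t₂, m t * k t φ ^ 2 := by
      have h1 := sq_integral_mul_le (Eventually.of_forall hm0) hmi'
        (by simpa using bmk 1 φ) (bmk 2 φ)
      simp only [← intervalIntegral.integral_of_le ht] at h1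
      refine h1.trans (mul_le_mul_of_nonneg_right hmN ?_)
      exact intervalIntegral.integral_nonneg ht fun t _ => mul_nonneg (hm0 t) (sq_nonneg _)
    set I := ∫ t in t₁..t₂, m t * k t φ
    have hsq := pow_le_pow_left₀ (by positivity) h 2
    rw [mul_pow, mul_pow] at hsq
    refine hsq.trans ?_
    have : (k t₁ φ + k t₂ φ + I) ^ 2 ≤ 3 * (k t₁ φ ^ 2 + k t₂ φ ^ 2 + I ^ 2) := by
      nlinarith [sq_nonneg (k t₁ φ - k t₂ φ), sq_nonneg (k t₁ φ - I), sq_nonneg (k t₂ φ - I)]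
    calc _ ≤ C ^ 2 * (3 * (k t₁ φ ^ 2 + k t₂ φ ^ 2 + N * ∫ t in t₁..t₂, m t * k t φ ^ 2)) :=
          mul_le_mul_of_nonneg_left (by linarith) (sq_nonneg C)
      _ = _ := by ring
  have tot : ∫ φ in α..β, R ^ 2 * ‖A.stripInt R t₁ t₂ a b φ‖ ^ 2 ≤
      3 * C ^ 2 * (4 * Real.pi / R + 4 * Real.pi / R + N * (N * (4 * Real.pi / R))) := by
    have im := intervalIntegral.integral_mono_on hαβ
      (((A.continuous_stripInt R t₁ t₂ a b).norm.pow 2).const_mul (R ^ 2) |>.intervalIntegrable α β)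
      ((((i1 t₁).add (i1 t₂)).add (hIint.const_mul N)).const_mul (3 * C ^ 2)) pt
    refine im.trans ?_
    rw [intervalIntegral.integral_const_mul,
      intervalIntegral.integral_add ((i1 t₁).add (i1 t₂)) (hIint.const_mul N),
      intervalIntegral.integral_add (i1 t₁) (i1 t₂), intervalIntegral.integral_const_mul]
    have e1 := hksq t₁ (left_mem_Icc.2 ht)
    have e2 := hksq t₂ (right_mem_Icc.2 ht)
    gcongr
  rw [intervalIntegral.integral_const_mul] at tot
  calc _ = R * (R ^ 2 * ∫ φ in α..β, ‖A.stripInt R t₁ t₂ a b φ‖ ^ 2) := by ring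
    _ ≤ R * (3 * C ^ 2 * (4 * Real.pi / R + 4 * Real.pi / R + N * (N * (4 * Real.pi / R)))) :=
        mul_le_mul_of_nonneg_left tot hR.le
    _ = _ := by field_simp; ring

/-- A `T T*` argument. The square is a double integral over `s` and `t`, in which `φ` is integrated
first. The angular derivative of the phase difference equals `(1 + u c) nor (s - t)` at an
intermediate point, hence is comparable to `|s - t|`. Two integrations by parts give the kernel
bound `C₀ / (1 + R² (s - t)²)`, whose integral in one variable is at most `C₀ π / R`. The cutoff in
`φ` removes the end-point terms. -/
lemma exists_dualCurveInt_bound : ∃ C : ℝ, 0 ≤ C ∧ ∀ t₁ t₂ : ℝ, 0 ≤ t₁ → t₁ ≤ t₂ → t₂ ≤ A.len →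
    ∀ α β σ : ℝ, α ≤ β → β - α ≤ 7 → |σ| = 1 →
    (∀ t ∈ Icc t₁ t₂, ∀ φ ∈ Icc α β, 1 / 4 ≤ σ * A.nor t φ) →
    ∀ R : ℝ, 0 < R → ∀ u ∈ Icc (-A.width) A.width,
    IntervalIntegrable (fun φ => ((φ - α) * (β - φ)) ^ 2 *
      ‖∫ t in t₁..t₂, ((A.F t / A.nor t φ : ℝ) : ℂ) * osc (R * A.phase u t φ)‖ ^ 2) volume α β ∧
    R * ∫ φ in α..β, ((φ - α) * (β - φ)) ^ 2 *
      ‖∫ t in t₁..t₂, ((A.F t / A.nor t φ : ℝ) : ℂ) * osc (R * A.phase u t φ)‖ ^ 2 ≤ C := by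
  obtain ⟨M, d, hM, hd, hbd, hreg⟩ := A.exists_bounds
  have hM0 : 0 ≤ M := by linarith
  -- Two reciprocals of `nor`, each with two-jet bound `132 = 4 + 2 * 4 ^ 3`, are multiplied with
  -- the cutoff, whose bound is 2401. Each product costs a Leibniz factor 4, and `M ^ 2` bounds the
  -- densities. In `C₀` the first term is the trivial bound over an interval of length at most 7,
  -- the second comes from `norm_integral_mul_osc_le_sq`.
  set B := 4 * (4 * 132 * 132) * 2401 * M ^ 2
  set C₀ := 7 * B + 8 * B * (2 * M) ^ 2 / (d / 4) ^ 4 * 7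
  have hC₀ : 0 ≤ C₀ := by positivity
  refine ⟨C₀ * Real.pi * A.len, by have := A.len_pos; positivity, ?_⟩
  intro t₁ t₂ ht₁ ht ht₂ α β σ hαβ h7 hσ hN R hR u hu
  have hsub : Icc t₁ t₂ ⊆ Icc 0 A.len := Icc_subset_Icc ht₁ ht₂
  have hnor : ∀ t ∈ Icc t₁ t₂, ∀ φ ∈ Icc α β, 1 / 4 ≤ |A.nor t φ| := fun t h φ hφ => by
    refine (hN t h φ hφ).trans ((le_abs_self _).trans ?_)
    rw [abs_mul, hσ, one_mul]
  have hnor0 : ∀ t ∈ Icc t₁ t₂, ∀ φ ∈ Icc α β, A.nor t φ ≠ 0 := fun t h φ hφ h0 => by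
    have := hnor t h φ hφ; rw [h0, abs_zero] at this; linarith
  -- the reciprocal of the normal component as a function of the direction
  have jet : ∀ t ∈ Icc t₁ t₂, BoundedTwoJet (Icc α β) 132 (fun φ => 1 / A.nor t φ)
      (fun φ => A.tan t φ / A.nor t φ ^ 2)
      (fun φ => 1 / A.nor t φ + 2 * A.tan t φ ^ 2 / A.nor t φ ^ 3) := by
    intro t h
    have cn : Continuous (A.nor t) := A.continuous_nor.comp (f := fun φ => (t, φ)) (by fun_prop)
    have ct : Continuous (A.tan t) := A.continuous_tan.comp (f := fun φ => (t, φ)) (by fun_prop)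
    refine ⟨fun φ hφ => ?_, fun φ hφ => ?_, ?_, fun φ hφ => ?_⟩
    · have n0 := hnor0 t h φ hφ
      refine ((hasDerivAt_const φ (1 : ℝ)).div (A.hasDerivAt_nor t φ) n0).congr_deriv ?_
      ring
    · have n0 := hnor0 t h φ hφ
      refine ((A.hasDerivAt_tan t φ).div ((A.hasDerivAt_nor t φ).pow 2)
        (pow_ne_zero 2 n0)).congr_deriv ?_
      simp only [Pi.pow_apply]
      field_simp; ring
    · exact (continuousOn_const.div cn.continuousOn (hnor0 t h)).add
        (ContinuousOn.div (by fun_prop) (cn.pow 3).continuousOn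
          fun φ hφ => pow_ne_zero 3 (hnor0 t h φ hφ))
    · have n1 := hnor t h φ hφ
      have tb := A.abs_tan_le (hsub h) φ
      have inv : ∀ n : ℕ, 1 / |A.nor t φ| ^ n ≤ 4 ^ n := fun n => by
        rw [div_le_iff₀ (by positivity), ← mul_pow]
        exact one_le_pow₀ (by linarith)
      have e0 : |1 / A.nor t φ| ≤ 4 := by
        have := inv 1; rw [pow_one, pow_one] at this
        rwa [abs_div, abs_one]
      refine ⟨e0.trans (by norm_num), ?_, ?_⟩
      · rw [abs_div, abs_pow, div_eq_mul_one_div]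
        calc _ ≤ 1 * 4 ^ 2 := mul_le_mul tb (inv 2) (by positivity) zero_le_one
          _ ≤ _ := by norm_num
      · refine (abs_add_le _ _).trans ?_
        rw [abs_div _ (A.nor t φ ^ 3), abs_pow, div_eq_mul_one_div _ (|A.nor t φ| ^ 3), abs_mul,
          abs_two, abs_pow]
        have : 2 * |A.tan t φ| ^ 2 * (1 / |A.nor t φ| ^ 3) ≤ 2 * 1 * 4 ^ 3 := by
          have := inv 3
          have h2 : |A.tan t φ| ^ 2 ≤ 1 := pow_le_one₀ (abs_nonneg _) tb
          gcongr
        linarith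
  set χ : ℝ → ℝ := fun φ => ((φ - α) * (β - φ)) ^ 2 with hχ
  have cχ : Continuous χ := by rw [hχ]; fun_prop
  set w : ℝ → ℝ → ℝ := fun t φ => A.F t / A.nor t φ with hw
  -- the kernel after integration over the directions
  have kernel : ∀ s ∈ Icc t₁ t₂, ∀ t ∈ Icc t₁ t₂,
      ‖∫ φ in α..β, ((χ φ * w s φ * w t φ : ℝ) : ℂ) * osc (R * (A.phase u s φ - A.phase u t φ))‖ ≤
      C₀ * (1 / (1 + R ^ 2 * (s - t) ^ 2)) := by
    intro s hs t ht'
    have J := ((jet s hs).mul (jet t ht')).mul (boundedTwoJet_bump hαβ h7)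
    set A₀ : ℝ → ℝ := fun φ => 1 / A.nor s φ * (1 / A.nor t φ) * χ φ with hA₀
    have e : ∫ φ in α..β, ((χ φ * w s φ * w t φ : ℝ) : ℂ) * osc (R * (A.phase u s φ - A.phase u t φ))
        = (A.F s * A.F t : ℝ) *
          ∫ φ in α..β, (A₀ φ : ℂ) * osc (R * (A.phase u s φ - A.phase u t φ)) := by
      rw [← intervalIntegral.integral_const_mul]
      congr 1; ext φ
      have : χ φ * w s φ * w t φ = (A.F s * A.F t) * A₀ φ := by rw [hA₀, hw]; ring
      rw [this]; push_cast; ring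
    rw [e, norm_mul, Complex.norm_real, Real.norm_eq_abs]
    have hFF : |A.F s * A.F t| ≤ M ^ 2 := by
      rw [abs_mul, sq]
      exact mul_le_mul (hbd s (hsub hs)).1 (hbd t (hsub ht')).1 (abs_nonneg _) hM0
    set I := ∫ φ in α..β, (A₀ φ : ℂ) * osc (R * (A.phase u s φ - A.phase u t φ)) with hI
    have i0 : ‖I‖ ≤ 4 * (4 * 132 * 132) * 2401 * (β - α) :=
      norm_integral_mul_osc_le hαβ fun φ hφ => (J.bound φ hφ).1
    set B₁ : ℝ := 4 * (4 * 132 * 132) * 2401 with hB₁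
    have hB₁0 : 0 ≤ B₁ := by norm_num [hB₁]
    have i2 : R ^ 2 * (s - t) ^ 2 * ‖I‖ ≤ 8 * B₁ * (2 * M) ^ 2 / (d / 4) ^ 4 * (β - α) := by
      rcases eq_or_ne s t with rfl | hst
      · simp only [sub_self]
        have : (0 : ℝ) ≤ 8 * B₁ * (2 * M) ^ 2 / (d / 4) ^ 4 * (β - α) :=
          mul_nonneg (by positivity) (by linarith)
        simpa using this
      · rw [← sq_abs (s - t)]
        have slope : ∀ φ, ∀ (f : ℝ → ℝ → ℝ → ℝ) (f' : ℝ → ℝ),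
            (∀ r ∈ Icc t₁ t₂, HasDerivAt (fun r => f u r φ) ((1 + u * A.c r) * f' r) r) →
            (∀ r ∈ Icc t₁ t₂, |f' r| ≤ 1) → |f u s φ - f u t φ| ≤ 2 * M * |s - t| := by
          intro φ f f' hf hf'
          obtain ⟨r, hr, er⟩ := exists_sub_eq_deriv_mul hf hs ht'
          rw [er, abs_mul, abs_mul]
          have h1 := A.regular r (hsub hr) u hu
          have h2 := (hreg r (hsub hr) u hu).2
          have h3 := hf' r hr
          rw [abs_of_pos h1]
          have : (1 + u * A.c r) * |f' r| ≤ M * 1 := mul_le_mul h2 h3 (abs_nonneg _) hM0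
          exact mul_le_mul_of_nonneg_right (by linarith) (abs_nonneg _)
        have sp : ∀ φ, |A.phase u s φ - A.phase u t φ| ≤ 2 * M * |s - t| := fun φ =>
          slope φ A.phase (fun r => A.tan r φ)
            (fun r hr => A.hasDerivAt_phase_param u φ (hsub hr)) fun r hr => A.abs_tan_le (hsub hr) φ
        have sp' : ∀ φ, |A.phase' u s φ - A.phase' u t φ| ≤ 2 * M * |s - t| := fun φ =>
          slope φ A.phase' (fun r => A.nor r φ)
            (fun r hr => A.hasDerivAt_phase'_param u φ (hsub hr)) fun r hr => A.abs_nor_le (hsub hr) φ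
        refine norm_integral_mul_osc_le_sq (A₀ := A₀) hαβ J.deriv_one J.deriv_two J.cont
          (ψ := fun φ => A.phase u s φ - A.phase u t φ)
          (P₀ := fun φ => A.phase' u s φ - A.phase' u t φ)
          (P₁ := fun φ => -A.phase u s φ - -A.phase u t φ)
          (P₂ := fun φ => -A.phase' u s φ - -A.phase' u t φ)
          (fun φ _ => (A.hasDerivAt_phase u s φ).sub (A.hasDerivAt_phase u t φ))
          (fun φ _ => (A.hasDerivAt_phase' u s φ).sub (A.hasDerivAt_phase' u t φ))
          (fun φ _ => (A.hasDerivAt_phase u s φ).neg.sub (A.hasDerivAt_phase u t φ).neg)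
          ?_ ?_ ?_ J.bound (C := 2 * M) (c := d / 4) ?_ (by positivity)
          (abs_pos.2 (sub_ne_zero.2 hst)) ?_
        · intro φ _
          have c1 := (A.hasDerivAt_phase' u s φ).continuousAt
          have c2 := (A.hasDerivAt_phase' u t φ).continuousAt
          exact (c1.neg.sub c2.neg).continuousWithinAt
        · constructor <;> simp [hA₀, hχ]
        · constructor <;> simp [hA₀, hχ]
        · intro φ _
          refine ⟨sp' φ, ?_, ?_⟩
          · rw [neg_sub_neg, abs_sub_comm]; exact sp φ
          · rw [neg_sub_neg, abs_sub_comm]; exact sp' φ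
        · intro φ hφ
          -- Nondegeneracy: the phase difference has angular derivative at least `d / 4 * |s - t|`,
          -- from `1 + u c ≥ d` and `|nor| ≥ 1 / 4` at the intermediate parameter.
          obtain ⟨r, hr, er⟩ := exists_sub_eq_deriv_mul
            (fun r hr => A.hasDerivAt_phase'_param u φ (hsub hr)) hs ht'
          have h1 := (hreg r (hsub hr) u hu).1
          have h2 := hnor r hr φ hφ
          change d / 4 * |s - t| ≤ |A.phase' u s φ - A.phase' u t φ|
          rw [er, abs_mul, abs_mul, abs_of_pos (hd.trans_le h1)]
          refine mul_le_mul_of_nonneg_right ?_ (abs_nonneg _)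
          calc d / 4 = d * (1 / 4) := by ring
            _ ≤ _ := mul_le_mul h1 h2 (by norm_num) (hd.le.trans h1)
    have hst2 : 0 < 1 + R ^ 2 * (s - t) ^ 2 := by positivity
    rw [mul_one_div, le_div_iff₀ hst2]
    have i3 : (1 + R ^ 2 * (s - t) ^ 2) * ‖I‖ ≤ B₁ * 7 + 8 * B₁ * (2 * M) ^ 2 / (d / 4) ^ 4 * 7 := by
      have g1 : B₁ * (β - α) ≤ B₁ * 7 := mul_le_mul_of_nonneg_left h7 hB₁0
      have g2 : 8 * B₁ * (2 * M) ^ 2 / (d / 4) ^ 4 * (β - α) ≤ 8 * B₁ * (2 * M) ^ 2 / (d / 4) ^ 4 * 7 :=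
        mul_le_mul_of_nonneg_left h7 (by positivity)
      linarith
    calc |A.F s * A.F t| * ‖I‖ * (1 + R ^ 2 * (s - t) ^ 2)
        = |A.F s * A.F t| * ((1 + R ^ 2 * (s - t) ^ 2) * ‖I‖) := by ring
      _ ≤ M ^ 2 * (B₁ * 7 + 8 * B₁ * (2 * M) ^ 2 / (d / 4) ^ 4 * 7) :=
        mul_le_mul hFF i3 (by positivity) (by positivity)
      _ = C₀ := by simp only [C₀, B, hB₁]; ring
  -- expand the square
  set μ := volume.restrict (Ioc α β) with hμ
  set ν := volume.restrict (Ioc t₁ t₂) with hν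
  have cph : Continuous fun z : ℝ × ℝ => A.phase u z.2 z.1 :=
    A.continuous_phase.comp (f := fun z : ℝ × ℝ => (u, z.2, z.1)) (by fun_prop)
  set H : ℝ → ℝ × ℝ → ℂ := fun φ z => ((χ φ * w z.1 φ * w z.2 φ : ℝ) : ℂ) *
    osc (R * (A.phase u z.1 φ - A.phase u z.2 φ)) with hH
  have cH : ContinuousOn (Function.uncurry H) (Icc α β ×ˢ (Icc t₁ t₂ ×ˢ Icc t₁ t₂)) := by
    have cF := A.cont_F
    have cn := A.continuous_nor
    have c1 : ContinuousOn (fun y : ℝ × ℝ × ℝ => w y.2.1 y.1) (Icc α β ×ˢ (Icc t₁ t₂ ×ˢ Icc t₁ t₂)) :=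
      (cF.comp (f := fun y : ℝ × ℝ × ℝ => y.2.1) (by fun_prop)).continuousOn.div
        (cn.comp (f := fun y : ℝ × ℝ × ℝ => (y.2.1, y.1)) (by fun_prop)).continuousOn
        fun y hy => hnor0 _ hy.2.1 _ hy.1
    have c2 : ContinuousOn (fun y : ℝ × ℝ × ℝ => w y.2.2 y.1) (Icc α β ×ˢ (Icc t₁ t₂ ×ˢ Icc t₁ t₂)) :=
      (cF.comp (f := fun y : ℝ × ℝ × ℝ => y.2.2) (by fun_prop)).continuousOn.div
        (cn.comp (f := fun y : ℝ × ℝ × ℝ => (y.2.2, y.1)) (by fun_prop)).continuousOn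
        fun y hy => hnor0 _ hy.2.2 _ hy.1
    have c3 : Continuous fun y : ℝ × ℝ × ℝ => osc (R * (A.phase u y.2.1 y.1 - A.phase u y.2.2 y.1)) :=
      continuous_osc.comp (continuous_const.mul
        ((cph.comp (f := fun y : ℝ × ℝ × ℝ => (y.1, y.2.1)) (by fun_prop)).sub
          (cph.comp (f := fun y : ℝ × ℝ × ℝ => (y.1, y.2.2)) (by fun_prop))))
    exact (Complex.continuous_ofReal.comp_continuousOn
      (((cχ.comp continuous_fst).continuousOn.mul c1).mul c2)).mul c3.continuousOn
  have iH : Integrable (Function.uncurry H) (μ.prod (ν.prod ν)) := by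
    rw [hμ, hν, Measure.prod_restrict, Measure.prod_restrict]
    have : IntegrableOn (Function.uncurry H) (Icc α β ×ˢ (Icc t₁ t₂ ×ˢ Icc t₁ t₂))
        (volume.prod (volume.prod volume)) :=
      cH.integrableOn_compact (isCompact_Icc.prod (isCompact_Icc.prod isCompact_Icc))
    exact this.mono_set (prod_mono Ioc_subset_Icc_self
      (prod_mono Ioc_subset_Icc_self Ioc_subset_Icc_self))
  have expand : ∀ φ, ((χ φ * ‖∫ t in t₁..t₂, (w t φ : ℂ) * osc (R * A.phase u t φ)‖ ^ 2 : ℝ) : ℂ) =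
      ∫ z, H φ z ∂(ν.prod ν) := by
    intro φ
    have h1 : ∫ z, H φ z ∂(ν.prod ν) = χ φ * ∫ z : ℝ × ℝ, ((w z.1 φ : ℂ) * osc (R * A.phase u z.1 φ)) *
        (starRingEnd ℂ) ((w z.2 φ : ℂ) * osc (R * A.phase u z.2 φ)) ∂(ν.prod ν) := by
      rw [← integral_const_mul]
      congr 1; ext z
      rw [map_mul, conj_osc, Complex.conj_ofReal, hH]
      simp only []
      rw [mul_sub, sub_eq_add_neg, osc_add]
      push_cast; ring
    rw [h1, integral_prod_mul (fun t => (w t φ : ℂ) * osc (R * A.phase u t φ))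
      (fun t => (starRingEnd ℂ) ((w t φ : ℂ) * osc (R * A.phase u t φ))), integral_conj,
      Complex.mul_conj, Complex.normSq_eq_norm_sq, intervalIntegral.integral_of_le ht]
    push_cast; rfl
  have total : ((∫ φ in α..β, χ φ * ‖∫ t in t₁..t₂, (w t φ : ℂ) * osc (R * A.phase u t φ)‖ ^ 2 : ℝ) : ℂ)
      = ∫ z, ∫ φ, H φ z ∂μ ∂(ν.prod ν) := by
    rw [← integral_integral_swap iH, intervalIntegral.integral_of_le hαβ, ← integral_complex_ofReal]
    exact integral_congr_ae (Eventually.of_forall expand)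
  have hnn : 0 ≤ ∫ φ in α..β, χ φ * ‖∫ t in t₁..t₂, (w t φ : ℂ) * osc (R * A.phase u t φ)‖ ^ 2 :=
    intervalIntegral.integral_nonneg hαβ fun φ _ => by rw [hχ]; positivity
  have ck : Continuous fun z : ℝ × ℝ => C₀ * (1 / (1 + R ^ 2 * (z.1 - z.2) ^ 2)) :=
    continuous_const.mul (continuous_const.div (by fun_prop) fun z => by positivity)
  have ik : Integrable (fun z : ℝ × ℝ => C₀ * (1 / (1 + R ^ 2 * (z.1 - z.2) ^ 2))) (ν.prod ν) :=
    ck.continuousOn.integrable_prod_Ioc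
  have bound : ∫ φ in α..β, χ φ * ‖∫ t in t₁..t₂, (w t φ : ℂ) * osc (R * A.phase u t φ)‖ ^ 2 ≤
      ∫ z : ℝ × ℝ, C₀ * (1 / (1 + R ^ 2 * (z.1 - z.2) ^ 2)) ∂(ν.prod ν) := by
    have h1 := congrArg norm total
    rw [Complex.norm_real, Real.norm_of_nonneg hnn] at h1
    rw [h1]
    apply norm_integral_le_of_norm_le ik
    rw [hν, Measure.prod_restrict]
    refine (ae_restrict_mem (measurableSet_Ioc.prod measurableSet_Ioc)).mono fun z hz => ?_
    rw [hμ, ← intervalIntegral.integral_of_le hαβ]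
    exact kernel z.1 (Ioc_subset_Icc_self hz.1) z.2 (Ioc_subset_Icc_self hz.2)
  have last : ∫ z : ℝ × ℝ, C₀ * (1 / (1 + R ^ 2 * (z.1 - z.2) ^ 2)) ∂(ν.prod ν) ≤
      C₀ * (Real.pi / R) * A.len := by
    rw [integral_prod _ ik, hν]
    simp only [← intervalIntegral.integral_of_le ht]
    calc _ ≤ ∫ s in t₁..t₂, C₀ * (Real.pi / R) := by
          apply intervalIntegral.integral_mono_on ht
          · rw [intervalIntegrable_iff_integrableOn_Ioc_of_le ht]
            simp only [intervalIntegral.integral_of_le ht]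
            exact ik.integral_prod_left
          · exact _root_.intervalIntegrable_const
          · intro s _
            rw [intervalIntegral.integral_const_mul]
            exact mul_le_mul_of_nonneg_left (integral_one_div_one_add_sq_le hR) hC₀
      _ = C₀ * (Real.pi / R) * (t₂ - t₁) := by
          rw [intervalIntegral.integral_const, smul_eq_mul]; ring
      _ ≤ _ := mul_le_mul_of_nonneg_left (by linarith) (by positivity)
  refine ⟨?_, ?_⟩
  -- By `expand` the integrand is the real part of a marginal of the integrable function `H`.
  · rw [intervalIntegrable_iff_integrableOn_Ioc_of_le hαβ]
    refine (iH.integral_prod_left.re).congr (Eventually.of_forall fun φ => ?_)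
    have := congrArg Complex.re (expand φ)
    exact this.symm
  calc _ ≤ R * (C₀ * (Real.pi / R) * A.len) :=
        mul_le_mul_of_nonneg_left (bound.trans last) hR.le
    _ = _ := by field_simp

end NormalStrip

/-! ### Nearly normal directions, and the strip cut into boxes. -/

namespace NormalStrip

variable (A : NormalStrip)

/-- The phase is affine in `u` with slope `nor`, so the integral in `u` is that of an exponential.
It leaves only the two parallel curves that bound the strip and gains one power of `R`. -/
lemma I_mul_stripInt {t₁ t₂ a b φ R : ℝ} (ht : t₁ ≤ t₂) (hab : a ≤ b)
    (hN : ∀ t ∈ Icc t₁ t₂, A.nor t φ ≠ 0) :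
    Complex.I * R * A.stripInt R t₁ t₂ a b φ =
      (∫ t in t₁..t₂, ((A.F t / A.nor t φ : ℝ) : ℂ) * osc (R * A.phase a t φ)) -
      ∫ t in t₁..t₂, ((A.F t / A.nor t φ : ℝ) : ℂ) * osc (R * A.phase b t φ) := by
  have cph : Continuous fun z : ℝ × ℝ => osc (R * A.phase z.1 z.2 φ) :=
    continuous_osc.comp (continuous_const.mul
      (A.continuous_phase.comp (f := fun z : ℝ × ℝ => (z.1, z.2, φ)) (by fun_prop)))
  have cN : Continuous fun t => A.nor t φ := A.continuous_nor.comp (f := fun t => (t, φ)) (by fun_prop)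
  have ii : ∀ u, IntervalIntegrable (fun t => ((A.F t / A.nor t φ : ℝ) : ℂ) *
      osc (R * A.phase u t φ)) volume t₁ t₂ := fun u => by
    apply ContinuousOn.intervalIntegrable
    rw [uIcc_of_le ht]
    exact (Complex.continuous_ofReal.comp_continuousOn
      (A.cont_F.continuousOn.div cN.continuousOn hN)).mul
      (cph.comp (f := fun t => (u, t)) (by fun_prop)).continuousOn
  have iH : Integrable (Function.uncurry fun u t => (A.F t : ℂ) * osc (R * A.phase u t φ))
      ((volume.restrict (Ioc a b)).prod (volume.restrict (Ioc t₁ t₂))) :=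
    (((Complex.continuous_ofReal.comp (A.cont_F.comp continuous_snd)).mul cph).continuousOn
      ).integrable_prod_Ioc
  unfold stripInt curveInt
  rw [intervalIntegral_swap hab ht iH, ← intervalIntegral.integral_sub (ii a) (ii b),
    ← intervalIntegral.integral_const_mul]
  apply intervalIntegral.integral_congr
  intro t h
  rw [uIcc_of_le ht] at h
  have n0 := hN t h
  have key := integral_deriv_mul_osc hab (S := ∅) countable_empty (A := fun _ => (1 : ℝ))
    (A' := fun _ => 0) (ψ := fun u => R * A.phase u t φ) (ψ' := fun _ => R * A.nor t φ)
    continuousOn_const (fun u _ => hasDerivAt_const u _) _root_.intervalIntegrable_const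
    (fun u _ => by
      have : (fun u => R * A.phase u t φ) = fun u => R * (A.phase 0 t φ + u * A.nor t φ) := by
        ext u; rw [A.phase_eq]
      rw [this]
      simpa using (((hasDerivAt_id u).mul_const (A.nor t φ)).const_add (A.phase 0 t φ)).const_mul R)
    continuousOn_const
  simp only [one_mul, Complex.ofReal_zero, zero_mul, intervalIntegral.integral_zero,
    Complex.ofReal_one, zero_sub, neg_sub, intervalIntegral.integral_const_mul] at key
  simp only [intervalIntegral.integral_const_mul]
  have n0' : (A.nor t φ : ℂ) ≠ 0 := Complex.ofReal_ne_zero.2 n0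
  rw [← mul_sub, ← key]
  push_cast
  field_simp

/-- The elementary integral across the strip accounts for `R⁻²` after squaring, and
`exists_dualCurveInt_bound` on the two bounding curves for the remaining `R⁻¹`. The margin `ρ` on
either side of the directions makes room for the cutoff, which is at least `ρ ^ 4` on `[φ₁, φ₂]`. -/
lemma exists_normal_bound : ∃ C : ℝ, 0 ≤ C ∧ ∀ t₁ t₂ : ℝ, 0 ≤ t₁ → t₁ ≤ t₂ → t₂ ≤ A.len →
    ∀ φ₁ φ₂ ρ σ : ℝ, φ₁ ≤ φ₂ → 0 < ρ → φ₂ - φ₁ + 2 * ρ ≤ 7 → |σ| = 1 →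
    (∀ t ∈ Icc t₁ t₂, ∀ φ ∈ Icc (φ₁ - ρ) (φ₂ + ρ), 1 / 4 ≤ σ * A.nor t φ) →
    ∀ R : ℝ, 0 < R → ∀ a b : ℝ, -A.width ≤ a → a ≤ b → b ≤ A.width →
    R ^ 3 * ∫ φ in φ₁..φ₂, ‖A.stripInt R t₁ t₂ a b φ‖ ^ 2 ≤ C / ρ ^ 4 := by
  obtain ⟨C, hC, hdual⟩ := A.exists_dualCurveInt_bound
  refine ⟨4 * C, by positivity, ?_⟩
  intro t₁ t₂ ht₁ ht ht₂ φ₁ φ₂ ρ σ hφ hρ h7 hσ hN R hR a b ha hab hb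
  have hαβ : φ₁ - ρ ≤ φ₂ + ρ := by linarith
  obtain ⟨ia, ba⟩ := hdual t₁ t₂ ht₁ ht ht₂ (φ₁ - ρ) (φ₂ + ρ) σ hαβ (by linarith) hσ hN R hR a
    ⟨ha, hab.trans hb⟩
  obtain ⟨ib, bb⟩ := hdual t₁ t₂ ht₁ ht ht₂ (φ₁ - ρ) (φ₂ + ρ) σ hαβ (by linarith) hσ hN R hR b
    ⟨ha.trans hab, hb⟩
  set D : ℝ → ℝ → ℂ := fun u φ =>
    ∫ t in t₁..t₂, ((A.F t / A.nor t φ : ℝ) : ℂ) * osc (R * A.phase u t φ) with hD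
  set χ : ℝ → ℝ := fun φ => ((φ - (φ₁ - ρ)) * (φ₂ + ρ - φ)) ^ 2 with hχ
  have hχ0 : ∀ φ, 0 ≤ χ φ := fun φ => sq_nonneg _
  have pt : ∀ φ ∈ Icc φ₁ φ₂, ρ ^ 4 * R ^ 2 * ‖A.stripInt R t₁ t₂ a b φ‖ ^ 2 ≤
      2 * (χ φ * ‖D a φ‖ ^ 2 + χ φ * ‖D b φ‖ ^ 2) := by
    intro φ h
    have h' : φ ∈ Icc (φ₁ - ρ) (φ₂ + ρ) := ⟨by linarith [h.1], by linarith [h.2]⟩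
    have e := congrArg norm (A.I_mul_stripInt (R := R) (φ := φ) ht hab fun t ht h0 => by
      have := hN t ht φ h'; rw [h0, mul_zero] at this; linarith)
    rw [norm_mul, norm_mul, Complex.norm_I, one_mul, Complex.norm_real,
      Real.norm_of_nonneg hR.le] at e
    change _ = ‖D a φ - D b φ‖ at e
    have e2 : R ^ 2 * ‖A.stripInt R t₁ t₂ a b φ‖ ^ 2 ≤ 2 * (‖D a φ‖ ^ 2 + ‖D b φ‖ ^ 2) := by
      rw [← mul_pow, e]
      have := pow_le_pow_left₀ (norm_nonneg _) (norm_sub_le (D a φ) (D b φ)) 2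
      nlinarith [sq_nonneg (‖D a φ‖ - ‖D b φ‖)]
    have e3 : ρ ^ 4 ≤ χ φ := by
      have h1 : ρ ≤ φ - (φ₁ - ρ) := by linarith [h.1]
      have h2 : ρ ≤ φ₂ + ρ - φ := by linarith [h.2]
      have h3 := mul_le_mul h1 h2 hρ.le (hρ.le.trans h1)
      calc ρ ^ 4 = (ρ * ρ) ^ 2 := by ring
        _ ≤ _ := pow_le_pow_left₀ (by positivity) h3 2
    calc _ = ρ ^ 4 * (R ^ 2 * ‖A.stripInt R t₁ t₂ a b φ‖ ^ 2) := by ring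
      _ ≤ χ φ * (2 * (‖D a φ‖ ^ 2 + ‖D b φ‖ ^ 2)) := mul_le_mul e3 e2 (by positivity) (hχ0 φ)
      _ = _ := by ring
  have i12 := (ia.add ib).const_mul 2
  have m1 := intervalIntegral.integral_mono_on hφ
    (((A.continuous_stripInt R t₁ t₂ a b).norm.pow 2).const_mul (ρ ^ 4 * R ^ 2)
      |>.intervalIntegrable φ₁ φ₂) (i12.mono_set (by
        rw [uIcc_of_le hφ, uIcc_of_le hαβ]
        exact Icc_subset_Icc (by linarith) (by linarith))) pt
  have m2 := intervalIntegral.integral_mono_interval (by linarith : φ₁ - ρ ≤ φ₁) hφ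
    (by linarith : φ₂ ≤ φ₂ + ρ) (Eventually.of_forall fun φ => by
      have := hχ0 φ
      change 0 ≤ 2 * (χ φ * ‖D a φ‖ ^ 2 + χ φ * ‖D b φ‖ ^ 2)
      positivity) i12
  have m3 := m1.trans m2
  rw [intervalIntegral.integral_const_mul, intervalIntegral.integral_const_mul,
    intervalIntegral.integral_add ia ib] at m3
  rw [le_div_iff₀ (by positivity)]
  calc _ = R * (ρ ^ 4 * R ^ 2 * ∫ φ in φ₁..φ₂, ‖A.stripInt R t₁ t₂ a b φ‖ ^ 2) := by ring
    _ ≤ _ := mul_le_mul_of_nonneg_left m3 hR.le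
    _ ≤ 4 * C := by linarith

/-- At a corner of the box `nor ^ 2 + tan ^ 2 = 1` forces one component to be at least `1 / 2` in
absolute value. Uniform continuity then keeps it at least `1 / 4`, with constant sign, on the whole
box and on the margin `η` needed for the cutoff. -/
lemma exists_box_bound : ∃ η C : ℝ, 0 < η ∧ 0 ≤ C ∧ ∀ t₁ t₂ : ℝ, 0 ≤ t₁ → t₁ ≤ t₂ → t₂ ≤ A.len →
    t₂ - t₁ ≤ η → ∀ φ₁ φ₂ : ℝ, 0 ≤ φ₁ → φ₁ ≤ φ₂ → φ₂ ≤ 2 * Real.pi → φ₂ - φ₁ ≤ η →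
    ∀ R : ℝ, 0 < R → ∀ a b : ℝ, -A.width ≤ a → a ≤ b → b ≤ A.width →
    R ^ 3 * ∫ φ in φ₁..φ₂, ‖A.stripInt R t₁ t₂ a b φ‖ ^ 2 ≤ C := by
  obtain ⟨CT, hCT, hT⟩ := A.exists_tangential_bound
  obtain ⟨CN, hCN, hNb⟩ := A.exists_normal_bound
  -- The directions exceed `[0, 2π]` by 1 on both sides, which accommodates the margin `η ≤ 1`.
  have hcomp : IsCompact (Icc 0 A.len ×ˢ Icc (-1) (2 * Real.pi + 1)) :=
    isCompact_Icc.prod isCompact_Icc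
  have un := Metric.uniformContinuousOn_iff.1
    (hcomp.uniformContinuousOn_of_continuous A.continuous_nor.continuousOn) (1 / 4) (by norm_num)
  have ut := Metric.uniformContinuousOn_iff.1
    (hcomp.uniformContinuousOn_of_continuous A.continuous_tan.continuousOn) (1 / 4) (by norm_num)
  obtain ⟨δ₁, hδ₁, h1⟩ := un
  obtain ⟨δ₂, hδ₂, h2⟩ := ut
  set η := min 1 (min δ₁ δ₂ / 4) with hη
  have hη0 : 0 < η := lt_min one_pos (by positivity)
  have hη1 : η ≤ 1 := min_le_left _ _
  have hηδ : 4 * η ≤ min δ₁ δ₂ := by linarith [min_le_right 1 (min δ₁ δ₂ / 4)]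
  have hη₁ : 4 * η ≤ δ₁ := hηδ.trans (min_le_left _ _)
  have hη₂ : 4 * η ≤ δ₂ := hηδ.trans (min_le_right _ _)
  refine ⟨η, max CT (CN / η ^ 4), hη0, le_max_of_le_left hCT, ?_⟩
  intro t₁ t₂ ht₁ ht ht₂ htη φ₁ φ₂ hφ₁ hφ hφ₂ hφη R hR a b ha hab hb
  have close : ∀ t ∈ Icc t₁ t₂, ∀ φ ∈ Icc (φ₁ - η) (φ₂ + η),
      |A.nor t φ - A.nor t₁ φ₁| < 1 / 4 ∧ |A.tan t φ - A.tan t₁ φ₁| < 1 / 4 := by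
    intro t h φ h'
    have m1 : (t, φ) ∈ Icc 0 A.len ×ˢ Icc (-1) (2 * Real.pi + 1) :=
      ⟨⟨ht₁.trans h.1, h.2.trans ht₂⟩, ⟨by linarith [h'.1], by linarith [h'.2]⟩⟩
    have m2 : (t₁, φ₁) ∈ Icc 0 A.len ×ˢ Icc (-1) (2 * Real.pi + 1) :=
      ⟨⟨ht₁, ht.trans ht₂⟩, ⟨by linarith, by linarith⟩⟩
    have dd : dist (t, φ) (t₁, φ₁) < 4 * η := by
      rw [Prod.dist_eq, Real.dist_eq, Real.dist_eq]
      apply max_lt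
      · rw [abs_of_nonneg (by linarith [h.1])]; linarith [h.2]
      · rw [abs_lt]; constructor <;> linarith [h'.1, h'.2]
    have r1 := h1 _ m1 _ m2 (dd.trans_le hη₁)
    have r2 := h2 _ m1 _ m2 (dd.trans_le hη₂)
    rw [Real.dist_eq] at r1 r2
    exact ⟨r1, r2⟩
  have sgn : ∀ x : ℝ, 1 / 2 ≤ |x| → ∃ σ : ℝ, |σ| = 1 ∧ ∀ y, |y - x| < 1 / 4 → 1 / 4 ≤ σ * y := by
    intro x hx
    rcases le_total 0 x with h0 | h0
    · refine ⟨1, abs_one, fun y hy => ?_⟩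
      rw [abs_of_nonneg h0] at hx; rw [abs_lt] at hy; linarith
    · refine ⟨-1, by simp, fun y hy => ?_⟩
      rw [abs_of_nonpos h0] at hx; rw [abs_lt] at hy; linarith
  have hsum := A.nor_sq_add_tan_sq ⟨ht₁, ht.trans ht₂⟩ φ₁
  rcases le_or_gt (1 / 2) |A.nor t₁ φ₁| with hn | hn
  · obtain ⟨σ, hσ, hσy⟩ := sgn _ hn
    refine (hNb t₁ t₂ ht₁ ht ht₂ φ₁ φ₂ η σ hφ hη0 (by linarith) hσ
      (fun t h φ h' => hσy _ (close t h φ h').1) R hR a b ha hab hb).trans (le_max_right _ _)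
  · have htn : 1 / 2 ≤ |A.tan t₁ φ₁| := by
      by_contra hlt
      push Not at hlt
      have e1 := sq_abs (A.nor t₁ φ₁)
      have e2 := sq_abs (A.tan t₁ φ₁)
      nlinarith [abs_nonneg (A.nor t₁ φ₁), abs_nonneg (A.tan t₁ φ₁)]
    obtain ⟨σ, hσ, hσy⟩ := sgn _ htn
    exact (hT t₁ t₂ ht₁ ht ht₂ φ₁ φ₂ σ hφ hσ (fun t h φ h' => hσy _ (close t h φ
      ⟨by linarith [h'.1], by linarith [h'.2]⟩).2) R hR a b ha hab hb).trans (le_max_left _ _)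

/-- The sharp average decay of the Fourier transform of a rectangle in normal coordinates. -/
theorem exists_stripInt_bound : ∃ C : ℝ, 0 ≤ C ∧ ∀ R : ℝ, 0 < R → ∀ a b : ℝ, -A.width ≤ a → a ≤ b →
    b ≤ A.width → R ^ 3 * ∫ φ in (0 : ℝ)..2 * Real.pi, ‖A.stripInt R 0 A.len a b φ‖ ^ 2 ≤ C := by
  obtain ⟨η, C, hη, hC, hbox⟩ := A.exists_box_bound
  have hL := A.len_pos
  have hpi := Real.pi_pos
  obtain ⟨N, hN⟩ := exists_nat_gt (max (A.len / η) (2 * Real.pi / η))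
  have hN1 : A.len / η < N := (le_max_left _ _).trans_lt hN
  have hN2 : 2 * Real.pi / η < N := (le_max_right _ _).trans_lt hN
  have hNpos : (0 : ℝ) < N := (by positivity : 0 < A.len / η).trans hN1
  have grid : ∀ l : ℝ, 0 < l → l / η < N → (∀ i < N, 0 ≤ l / N * i ∧ l / N * i ≤ l / N * (i + 1 : ℕ) ∧
      l / N * (i + 1 : ℕ) ≤ l ∧ l / N * (i + 1 : ℕ) - l / N * i ≤ η) := by
    intro l hl hlN i hi
    have hlN' : l / N ≤ η := by
      rw [div_le_iff₀ hNpos]; rw [div_lt_iff₀ hη] at hlN; linarith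
    have hq : 0 ≤ l / N := by positivity
    have hi' : ((i + 1 : ℕ) : ℝ) ≤ N := by exact_mod_cast hi
    push_cast at hi' ⊢
    refine ⟨by positivity, by nlinarith, ?_, by nlinarith⟩
    calc l / N * (i + 1) ≤ l / N * N := mul_le_mul_of_nonneg_left hi' hq
      _ = l := by field_simp
  -- One factor `N` comes from Cauchy-Schwarz for the sum over arcs, one counts the arcs, one counts
  -- the intervals of directions.
  refine ⟨N * (N * (N * C)), by positivity, ?_⟩
  intro R hR a b ha hab hb
  set τ : ℕ → ℝ := fun i => A.len / N * i with hτ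
  set ϑ : ℕ → ℝ := fun i => 2 * Real.pi / N * i with hϑ
  have split : ∀ φ, A.stripInt R 0 A.len a b φ =
      ∑ i ∈ Finset.range N, A.stripInt R (τ i) (τ (i + 1)) a b φ := by
    intro φ
    unfold stripInt
    rw [← intervalIntegral.integral_finsetSum (f := fun i u => A.curveInt R (τ i) (τ (i + 1)) u φ)
      (fun i _ => ((A.continuous_curveInt R (τ i) (τ (i + 1))).comp (f := fun u => (u, φ))
        (by fun_prop)).intervalIntegrable _ _)]
    congr 1; ext u
    unfold curveInt
    have c : Continuous fun t => (A.F t : ℂ) * osc (R * A.phase u t φ) :=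
      (Complex.continuous_ofReal.comp A.cont_F).mul (continuous_osc.comp (continuous_const.mul
        (A.continuous_phase.comp (f := fun t => (u, t, φ)) (by fun_prop))))
    rw [intervalIntegral.sum_integral_adjacent_intervals fun k _ => c.intervalIntegrable _ _]
    simp only [hτ, Nat.cast_zero, mul_zero]
    rw [div_mul_cancel₀ _ hNpos.ne']
  have pt : ∀ φ, ‖A.stripInt R 0 A.len a b φ‖ ^ 2 ≤
      N * ∑ i ∈ Finset.range N, ‖A.stripInt R (τ i) (τ (i + 1)) a b φ‖ ^ 2 := by
    intro φ
    rw [split φ]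
    refine (pow_le_pow_left₀ (norm_nonneg _) (norm_sum_le _ _) 2).trans ?_
    have := sq_sum_le_card_mul_sum_sq (s := Finset.range N)
      (f := fun i => ‖A.stripInt R (τ i) (τ (i + 1)) a b φ‖)
    rwa [Finset.card_range] at this
  have cont : ∀ i, Continuous fun φ => ‖A.stripInt R (τ i) (τ (i + 1)) a b φ‖ ^ 2 := fun i =>
    (A.continuous_stripInt R _ _ a b).norm.pow 2
  have piece : ∀ i ∈ Finset.range N,
      R ^ 3 * ∫ φ in (0 : ℝ)..2 * Real.pi, ‖A.stripInt R (τ i) (τ (i + 1)) a b φ‖ ^ 2 ≤ N * C := by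
    intro i hi
    have adj := intervalIntegral.sum_integral_adjacent_intervals (μ := volume) (a := ϑ) (n := N)
      (f := fun φ => ‖A.stripInt R (τ i) (τ (i + 1)) a b φ‖ ^ 2)
      fun k _ => (cont i).intervalIntegrable _ _
    have e0 : ϑ 0 = 0 := by simp [hϑ]
    have eN : ϑ N = 2 * Real.pi := by simp only [hϑ]; rw [div_mul_cancel₀ _ hNpos.ne']
    rw [e0, eN] at adj
    rw [← adj, Finset.mul_sum]
    obtain ⟨g1, g2, g3, g4⟩ := grid A.len hL hN1 i (Finset.mem_range.1 hi)
    calc _ ≤ ∑ j ∈ Finset.range N, C := Finset.sum_le_sum fun j hj => by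
          obtain ⟨q1, q2, q3, q4⟩ := grid (2 * Real.pi) (by positivity) hN2 j (Finset.mem_range.1 hj)
          exact hbox _ _ g1 g2 g3 g4 _ _ q1 q2 q3 q4 R hR a b ha hab hb
      _ = N * C := by rw [Finset.sum_const, Finset.card_range, nsmul_eq_mul]
  have h2π : (0 : ℝ) ≤ 2 * Real.pi := by positivity
  have mono := intervalIntegral.integral_mono_on (μ := volume) h2π
    (((A.continuous_stripInt R 0 A.len a b).norm.pow 2).intervalIntegrable 0 (2 * Real.pi))
    ((continuous_const.mul (continuous_finsetSum (Finset.range N)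
      fun i _ => cont i)).intervalIntegrable 0 (2 * Real.pi))
    fun φ _ => pt φ
  simp only [Pi.mul_apply, Pi.pow_apply] at mono
  rw [intervalIntegral.integral_const_mul, intervalIntegral.integral_finsetSum
    fun i _ => (cont i).intervalIntegrable _ _] at mono
  calc _ ≤ R ^ 3 * (N * ∑ i ∈ Finset.range N,
        ∫ φ in (0 : ℝ)..2 * Real.pi, ‖A.stripInt R (τ i) (τ (i + 1)) a b φ‖ ^ 2) :=
        mul_le_mul_of_nonneg_left mono (by positivity)
    _ = N * ∑ i ∈ Finset.range N, R ^ 3 *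
        ∫ φ in (0 : ℝ)..2 * Real.pi, ‖A.stripInt R (τ i) (τ (i + 1)) a b φ‖ ^ 2 := by
        rw [← Finset.mul_sum]; ring
    _ ≤ N * ∑ i ∈ Finset.range N, (N * C : ℝ) :=
        mul_le_mul_of_nonneg_left (Finset.sum_le_sum piece) hNpos.le
    _ = _ := by rw [Finset.sum_const, Finset.card_range, nsmul_eq_mul]

end NormalStrip

/-! ### Piecewise smooth weights -/

/-- Induction over intervals: an additive property of intervals that holds for all small intervals
to the left and to the right of each point holds for the whole interval. -/
lemma interval_induction {P : ℝ → ℝ → Prop} {a b : ℝ} (hab : a ≤ b) (hrefl : P a a)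
    (hadd : ∀ x y z, a ≤ x → x ≤ y → y ≤ z → z ≤ b → P x y → P y z → P x z)
    (hloc : ∀ s ∈ Icc a b, ∃ δ > 0, (∀ r ∈ Ioo s (s + δ), r ≤ b → P s r) ∧
      ∀ r ∈ Ioo (s - δ) s, a ≤ r → P r s) : P a b := by
  set E := {x | x ∈ Icc a b ∧ P a x}
  have hE : a ∈ E := ⟨left_mem_Icc.2 hab, hrefl⟩
  have hbdd : BddAbove E := ⟨b, fun x hx => hx.1.2⟩
  set x := sSup E
  have hax : a ≤ x := le_csSup hbdd hE
  have hxb : x ≤ b := csSup_le ⟨a, hE⟩ fun y hy => hy.1.2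
  obtain ⟨δ, hδ, hr, hl⟩ := hloc x ⟨hax, hxb⟩
  have hPx : P a x := by
    obtain ⟨y, hy, hyx⟩ := exists_lt_of_lt_csSup ⟨a, hE⟩ (sub_lt_self x hδ)
    rcases (le_csSup hbdd hy).eq_or_lt with h | h
    · rw [h] at hy; exact hy.2
    · exact hadd a y x le_rfl hy.1.1 h.le hxb hy.2 (hl y ⟨hyx, h⟩ hy.1.1)
  rcases hxb.eq_or_lt with h | h
  · rwa [h] at hPx
  · exfalso
    set r := min (x + δ / 2) b
    have hxr : x < r := lt_min (by linarith) h
    have hrδ : r < x + δ := (min_le_left _ _).trans_lt (by linarith)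
    have : r ∈ E := ⟨⟨hax.trans hxr.le, min_le_right _ _⟩,
      hadd a x r le_rfl hax hxr.le (min_le_right _ _) hPx (hr r ⟨hxr, hrδ⟩ (min_le_right _ _))⟩
    exact absurd (le_csSup hbdd this) (not_le.2 hxr)

/-- `θ` is piecewise `C^1`. -/
structure PiecewiseC1 (θ : ℝ → ℝ) : Prop where
  exceptional : ∃ B : Finset ℝ, ∀ s ∉ B, ContDiffAt ℝ 1 θ s
  left : ∀ s, ∃ l, Tendsto θ (𝓝[<] s) (𝓝 l)
  right : ∀ s, ∃ l, Tendsto θ (𝓝[>] s) (𝓝 l)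
  left_deriv : ∀ s, ∃ l, Tendsto (deriv θ) (𝓝[<] s) (𝓝 l)
  right_deriv : ∀ s, ∃ l, Tendsto (deriv θ) (𝓝[>] s) (𝓝 l)

lemma ContDiffAt.continuousAt_deriv {θ : ℝ → ℝ} {s : ℝ} (h : ContDiffAt ℝ 1 θ s) :
    ContinuousAt (deriv θ) s := by
  have h1 : ContDiffAt ℝ 0 (fderiv ℝ θ) s := h.fderiv_right (by norm_num)
  have h2 := h1.continuousAt
  have : deriv θ = fun x => fderiv ℝ θ x 1 := by ext x; simp
  rw [this]
  exact h2.clm_apply continuousAt_const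

/-- Only `θ` and its first derivative are needed. For `q ≥ 2` both are continuous. For `q = 1` the
function `θ` is continuous and `θ'` has the prescribed one-sided limits. For `q = 0` both have such
limits. -/
lemma IsWeight.piecewiseC1 {q : ℕ} {θ : ℝ → ℝ} (h : IsWeight q θ) : PiecewiseC1 θ := by
  obtain ⟨B, hB, hBl⟩ := h.piecewise
  have smooth : ∀ s ∉ B, ContDiffAt ℝ 1 θ s := fun s hs => (hB s hs).of_le (by
    have : (1 : ℕ) ≤ q + 1 := by omega
    exact_mod_cast this)
  have cont : ∀ s, s ∈ B → 1 ≤ q → ContinuousAt θ s := fun s _ hq => by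
    have := h.contDiff (q - 1) (by omega)
    exact this.continuous.continuousAt
  have cont' : ∀ s, s ∈ B → 2 ≤ q → ContinuousAt (deriv θ) s := fun s _ hq => by
    have := h.contDiff (q - 1) (by omega)
    refine ContDiffAt.continuousAt_deriv (this.contDiffAt.of_le ?_)
    have : (1 : ℕ) ≤ q - 1 := by omega
    exact_mod_cast this
  have val : ∀ s, ContinuousAt θ s ∨ (q = 0 ∧ s ∈ B) := fun s => by
    by_cases hs : s ∈ B
    · rcases Nat.eq_zero_or_pos q with h0 | h0
      · exact Or.inr ⟨h0, hs⟩
      · exact Or.inl (cont s hs h0)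
    · exact Or.inl (smooth s hs).continuousAt
  have val' : ∀ s, ContinuousAt (deriv θ) s ∨ ((1 = q ∨ 1 = q + 1) ∧ s ∈ B) := fun s => by
    by_cases hs : s ∈ B
    · rcases le_or_gt 2 q with h0 | h0
      · exact Or.inl (cont' s hs h0)
      · exact Or.inr ⟨by omega, hs⟩
    · exact Or.inl (smooth s hs).continuousAt_deriv
  refine ⟨⟨B, smooth⟩, fun s => ?_, fun s => ?_, fun s => ?_, fun s => ?_⟩
  · rcases val s with h1 | ⟨h0, hs⟩
    · exact ⟨_, h1.tendsto.mono_left nhdsWithin_le_nhds⟩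
    · simpa using (hBl s hs 0 (Or.inl h0.symm)).1
  · rcases val s with h1 | ⟨h0, hs⟩
    · exact ⟨_, h1.tendsto.mono_left nhdsWithin_le_nhds⟩
    · simpa using (hBl s hs 0 (Or.inl h0.symm)).2
  · rcases val' s with h1 | ⟨h0, hs⟩
    · exact ⟨_, h1.tendsto.mono_left nhdsWithin_le_nhds⟩
    · simpa using (hBl s hs 1 h0).1
  · rcases val' s with h1 | ⟨h0, hs⟩
    · exact ⟨_, h1.tendsto.mono_left nhdsWithin_le_nhds⟩
    · simpa using (hBl s hs 1 h0).2

namespace PiecewiseC1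

variable {θ : ℝ → ℝ}

lemma measurable (h : PiecewiseC1 θ) : Measurable θ := by
  obtain ⟨B, hB⟩ := h.exceptional
  refine measurable_of_measurable_on_compl_finite (B : Set ℝ) B.finite_toSet ?_
  have : ContinuousOn θ (B : Set ℝ)ᶜ := fun s hs => (hB s hs).continuousAt.continuousWithinAt
  exact (continuousOn_iff_continuous_domRestrict.1 this).measurable

/-- Each point has one-sided neighbourhoods free of exceptional points. -/
lemma exists_smooth_sides (h : PiecewiseC1 θ) (s : ℝ) : ∃ δ > 0,
    (∀ r ∈ Ioo s (s + δ), ContDiffAt ℝ 1 θ r) ∧ ∀ r ∈ Ioo (s - δ) s, ContDiffAt ℝ 1 θ r := by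
  obtain ⟨B, hB⟩ := h.exceptional
  have hc : IsClosed ((B : Set ℝ) \ {s}) := (B.finite_toSet.sdiff).isClosed
  have hs : ((B : Set ℝ) \ {s})ᶜ ∈ 𝓝 s := hc.isOpen_compl.mem_nhds (by simp)
  obtain ⟨δ, hδ, hsub⟩ := Metric.mem_nhds_iff.1 hs
  have key : ∀ r, |r - s| < δ → r ≠ s → ContDiffAt ℝ 1 θ r := fun r hr hne => by
    have := hsub (show r ∈ Metric.ball s δ by rwa [Metric.mem_ball, Real.dist_eq])
    exact hB r fun hr' => this ⟨hr', hne⟩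
  refine ⟨δ, hδ, fun r hr => key r ?_ hr.1.ne', fun r hr => key r ?_ hr.2.ne⟩
  · rw [abs_lt]; constructor <;> linarith [hr.1, hr.2]
  · rw [abs_lt]; constructor <;> linarith [hr.1, hr.2]

lemma exists_bound (h : PiecewiseC1 θ) {a b : ℝ} (hab : a ≤ b) : ∃ B, ∀ s ∈ Icc a b, |θ s| ≤ B := by
  refine interval_induction (P := fun a b => ∃ B, ∀ s ∈ Icc a b, |θ s| ≤ B) hab
    ⟨|θ a|, fun s hs => ?_⟩ ?_ ?_
  · rw [le_antisymm hs.2 hs.1]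
  · rintro x y z - hxy hyz - ⟨B, hB⟩ ⟨C, hC⟩
    refine ⟨max B C, fun s hs => ?_⟩
    rcases le_total s y with hsy | hsy
    · exact (hB s ⟨hs.1, hsy⟩).trans (le_max_left _ _)
    · exact (hC s ⟨hsy, hs.2⟩).trans (le_max_right _ _)
  · intro s _
    obtain ⟨l, hl⟩ := h.left s
    obtain ⟨r, hr⟩ := h.right s
    have el : ∀ᶠ x in 𝓝[<] s, |θ x| ≤ |l| + 1 := hl.abs.eventually_le_const (by linarith)
    have er : ∀ᶠ x in 𝓝[>] s, |θ x| ≤ |r| + 1 := hr.abs.eventually_le_const (by linarith)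
    obtain ⟨x, hx, hxs⟩ := mem_nhdsLT_iff_exists_Ioo_subset.1 el
    obtain ⟨y, hy, hys⟩ := mem_nhdsGT_iff_exists_Ioo_subset.1 er
    have hx' : x < s := hx
    have hy' : s < y := hy
    refine ⟨min (s - x) (y - s), lt_min (by linarith) (by linarith), fun t ht _ => ?_, fun t ht _ => ?_⟩
    · refine ⟨max |θ s| (|r| + 1), fun z hz => ?_⟩
      rcases hz.1.eq_or_lt with h0 | h0
      · rw [← h0]; exact le_max_left _ _
      · refine le_max_of_le_right (hys ⟨h0, ?_⟩)
        linarith [hz.2, ht.2, min_le_right (s - x) (y - s)]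
    · refine ⟨max |θ s| (|l| + 1), fun z hz => ?_⟩
      rcases hz.2.eq_or_lt with h0 | h0
      · rw [h0]; exact le_max_left _ _
      · refine le_max_of_le_right (hxs ⟨?_, h0⟩)
        linarith [hz.1, ht.1, min_le_left (s - x) (y - s)]

lemma intervalIntegrable (h : PiecewiseC1 θ) {a b : ℝ} (hab : a ≤ b) :
    IntervalIntegrable θ volume a b := by
  obtain ⟨B, hB⟩ := h.exists_bound hab
  rw [intervalIntegrable_iff_integrableOn_Ioc_of_le hab]
  refine Measure.integrableOn_of_bounded (M := B) (by simp) h.measurable.aestronglyMeasurable ?_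
  exact (ae_restrict_mem measurableSet_Ioc).mono fun s hs => hB s (Ioc_subset_Icc_self hs)

end PiecewiseC1

/-! ### Weights across the strip. -/

namespace NormalStrip

variable (A : NormalStrip)

/-- The oscillatory integral with a weight across the strip. -/
def weightInt (θ : ℝ → ℝ) (ε R a b φ : ℝ) : ℂ :=
  ∫ s in a..b, (θ s : ℂ) * A.curveInt R 0 A.len (ε * s) φ

-- Integration by parts in `s` against the primitive `K` of the curve integrals. Since `K s` is
-- `ε⁻¹` times the unweighted strip integral between the heights `ε a` and `ε s`, the bound for
-- strips transfers at the cost of `ε⁻²`. Only the boundedness of `θ` and of its derivative on the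
-- piece is used, which is why weights with jumps are allowed.
set_option maxHeartbeats 1000000 in
lemma norm_weightInt_piece_le {θ : ℝ → ℝ} {a b : ℝ} (hab : a < b) (ha : -1 ≤ a) (hb : b ≤ 1)
    (hsm : ∀ s ∈ Ioo a b, ContDiffAt ℝ 1 θ s)
    (hr : ∃ l, Tendsto θ (𝓝[>] a) (𝓝 l)) (hl : ∃ l, Tendsto θ (𝓝[<] b) (𝓝 l))
    (hr' : ∃ l, Tendsto (deriv θ) (𝓝[>] a) (𝓝 l)) (hl' : ∃ l, Tendsto (deriv θ) (𝓝[<] b) (𝓝 l)) :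
    ∃ C : ℝ, 0 ≤ C ∧ ∀ ε : ℝ, 0 < ε → ε ≤ A.width → ∀ R : ℝ, 0 < R →
      R ^ 3 * ∫ φ in (0 : ℝ)..2 * Real.pi, ‖A.weightInt θ ε R a b φ‖ ^ 2 ≤ C / ε ^ 2 := by
  obtain ⟨C, hC, hcore⟩ := A.exists_stripInt_bound
  obtain ⟨la, hla⟩ := hr
  obtain ⟨lb, hlb⟩ := hl
  obtain ⟨la', hla'⟩ := hr'
  obtain ⟨lb', hlb'⟩ := hl'
  -- The one-sided limits extend `θ` and its derivative continuously to the closed piece; the values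
  -- of `θ` at the end points do not affect the integral.
  set θ₁ := extendFrom (Ioo a b) θ with hθ₁
  set D := extendFrom (Ioo a b) (deriv θ) with hD
  have cθ : ContinuousOn θ₁ (Icc a b) := continuousOn_Icc_extendFrom_Ioo
    (fun s hs => (hsm s hs).continuousAt.continuousWithinAt) hla hlb
  have cD : ContinuousOn D (Icc a b) := continuousOn_Icc_extendFrom_Ioo
    (fun s hs => (hsm s hs).continuousAt_deriv.continuousWithinAt) hla' hlb'
  have eθ : ∀ s ∈ Ioo a b, θ₁ s = θ s := fun s hs => by
    refine extendFrom_eq (subset_closure hs) ?_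
    exact (hsm s hs).continuousAt.continuousWithinAt
  have eD : ∀ s ∈ Ioo a b, D s = deriv θ s := fun s hs => by
    refine extendFrom_eq (subset_closure hs) ?_
    exact (hsm s hs).continuousAt_deriv.continuousWithinAt
  have dθ : ∀ s ∈ Ioo a b, HasDerivAt θ₁ (D s) s := fun s hs => by
    have h1 := ((hsm s hs).differentiableAt one_ne_zero).hasDerivAt
    rw [eD s hs]
    exact h1.congr_of_eventuallyEq
      ((isOpen_Ioo.mem_nhds hs : Ioo a b ∈ 𝓝 s) |> fun h => Filter.eventually_of_mem h eθ)
  obtain ⟨B, hB⟩ := isCompact_Icc.exists_bound_of_continuousOn cD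
  have hB0 : 0 ≤ B := (norm_nonneg _).trans (hB a (left_mem_Icc.2 hab.le))
  refine ⟨2 * (θ₁ b ^ 2 * C + B ^ 2 * (2 * (2 * C))), by positivity, ?_⟩
  intro ε hε hεw R hR
  set V : ℝ → ℝ → ℂ := fun s φ => A.curveInt R 0 A.len (ε * s) φ with hV
  have cV : Continuous fun z : ℝ × ℝ => V z.1 z.2 :=
    (A.continuous_curveInt R 0 A.len).comp (f := fun z : ℝ × ℝ => (ε * z.1, z.2)) (by fun_prop)
  have cVs : ∀ φ, Continuous fun s => V s φ := fun φ => cV.comp (f := fun s => (s, φ)) (by fun_prop)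
  set K : ℝ → ℝ → ℂ := fun s φ => ∫ r in a..s, V r φ with hK
  have cK : Continuous fun z : ℝ × ℝ => K z.1 z.2 := by
    have h1 : Continuous (Function.uncurry fun φ s => V s φ) :=
      cV.comp (f := fun z : ℝ × ℝ => (z.2, z.1)) (by fun_prop)
    have := intervalIntegral.continuous_parametric_primitive_of_continuous (μ := volume) (a₀ := a) h1
    exact this.comp (f := fun z : ℝ × ℝ => (z.2, z.1)) (by fun_prop)
  have cKs : ∀ φ, Continuous fun s => K s φ := fun φ => cK.comp (f := fun s => (s, φ)) (by fun_prop)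
  have cKφ : ∀ s, Continuous fun φ => K s φ := fun s => cK.comp (f := fun φ => (s, φ)) (by fun_prop)
  have hKeq : ∀ s φ, K s φ = (ε : ℂ)⁻¹ * A.stripInt R 0 A.len (ε * a) (ε * s) φ := fun s φ => by
    simp only [hK, hV]
    rw [intervalIntegral.integral_comp_mul_left (fun u => A.curveInt R 0 A.len u φ) hε.ne']
    rw [Complex.real_smul]; push_cast; rfl
  have hKb : ∀ s ∈ Icc a b, R ^ 3 * ∫ φ in (0 : ℝ)..2 * Real.pi, ‖K s φ‖ ^ 2 ≤ C / ε ^ 2 := by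
    intro s hs
    have e : ∀ φ, ‖K s φ‖ ^ 2 = (1 / ε ^ 2) * ‖A.stripInt R 0 A.len (ε * a) (ε * s) φ‖ ^ 2 := fun φ => by
      rw [hKeq, norm_mul, norm_inv, Complex.norm_real, Real.norm_of_nonneg hε.le, mul_pow]
      field_simp
    simp only [e]
    rw [intervalIntegral.integral_const_mul, mul_left_comm, one_div, div_eq_inv_mul C]
    refine mul_le_mul_of_nonneg_left (hcore R hR _ _ ?_ ?_ ?_) (by positivity)
    · nlinarith
    · exact mul_le_mul_of_nonneg_left hs.1 hε.le
    · nlinarith [hs.2]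
  have parts : ∀ φ, A.weightInt θ ε R a b φ =
      (θ₁ b : ℂ) * K b φ - ∫ s in a..b, (D s : ℂ) * K s φ := by
    intro φ
    have i1 : IntervalIntegrable (fun s => (D s : ℂ) * K s φ) volume a b := by
      apply ContinuousOn.intervalIntegrable
      rw [uIcc_of_le hab.le]
      exact (Complex.continuous_ofReal.comp_continuousOn cD).mul (cKs φ).continuousOn
    have i2 : IntervalIntegrable (fun s => (θ₁ s : ℂ) * V s φ) volume a b := by
      apply ContinuousOn.intervalIntegrable
      rw [uIcc_of_le hab.le]
      exact (Complex.continuous_ofReal.comp_continuousOn cθ).mul (cVs φ).continuousOn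
    have key := integral_eq_of_hasDerivAt_off_countable_of_le (fun s => (θ₁ s : ℂ) * K s φ)
      (fun s => (D s : ℂ) * K s φ + (θ₁ s : ℂ) * V s φ) hab.le countable_empty
      ((Complex.continuous_ofReal.comp_continuousOn cθ).mul (cKs φ).continuousOn)
      (fun s hs => (dθ s hs.1).ofReal_comp.mul
        (intervalIntegral.integral_hasDerivAt_right ((cVs φ).intervalIntegrable _ _)
          ((cVs φ).stronglyMeasurableAtFilter _ _) (cVs φ).continuousAt)) (i1.add i2)
    rw [intervalIntegral.integral_add i1 i2] at key
    have e : A.weightInt θ ε R a b φ = ∫ s in a..b, (θ₁ s : ℂ) * V s φ := by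
      unfold weightInt
      refine intervalIntegral.integral_congr_uIoo ?_
      rw [uIoo_of_le hab.le]
      intro s hs
      simp only [eθ s hs, hV]
    have ka : K a φ = 0 := by simp [hK]
    rw [ka, mul_zero, sub_zero] at key
    rw [e, ← key]; ring
  have pt : ∀ φ, ‖A.weightInt θ ε R a b φ‖ ^ 2 ≤
      2 * (θ₁ b ^ 2 * ‖K b φ‖ ^ 2 + B ^ 2 * (2 * ∫ s in a..b, ‖K s φ‖ ^ 2)) := by
    intro φ
    have n1 : ‖∫ s in a..b, (D s : ℂ) * K s φ‖ ≤ B * ∫ s in a..b, ‖K s φ‖ := by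
      rw [← intervalIntegral.integral_const_mul]
      refine intervalIntegral.norm_integral_le_of_norm_le hab.le (Eventually.of_forall fun s hs => ?_)
        (((cKs φ).norm.intervalIntegrable _ _).const_mul _)
      rw [norm_mul, Complex.norm_real]
      exact mul_le_mul_of_nonneg_right (hB s (Ioc_subset_Icc_self hs)) (norm_nonneg _)
    -- Cauchy-Schwarz; the 2 bounds the length of `[a, b] ⊆ [-1, 1]`.
    have n2 : (∫ s in a..b, ‖K s φ‖) ^ 2 ≤ 2 * ∫ s in a..b, ‖K s φ‖ ^ 2 := by
      have := sq_integral_mul_le (μ := volume.restrict (Ioc a b)) (m := fun _ => 1)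
        (k := fun s => ‖K s φ‖) (Eventually.of_forall fun _ => zero_le_one)
        (integrable_const _) (by simp only [one_mul]; exact (cKs φ).norm.integrableOn_Ioc)
        (by simp only [one_mul]; exact ((cKs φ).norm.pow 2).integrableOn_Ioc)
      simp only [one_mul, ← intervalIntegral.integral_of_le hab.le] at this
      refine this.trans (mul_le_mul_of_nonneg_right ?_ ?_)
      · rw [intervalIntegral.integral_const, smul_eq_mul]; linarith
      · exact intervalIntegral.integral_nonneg hab.le fun _ _ => sq_nonneg _
    have n3 : ‖∫ s in a..b, (D s : ℂ) * K s φ‖ ^ 2 ≤ B ^ 2 * (2 * ∫ s in a..b, ‖K s φ‖ ^ 2) := by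
      refine (pow_le_pow_left₀ (norm_nonneg _) n1 2).trans ?_
      rw [mul_pow]
      exact mul_le_mul_of_nonneg_left n2 (sq_nonneg _)
    rw [parts φ]
    have n4 := pow_le_pow_left₀ (norm_nonneg _)
      (norm_sub_le ((θ₁ b : ℂ) * K b φ) (∫ s in a..b, (D s : ℂ) * K s φ)) 2
    have n5 : ‖(θ₁ b : ℂ) * K b φ‖ ^ 2 = θ₁ b ^ 2 * ‖K b φ‖ ^ 2 := by
      rw [norm_mul, mul_pow, Complex.norm_real, Real.norm_eq_abs, sq_abs]
    nlinarith [sq_nonneg (‖(θ₁ b : ℂ) * K b φ‖ - ‖∫ s in a..b, (D s : ℂ) * K s φ‖)]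
  have h2π : (0 : ℝ) ≤ 2 * Real.pi := by positivity
  have cnorm : Continuous fun z : ℝ × ℝ => ‖K z.2 z.1‖ ^ 2 :=
    ((cK.comp (f := fun z : ℝ × ℝ => (z.2, z.1)) (by fun_prop)).norm.pow 2)
  have iK : Integrable (Function.uncurry fun φ s => ‖K s φ‖ ^ 2)
      ((volume.restrict (Ioc 0 (2 * Real.pi))).prod (volume.restrict (Ioc a b))) :=
    cnorm.continuousOn.integrable_prod_Ioc
  have sw : R ^ 3 * ∫ φ in (0 : ℝ)..2 * Real.pi, ∫ s in a..b, ‖K s φ‖ ^ 2 ≤ 2 * (C / ε ^ 2) := by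
    rw [intervalIntegral_swap h2π hab.le iK, ← intervalIntegral.integral_const_mul]
    calc _ ≤ ∫ s in a..b, C / ε ^ 2 := by
          apply intervalIntegral.integral_mono_on hab.le _ _root_.intervalIntegrable_const hKb
          refine IntervalIntegrable.const_mul ?_ _
          rw [intervalIntegrable_iff_integrableOn_Ioc_of_le hab.le]
          simp only [intervalIntegral.integral_of_le h2π]
          exact iK.integral_prod_right
      _ ≤ _ := by
          rw [intervalIntegral.integral_const, smul_eq_mul]
          exact mul_le_mul_of_nonneg_right (by linarith) (by positivity)
  have iφ : IntervalIntegrable (fun φ => ∫ s in a..b, ‖K s φ‖ ^ 2) volume 0 (2 * Real.pi) := by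
    rw [intervalIntegrable_iff_integrableOn_Ioc_of_le h2π]
    simp only [intervalIntegral.integral_of_le hab.le]
    exact iK.integral_prod_left
  have iKb : IntervalIntegrable (fun φ => ‖K b φ‖ ^ 2) volume 0 (2 * Real.pi) :=
    ((cKφ b).norm.pow 2).intervalIntegrable _ _
  have tot : ∫ φ in (0 : ℝ)..2 * Real.pi, ‖A.weightInt θ ε R a b φ‖ ^ 2 ≤
      ∫ φ in (0 : ℝ)..2 * Real.pi,
        2 * (θ₁ b ^ 2 * ‖K b φ‖ ^ 2 + B ^ 2 * (2 * ∫ s in a..b, ‖K s φ‖ ^ 2)) := by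
    rw [intervalIntegral.integral_of_le h2π, intervalIntegral.integral_of_le h2π]
    refine integral_mono_of_nonneg (Eventually.of_forall fun φ => sq_nonneg _) ?_
      (Eventually.of_forall pt)
    exact (((iKb.const_mul (θ₁ b ^ 2)).add ((iφ.const_mul 2).const_mul (B ^ 2))).const_mul 2).1
  rw [intervalIntegral.integral_const_mul, intervalIntegral.integral_add (iKb.const_mul _)
    ((iφ.const_mul 2).const_mul _), intervalIntegral.integral_const_mul,
    intervalIntegral.integral_const_mul, intervalIntegral.integral_const_mul] at tot
  have t1 := hKb b (right_mem_Icc.2 hab.le)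
  set I₁ := ∫ φ in (0 : ℝ)..2 * Real.pi, ‖K b φ‖ ^ 2
  set I₂ := ∫ φ in (0 : ℝ)..2 * Real.pi, ∫ s in a..b, ‖K s φ‖ ^ 2
  calc _ ≤ R ^ 3 * (2 * (θ₁ b ^ 2 * I₁ + B ^ 2 * (2 * I₂))) :=
        mul_le_mul_of_nonneg_left tot (by positivity)
    _ = 2 * (θ₁ b ^ 2 * (R ^ 3 * I₁) + B ^ 2 * (2 * (R ^ 3 * I₂))) := by ring
    _ ≤ 2 * (θ₁ b ^ 2 * (C / ε ^ 2) + B ^ 2 * (2 * (2 * (C / ε ^ 2)))) := by gcongr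
    _ = _ := by ring

/-- The average decay of the Fourier transform of the weighted strip. -/
theorem exists_weightInt_bound {θ : ℝ → ℝ} (hθ : PiecewiseC1 θ) :
    ∃ C : ℝ, 0 ≤ C ∧ ∀ ε : ℝ, 0 < ε → ε ≤ A.width → ∀ R : ℝ, 0 < R →
      R ^ 3 * ∫ φ in (0 : ℝ)..2 * Real.pi, ‖A.weightInt θ ε R (-1) 1 φ‖ ^ 2 ≤ C / ε ^ 2 := by
  have h2π : (0 : ℝ) ≤ 2 * Real.pi := by positivity
  have cont : ∀ ε R a b, a ≤ b → Continuous (A.weightInt θ ε R a b) := by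
    intro ε R a b hab
    unfold weightInt
    obtain ⟨B, hB⟩ := hθ.exists_bound hab
    have cV := A.continuous_curveInt R 0 A.len
    obtain ⟨M, d, hM, hd, hbd, hreg⟩ := A.exists_bounds
    refine intervalIntegral.continuous_of_dominated_interval (bound := fun _ => B * (M * A.len)) ?_ ?_
      _root_.intervalIntegrable_const ?_
    · intro φ
      exact ((Complex.measurable_ofReal.comp hθ.measurable).mul
        (cV.comp (f := fun s => (ε * s, φ)) (by fun_prop)).measurable).aestronglyMeasurable
    · intro φ
      refine Eventually.of_forall fun s hs => ?_
      rw [uIoc_of_le hab] at hs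
      have hb := hB s (Ioc_subset_Icc_self hs)
      rw [norm_mul, Complex.norm_real]
      refine mul_le_mul hb ?_ (norm_nonneg _) ((abs_nonneg _).trans hb)
      have := norm_integral_mul_osc_le (ψ := fun t => R * A.phase (ε * s) t φ) A.len_pos.le
        fun t ht => (hbd t ht).1
      rwa [sub_zero] at this
    · refine Eventually.of_forall fun s _ => ?_
      exact continuous_const.mul (cV.comp (f := fun φ => (ε * s, φ)) (by fun_prop))
  -- Every point has smooth pieces on both sides, with jumps only at their ends. Joining two pieces
  -- at most doubles the sum of their constants.
  refine interval_induction (P := fun a b => ∃ C : ℝ, 0 ≤ C ∧ ∀ ε : ℝ, 0 < ε → ε ≤ A.width →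
      ∀ R : ℝ, 0 < R → R ^ 3 * ∫ φ in (0 : ℝ)..2 * Real.pi, ‖A.weightInt θ ε R a b φ‖ ^ 2 ≤ C / ε ^ 2)
      (by norm_num) ?_ ?_ ?_
  · refine ⟨0, le_rfl, fun ε _ _ R _ => ?_⟩
    simp [weightInt]
  · rintro x y z - hxy hyz - ⟨C₁, hC₁, h1⟩ ⟨C₂, hC₂, h2⟩
    refine ⟨2 * (C₁ + C₂), by positivity, fun ε hε hεw R hR => ?_⟩
    have e : ∀ φ, A.weightInt θ ε R x z φ = A.weightInt θ ε R x y φ + A.weightInt θ ε R y z φ := by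
      intro φ
      have ii : ∀ a b, a ≤ b → IntervalIntegrable
          (fun s => (θ s : ℂ) * A.curveInt R 0 A.len (ε * s) φ) volume a b := fun a b hab => by
        have hi := hθ.intervalIntegrable hab
        have hi' : IntervalIntegrable (fun s => (θ s : ℂ)) volume a b := ⟨hi.1.ofReal, hi.2.ofReal⟩
        exact hi'.mul_continuousOn ((A.continuous_curveInt R 0 A.len).comp
          (f := fun s => (ε * s, φ)) (by fun_prop)).continuousOn
      exact (intervalIntegral.integral_add_adjacent_intervals (ii x y hxy) (ii y z hyz)).symm
    have c1 := (cont ε R x y hxy).norm.pow 2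
    have c2 := (cont ε R y z hyz).norm.pow 2
    have i1 : IntervalIntegrable (fun φ => ‖A.weightInt θ ε R x y φ‖ ^ 2) volume 0 (2 * Real.pi) :=
      c1.intervalIntegrable _ _
    have i2 : IntervalIntegrable (fun φ => ‖A.weightInt θ ε R y z φ‖ ^ 2) volume 0 (2 * Real.pi) :=
      c2.intervalIntegrable _ _
    have i3 : IntervalIntegrable (fun φ => ‖A.weightInt θ ε R x z φ‖ ^ 2) volume 0 (2 * Real.pi) :=
      ((cont ε R x z (hxy.trans hyz)).norm.pow 2).intervalIntegrable _ _
    have m := intervalIntegral.integral_mono_on h2π i3 ((i1.add i2).const_mul 2) fun φ _ => by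
      rw [e φ]
      have n4 := pow_le_pow_left₀ (norm_nonneg _)
        (norm_add_le (A.weightInt θ ε R x y φ) (A.weightInt θ ε R y z φ)) 2
      nlinarith [sq_nonneg (‖A.weightInt θ ε R x y φ‖ - ‖A.weightInt θ ε R y z φ‖)]
    rw [intervalIntegral.integral_const_mul, intervalIntegral.integral_add i1 i2] at m
    have b1 := h1 ε hε hεw R hR
    have b2 := h2 ε hε hεw R hR
    have m' := mul_le_mul_of_nonneg_left m (by positivity : 0 ≤ R ^ 3)
    have : 2 * (C₁ + C₂) / ε ^ 2 = 2 * (C₁ / ε ^ 2 + C₂ / ε ^ 2) := by ring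
    rw [this]
    linarith
  · intro s hs
    obtain ⟨δ, hδ, hr, hl⟩ := hθ.exists_smooth_sides s
    refine ⟨δ, hδ, fun r hr' hr1 => ?_, fun r hr' hr1 => ?_⟩
    · exact A.norm_weightInt_piece_le hr'.1 hs.1 hr1 (fun x hx => hr x ⟨hx.1, hx.2.trans hr'.2⟩)
        (hθ.right s) (hθ.left r) (hθ.right_deriv s) (hθ.left_deriv r)
    · exact A.norm_weightInt_piece_le hr'.2 hr1 hs.2 (fun x hx => hl x ⟨hr'.1.trans hx.1, hx.2⟩)
        (hθ.right r) (hθ.left s) (hθ.right_deriv r) (hθ.left_deriv s)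

end NormalStrip

/-! ### Lattice sums and Parseval's identity -/

lemma osc_add_two_pi_int (x : ℝ) (m : ℤ) : osc (2 * Real.pi * m + x) = osc x := by
  rw [osc_add]
  have : osc (2 * Real.pi * m) = 1 := by
    unfold osc
    rw [Complex.exp_eq_one_iff]
    exact ⟨-m, by push_cast; ring⟩
  rw [this, one_mul]

/-- The half-open unit cube. -/
def unitCube : Set (Fin 2 → ℝ) := {x | ∀ i, x i ∈ Ioc (0 : ℝ) 1}

lemma measurableSet_unitCube : MeasurableSet unitCube := by
  have : unitCube = Set.pi univ fun _ => Ioc (0 : ℝ) 1 := by ext x; simp [unitCube]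
  rw [this]
  exact MeasurableSet.univ_pi fun _ => measurableSet_Ioc

lemma volume_unitCube : volume unitCube = 1 := by
  have : unitCube = Set.pi univ fun _ => Ioc (0 : ℝ) 1 := by ext x; simp [unitCube]
  rw [this, Real.volume_pi_Ioc]
  simp

/-- The integer vector with real entries. -/
def intVec (w : Fin 2 → ℤ) : Fin 2 → ℝ := fun i => (w i : ℝ)

lemma mFourier_neg_coe (n : Fin 2 → ℤ) (x : Fin 2 → ℝ) :
    UnitAddTorus.mFourier (-n) (fun i => (x i : UnitAddCircle)) =
      osc (2 * Real.pi * (n 0 * x 0 + n 1 * x 1)) := by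
  change ∏ i : Fin 2, fourier ((-n) i) (x i : UnitAddCircle) = _
  rw [Fin.prod_univ_two, fourier_coe_apply, fourier_coe_apply, ← Complex.exp_add]
  unfold osc
  congr 1
  simp only [Pi.neg_apply]
  push_cast
  ring

/-- Unfolding the integral of a periodization. -/
lemma tsum_integral_unitCube (F : (Fin 2 → ℝ) → ℂ) (hF : Integrable F) :
    HasSum (fun w : Fin 2 → ℤ => ∫ x in unitCube, F (intVec w - x)) (∫ y, F y) := by
  set s : (Fin 2 → ℤ) → Set (Fin 2 → ℝ) := fun w => {y | intVec w - y ∈ unitCube} with hs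
  have hsm : ∀ w, MeasurableSet (s w) := fun w =>
    measurableSet_unitCube.preimage (measurable_const.sub measurable_id)
  -- The cube is open on the left and closed on the right, so `0 < w i - y i ≤ 1` has the unique
  -- integer solution `⌊y i⌋ + 1`. Hence the sets `s w` tile the plane.
  have hfl : ∀ w y, y ∈ s w ↔ ∀ i, ⌊y i⌋ + 1 = w i := by
    intro w y
    simp only [hs, unitCube, intVec, mem_ofPred_eq, Pi.sub_apply, mem_Ioc]
    refine forall_congr' fun i => ?_
    rw [eq_comm, ← sub_eq_iff_eq_add, eq_comm, Int.floor_eq_iff]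
    push_cast
    constructor
    · rintro ⟨h1, h2⟩; constructor <;> linarith
    · rintro ⟨h1, h2⟩; constructor <;> linarith
  have hd : Pairwise (Function.onFun Disjoint s) := by
    intro w w' hne
    refine Set.disjoint_left.2 fun y hy hy' => hne ?_
    ext i
    rw [← (hfl w y).1 hy i, (hfl w' y).1 hy' i]
  have hU : ⋃ w, s w = univ := by
    ext y
    simp only [mem_iUnion, mem_univ, iff_true]
    exact ⟨fun i => ⌊y i⌋ + 1, (hfl _ y).2 fun i => rfl⟩
  have := hasSum_integral_iUnion (f := F) (μ := volume) hsm hd (by rw [hU]; exact hF.integrableOn)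
  rw [hU, setIntegral_univ] at this
  refine this.congr_fun fun w => ?_
  rw [← integral_indicator measurableSet_unitCube, ← integral_indicator (hsm w)]
  rw [← integral_sub_left_eq_self (fun y => (s w).indicator F y) volume (intVec w)]
  congr 1
  ext x
  have hx : x ∈ unitCube ↔ intVec w - x ∈ s w := by
    change _ ↔ intVec w - (intVec w - x) ∈ unitCube
    rw [sub_sub_cancel]
  by_cases h : x ∈ unitCube
  · rw [indicator_of_mem h, indicator_of_mem (hx.1 h)]
  · rw [indicator_of_notMem h, indicator_of_notMem (fun h' => h (hx.2 h'))]

attribute [local instance] instMeasureSpaceUnitAddCircle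

local instance isProbabilityMeasure_unitAddCircle :
    IsProbabilityMeasure (volume : Measure UnitAddCircle) :=
  inferInstanceAs (IsProbabilityMeasure AddCircle.haarAddCircle)

/-- The mean square deviation of a periodization from its mean is the sum of the squares of the
nonconstant Fourier coefficients. -/
theorem hasSum_sq_periodization {k : (Fin 2 → ℝ) → ℝ} (hk : Measurable k) {M : ℝ}
    (hM : ∀ y, |k y| ≤ M) (W : Finset (Fin 2 → ℤ))
    (hW : ∀ w ∉ W, ∀ x ∈ unitCube, k (intVec w - x) = 0) (hki : Integrable k) :
    HasSum (fun n : Fin 2 → ℤ => if n = 0 then 0 else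
      ‖∫ y, (k y : ℂ) * osc (-(2 * Real.pi * (n 0 * y 0 + n 1 * y 1)))‖ ^ 2)
      (∫ x in unitCube, ((∫ y, k y) - ∑ w ∈ W, k (intVec w - x)) ^ 2) := by
  set P : (Fin 2 → ℝ) → ℝ := fun x => ∑ w ∈ W, k (intVec w - x) with hP
  have mP : Measurable P := Finset.measurable_sum _ fun w _ =>
    hk.comp (measurable_const.sub measurable_id)
  have bP : ∀ x, |P x| ≤ W.card * M := fun x => by
    refine (Finset.abs_sum_le_sum_abs _ _).trans ?_
    rw [← nsmul_eq_mul]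
    exact Finset.sum_le_card_nsmul _ _ _ fun w _ => hM _
  set e := UnitAddTorus.measurableEquivPiIoc (fun _ : Fin 2 => (0 : ℝ)) with he
  -- `P` is a finite sum and need not be periodic. Only its values on the cube matter, where it
  -- agrees with the full periodization, so it is transported to the torus through representatives
  -- in `(0, 1]²`.
  set f : UnitAddTorus (Fin 2) → ℂ := fun x => (P (e x).1 : ℂ) with hf
  have mf : Measurable f := Complex.measurable_ofReal.comp
    (mP.comp (measurable_subtype_coe.comp e.measurable))
  have fL2 : MemLp f 2 volume := MemLp.of_bound mf.aestronglyMeasurable (W.card * M)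
    (Eventually.of_forall fun x => by rw [hf, Complex.norm_real]; exact bP _)
  have hcube : {x : Fin 2 → ℝ | ∀ i, x i ∈ Ioc ((fun _ : Fin 2 => (0 : ℝ)) i)
      ((fun _ : Fin 2 => (0 : ℝ)) i + 1)} = unitCube := by
    ext x; simp [unitCube]
  have fcoe : ∀ x ∈ unitCube, f (fun i => (x i : UnitAddCircle)) = P x := by
    intro x hx
    have hx' : ∀ i, x i ∈ Ioc ((fun _ : Fin 2 => (0 : ℝ)) i) ((fun _ : Fin 2 => (0 : ℝ)) i + 1) := by
      intro i; simpa using hx i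
    have : e (e.symm ⟨x, hx'⟩) = ⟨x, hx'⟩ := e.apply_symm_apply _
    rw [he, UnitAddTorus.coe_symm_measurableEquivPiIoc_apply] at this
    simp only [hf, he, this]
  -- the Fourier coefficients
  have intk : ∀ n : Fin 2 → ℤ, Integrable
      (fun y => (k y : ℂ) * osc (-(2 * Real.pi * (n 0 * y 0 + n 1 * y 1)))) := fun n => by
    refine hki.ofReal.mul_bdd (c := 1) ?_ (Eventually.of_forall fun y => (norm_osc _).le)
    exact (continuous_osc.comp (by fun_prop)).aestronglyMeasurable
  -- Characters are invariant under integer translations, so the substitution `y = w - x` unfolds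
  -- the integral over the cube to the plane. The reflection in this substitution flips the sign of
  -- the frequency.
  have coeff : ∀ n, UnitAddTorus.mFourierCoeff f n =
      ∫ y, (k y : ℂ) * osc (-(2 * Real.pi * (n 0 * y 0 + n 1 * y 1))) := by
    intro n
    rw [UnitAddTorus.mFourierCoeff_eq_integral f n (fun _ => 0), hcube]
    have h1 : ∫ x in unitCube, UnitAddTorus.mFourier (-n) (fun i => (x i : UnitAddCircle)) •
        f (fun i => (x i : UnitAddCircle)) = ∫ x in unitCube, ∑ w ∈ W,
          (k (intVec w - x) : ℂ) *
            osc (-(2 * Real.pi * (n 0 * (intVec w - x) 0 + n 1 * (intVec w - x) 1))) := by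
      refine setIntegral_congr_fun measurableSet_unitCube fun x hx => ?_
      rw [fcoe x hx, mFourier_neg_coe, smul_eq_mul, hP]
      push_cast
      rw [Finset.mul_sum]
      refine Finset.sum_congr rfl fun w _ => ?_
      rw [mul_comm]
      congr 1
      rw [← osc_add_two_pi_int _ (-(n 0 * w 0 + n 1 * w 1))]
      congr 1
      simp only [intVec, Pi.sub_apply]
      push_cast
      ring
    rw [h1, integral_finsetSum]
    · refine HasSum.unique ?_ (tsum_integral_unitCube _ (intk n))
      apply hasSum_sum_of_ne_finset_zero
      intro w hw
      refine setIntegral_eq_zero_of_forall_eq_zero fun x hx => ?_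
      rw [hW w hw x hx]; simp
    · intro w _
      exact ((intk n).comp_sub_left (intVec w)).integrableOn
  have parseval := UnitAddTorus.hasSum_sq_mFourierCoeff (fL2.toLp f)
  have c2 : ∀ n, UnitAddTorus.mFourierCoeff (fL2.toLp f) n = UnitAddTorus.mFourierCoeff f n := fun n =>
    integral_congr_ae (fL2.coeFn_toLp.mono fun x hx => by simp only [hx])
  have n2 : ∫ t, ‖(fL2.toLp f) t‖ ^ 2 = ∫ x in unitCube, P x ^ 2 := by
    have h1 : ∫ t, ‖(fL2.toLp f) t‖ ^ 2 = ∫ t, ‖f t‖ ^ 2 :=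
      integral_congr_ae (fL2.coeFn_toLp.mono fun x hx => by simp only [hx])
    rw [h1, UnitAddTorus.integral_preimage _ (fun _ => 0), hcube]
    refine setIntegral_congr_fun measurableSet_unitCube fun x hx => ?_
    rw [fcoe x hx, Complex.norm_real, Real.norm_eq_abs, sq_abs]
  simp only [c2, coeff] at parseval
  rw [n2] at parseval
  -- the zeroth coefficient
  have z0 : ∫ y, (k y : ℂ) * osc (-(2 * Real.pi *
      (((0 : Fin 2 → ℤ) 0 : ℤ) * y 0 + ((0 : Fin 2 → ℤ) 1 : ℤ) * y 1))) = ((∫ y, k y : ℝ) : ℂ) := by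
    rw [← integral_complex_ofReal]
    congr 1; ext y
    simp [osc]
  have mean : ∫ x in unitCube, P x = ∫ y, k y := by
    have h1 := coeff 0
    rw [z0, UnitAddTorus.mFourierCoeff_eq_integral f 0 (fun _ => 0), hcube] at h1
    have h2 : ∫ x in unitCube, UnitAddTorus.mFourier (-0) (fun i => (x i : UnitAddCircle)) •
        f (fun i => (x i : UnitAddCircle)) = ((∫ x in unitCube, P x : ℝ) : ℂ) := by
      rw [← integral_complex_ofReal]
      refine setIntegral_congr_fun measurableSet_unitCube fun x hx => ?_
      rw [fcoe x hx, neg_zero, UnitAddTorus.mFourier_zero]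
      simp
    rw [h2] at h1
    exact_mod_cast h1
  have : IsFiniteMeasure (volume.restrict unitCube) :=
    ⟨by rw [Measure.restrict_apply_univ, volume_unitCube]; exact ENNReal.one_lt_top⟩
  have iP : IntegrableOn P unitCube := Measure.integrableOn_of_bounded (M := W.card * M)
    (by rw [volume_unitCube]; exact ENNReal.one_ne_top) mP.aestronglyMeasurable
    (Eventually.of_forall fun x => bP x)
  have iP2 : IntegrableOn (fun x => P x ^ 2) unitCube :=
    Measure.integrableOn_of_bounded (M := (W.card * M) ^ 2)
    (by rw [volume_unitCube]; exact ENNReal.one_ne_top) (mP.pow_const 2).aestronglyMeasurable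
    (Eventually.of_forall fun x => by
      rw [norm_pow]; exact pow_le_pow_left₀ (norm_nonneg _) (bP x) 2)
  -- The cube has volume one and `P` has mean `∫ k`, so this is the usual variance identity; the
  -- subtracted square is the term `n = 0` in Parseval's identity.
  have total : ∫ x in unitCube, ((∫ y, k y) - P x) ^ 2 = (∫ x in unitCube, P x ^ 2) - (∫ y, k y) ^ 2 := by
    have : ∀ x, ((∫ y, k y) - P x) ^ 2 = (∫ y, k y) ^ 2 - 2 * (∫ y, k y) * P x + P x ^ 2 :=
      fun x => by ring
    simp only [this]
    rw [integral_add (f := fun x => (∫ y, k y) ^ 2 - 2 * (∫ y, k y) * P x)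
        ((integrable_const _).sub (iP.const_mul _)) iP2,
      integral_sub (integrable_const _) (iP.const_mul _), integral_const_mul, mean,
      integral_const, Measure.real, Measure.restrict_apply_univ, volume_unitCube]
    simp
    ring
  rw [total]
  have hz := hasSum_ite_eq (0 : Fin 2 → ℤ) ((∫ y, k y) ^ 2)
  refine (parseval.sub hz).congr_fun fun n => ?_
  by_cases hn : n = 0
  · subst hn
    simp only [if_true]
    rw [z0, Complex.norm_real, Real.norm_eq_abs, sq_abs, sub_self]
  · simp [hn]

/-! ### Averages of lattice sums over rigid motions -/

/-- The rotation of the plane as a linear isometry. -/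
def rotationIsometry (φ : ℝ) : Plane ≃ₗᵢ[ℝ] Plane where
  toFun := planeRotation φ
  invFun := planeRotation (-φ)
  map_add' x y := by ext i; fin_cases i <;> simp [planeRotation] <;> ring
  map_smul' a x := by ext i; fin_cases i <;> simp [planeRotation] <;> ring
  left_inv x := by
    ext i
    fin_cases i <;> simp [planeRotation]
    · linear_combination x 0 * Real.cos_sq_add_sin_sq φ
    · linear_combination x 1 * Real.cos_sq_add_sin_sq φ
  right_inv x := by
    ext i
    fin_cases i <;> simp [planeRotation]
    · linear_combination x 0 * Real.cos_sq_add_sin_sq φ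
    · linear_combination x 1 * Real.cos_sq_add_sin_sq φ
  norm_map' x := by
    change ‖planeRotation φ x‖ = ‖x‖
    rw [← sq_eq_sq₀ (norm_nonneg _) (norm_nonneg _), EuclideanSpace.norm_sq_eq,
      EuclideanSpace.norm_sq_eq]
    simp only [Fin.sum_univ_two, Real.norm_eq_abs, sq_abs, planeRotation]
    simp
    linear_combination (x 0 ^ 2 + x 1 ^ 2) * Real.cos_sq_add_sin_sq φ

lemma coe_rotationIsometry (φ : ℝ) : ⇑(rotationIsometry φ) = planeRotation φ := rfl

lemma norm_planeRotation (φ : ℝ) (x : Plane) : ‖planeRotation φ x‖ = ‖x‖ :=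
  (rotationIsometry φ).norm_map x

lemma planeRotation_neg_apply (φ : ℝ) (x : Plane) : planeRotation (-φ) (planeRotation φ x) = x :=
  (rotationIsometry φ).symm_apply_apply x

lemma planeRotation_apply_neg (φ : ℝ) (x : Plane) : planeRotation φ (planeRotation (-φ) x) = x :=
  (rotationIsometry φ).apply_symm_apply x

/-- The integral of a function in scaled and rotated coordinates. -/
lemma integral_planeRotation_smul {E : Type*} [NormedAddCommGroup E] [NormedSpace ℝ E]
    (G : Plane → E) {h : ℝ} (hh : 0 < h) (φ : ℝ) :
    ∫ y : Fin 2 → ℝ, h ^ 2 • G (planeRotation (-φ) (h • WithLp.toLp 2 y)) = ∫ x, G x := by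
  rw [(PiLp.volume_preserving_toLp (Fin 2)).integral_comp
    (MeasurableEquiv.toLp 2 (Fin 2 → ℝ)).measurableEmbedding
    (fun x : Plane => h ^ 2 • G (planeRotation (-φ) (h • x))), integral_smul,
    Measure.integral_comp_smul volume (fun x : Plane => G (planeRotation (-φ) x)) h]
  have : ∫ x : Plane, G (planeRotation (-φ) x) = ∫ x, G x :=
    (rotationIsometry (-φ)).measurePreserving.integral_comp
      (rotationIsometry (-φ)).toHomeomorph.measurableEmbedding G
  rw [this, smul_smul, finrank_euclideanSpace_fin, abs_of_pos (by positivity),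
    mul_inv_cancel₀ (by positivity), one_smul]

/-- The Fourier transform of a function on the plane in polar coordinates. -/
def polarFourier (g : Plane → ℝ) (R φ : ℝ) : ℂ :=
  ∫ x : Plane, (g x : ℂ) * osc (R * (Real.cos φ * x 0 + Real.sin φ * x 1))

/-- The lattice sum of a function in rotated and translated coordinates. -/
def latticeSum (g : Plane → ℝ) (h φ : ℝ) (ξ : Plane) : ℝ :=
  h ^ 2 * ∑' w : Fin 2 → ℤ, g (planeRotation (-φ) (latticePoint h w - h • ξ))

/-- A box of lattice indices. -/
def latticeBox (N : ℕ) : Finset (Fin 2 → ℤ) := Fintype.piFinset fun _ => Finset.Icc (-N : ℤ) N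

lemma lt_norm_of_notMem_latticeBox {h ρ : ℝ} (hh : 0 < h) {ξ : Plane} {N : ℕ}
    (hN : ρ / h + ‖ξ‖ ≤ N) {w : Fin 2 → ℤ} (hw : w ∉ latticeBox N) (φ : ℝ) :
    ρ < ‖planeRotation (-φ) (latticePoint h w - h • ξ)‖ := by
  rw [norm_planeRotation]
  simp only [latticeBox, Fintype.mem_piFinset, Finset.mem_Icc, not_forall] at hw
  obtain ⟨i, hi⟩ := hw
  have h1 : (N : ℤ) < |w i| := by
    by_contra hc
    exact hi (abs_le.1 (not_lt.1 hc))
  have h2 : (N : ℝ) < |(w i : ℝ)| := by exact_mod_cast h1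
  have h3 : (latticePoint h w - h • ξ) i = h * (w i - ξ i) := by
    fin_cases i <;> simp [latticePoint] <;> ring
  have h4 := PiLp.norm_apply_le (latticePoint h w - h • ξ) i
  have h5 := PiLp.norm_apply_le ξ i
  rw [h3, norm_mul, Real.norm_eq_abs, abs_of_pos hh] at h4
  rw [Real.norm_eq_abs] at h4 h5
  have h6 := abs_sub_abs_le_abs_sub (w i : ℝ) (ξ i)
  have h7 : ρ / h < |(w i : ℝ) - ξ i| := by linarith
  rw [div_lt_iff₀ hh] at h7
  linarith

lemma latticeSum_eq_sum {g : Plane → ℝ} {h ρ : ℝ} (hg : ∀ x, ρ < ‖x‖ → g x = 0) (hh : 0 < h)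
    {ξ : Plane} {N : ℕ} (hN : ρ / h + ‖ξ‖ ≤ N) (φ : ℝ) :
    latticeSum g h φ ξ =
      h ^ 2 * ∑ w ∈ latticeBox N, g (planeRotation (-φ) (latticePoint h w - h • ξ)) := by
  unfold latticeSum
  rw [tsum_eq_sum fun w hw => hg _ (lt_norm_of_notMem_latticeBox hh hN hw φ)]

lemma summable_lattice {g : Plane → ℝ} {h ρ : ℝ} (hg : ∀ x, ρ < ‖x‖ → g x = 0) (hh : 0 < h)
    (ξ : Plane) (φ : ℝ) :
    Summable fun w : Fin 2 → ℤ => g (planeRotation (-φ) (latticePoint h w - h • ξ)) := by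
  obtain ⟨N, hN⟩ := exists_nat_ge (ρ / h + ‖ξ‖)
  exact summable_of_ne_finset_zero fun w hw => hg _ (lt_norm_of_notMem_latticeBox hh hN hw φ)

lemma norm_le_two_of_mem_unitSquare {ξ : Plane} (hξ : ξ ∈ unitSquare) : ‖ξ‖ ≤ 2 := by
  refine le_of_sq_le_sq ?_ (by norm_num)
  rw [EuclideanSpace.norm_sq_eq, Fin.sum_univ_two, Real.norm_eq_abs, Real.norm_eq_abs, sq_abs,
    sq_abs]
  have h0 := hξ 0
  have h1 := hξ 1
  nlinarith [h0.1, h0.2, h1.1, h1.2]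

lemma measurableSet_unitSquare : MeasurableSet unitSquare := by
  have : unitSquare = ⋂ i, (fun ξ : Plane => ξ i) ⁻¹' Icc (0 : ℝ) 1 := by
    ext ξ; simp [unitSquare]
  rw [this]
  refine MeasurableSet.iInter fun i => measurableSet_Icc.preimage ?_
  exact (by fun_prop : Continuous fun ξ : Plane => ξ i).measurable

/-- The closed square differs by a null set from the half-open cube that represents the torus. -/
lemma integral_unitSquare (Φ : Plane → ℝ) :
    ∫ ξ in unitSquare, Φ ξ = ∫ x in unitCube, Φ (WithLp.toLp 2 x) := by
  rw [← (PiLp.volume_preserving_toLp (Fin 2)).setIntegral_preimage_emb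
    (MeasurableEquiv.toLp 2 (Fin 2 → ℝ)).measurableEmbedding]
  refine setIntegral_congr_set ?_
  have h1 : (WithLp.toLp 2 ⁻¹' unitSquare : Set (Fin 2 → ℝ)) = Icc (fun _ => 0) (fun _ => 1) := by
    ext x
    simp [unitSquare, Pi.le_def, forall_and]
  have h2 : unitCube = Set.pi univ fun _ => Ioc (0 : ℝ) 1 := by ext x; simp [unitCube]
  rw [h1, h2]
  exact (Measure.univ_pi_Ioc_ae_eq_Icc (μ := fun _ : Fin 2 => (volume : Measure ℝ))).symm

lemma volume_unitSquare_lt_top : volume unitSquare < ⊤ := by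
  refine (measure_mono fun ξ hξ => ?_).trans_lt (measure_closedBall_lt_top (x := (0 : Plane)) (r := 2))
  rw [mem_closedBall_zero_iff]
  exact norm_le_two_of_mem_unitSquare hξ

section
variable {g : Plane → ℝ} {M ρ : ℝ}

lemma integrable_of_bounded_of_support (hg : Measurable g) (hM : ∀ x, |g x| ≤ M)
    (hρ : ∀ x, ρ < ‖x‖ → g x = 0) : Integrable g := by
  have : IntegrableOn g (Metric.closedBall 0 ρ) :=
    Measure.integrableOn_of_bounded measure_closedBall_lt_top.ne hg.aestronglyMeasurable
      (Eventually.of_forall fun x => hM x)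
  refine (integrableOn_iff_integrable_of_support_subset fun x hx => ?_).1 this
  rw [mem_closedBall_zero_iff]
  exact not_lt.1 fun hc => hx (hρ x hc)

lemma continuous_polarFourier (hg : Integrable g) (R : ℝ) : Continuous (polarFourier g R) := by
  refine continuous_of_dominated (bound := fun x => ‖g x‖) (fun φ => ?_) (fun φ => ?_) hg.norm ?_
  · exact (Complex.continuous_ofReal.comp_aestronglyMeasurable hg.1).mul (continuous_osc.comp (by fun_prop)).aestronglyMeasurable
  · refine Eventually.of_forall fun x => ?_
    rw [norm_mul, norm_osc, mul_one, Complex.norm_real]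
  · exact Eventually.of_forall fun x => continuous_const.mul (continuous_osc.comp (by fun_prop))

lemma polarFourier_periodic (R : ℝ) : Function.Periodic (polarFourier g R) (2 * Real.pi) := by
  intro φ
  simp [polarFourier]

/-- The squared error of the lattice sums, averaged over translations, in terms of the Fourier
transform. -/
theorem hasSum_sq_latticeSum (hg : Measurable g) (hM : ∀ x, |g x| ≤ M)
    (hρ : ∀ x, ρ < ‖x‖ → g x = 0) {h : ℝ} (hh : 0 < h) (φ : ℝ) :
    HasSum (fun n : Fin 2 → ℤ => if n = 0 then 0 else
      ‖polarFourier g (2 * Real.pi * ‖(⟨-n 0, -n 1⟩ : ℂ)‖ / h)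
        ((⟨-n 0, -n 1⟩ : ℂ).arg - φ)‖ ^ 2)
      (∫ ξ in unitSquare, ((∫ x, g x) - latticeSum g h φ ξ) ^ 2) := by
  obtain ⟨N, hN⟩ := exists_nat_ge (ρ / h + 2)
  -- At `y = w - x` this is the summand with index `w` of the lattice sum translated by `x`. The
  -- factor `h ^ 2` makes `∫ k = ∫ g`.
  set k : (Fin 2 → ℝ) → ℝ := fun y => h ^ 2 * g (planeRotation (-φ) (h • WithLp.toLp 2 y)) with hk
  have mt : Measurable fun y : Fin 2 → ℝ => planeRotation (-φ) (h • WithLp.toLp 2 y) :=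
    ((rotationIsometry (-φ)).continuous.comp
      ((PiLp.continuous_toLp 2 _).const_smul h)).measurable
  have mk : Measurable k := (hg.comp mt).const_mul _
  have bk : ∀ y, |k y| ≤ h ^ 2 * M := fun y => by
    rw [hk, abs_mul, abs_of_pos (by positivity : 0 < h ^ 2)]
    exact mul_le_mul_of_nonneg_left (hM _) (by positivity)
  have hpt : ∀ (w : Fin 2 → ℤ) (x : Fin 2 → ℝ),
      h • WithLp.toLp 2 (intVec w - x) = latticePoint h w - h • WithLp.toLp 2 x := by
    intro w x
    ext i
    fin_cases i <;> simp [latticePoint, intVec] <;> ring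
  have hsq : ∀ x ∈ unitCube, (WithLp.toLp 2 x : Plane) ∈ unitSquare := fun x hx i =>
    Ioc_subset_Icc_self (hx i)
  have hW : ∀ w ∉ latticeBox N, ∀ x ∈ unitCube, k (intVec w - x) = 0 := by
    intro w hw x hx
    rw [hk]
    beta_reduce
    rw [hpt, hρ, mul_zero]
    refine lt_norm_of_notMem_latticeBox hh (N := N) ?_ hw φ
    linarith [norm_le_two_of_mem_unitSquare (hsq x hx)]
  have ki : Integrable k := by
    refine Integrable.const_mul ?_ _
    have hi := integrable_of_bounded_of_support hg hM hρ
    have h1 : Integrable fun x => g (planeRotation (-φ) x) :=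
      ((rotationIsometry (-φ)).measurePreserving.integrable_comp_emb
        (rotationIsometry (-φ)).toHomeomorph.measurableEmbedding).2 hi
    have h2 : Integrable fun x : Plane => g (planeRotation (-φ) (h • x)) :=
      (integrable_comp_smul_iff volume (fun x => g (planeRotation (-φ) x)) hh.ne').2 h1
    exact ((PiLp.volume_preserving_toLp (Fin 2)).integrable_comp_emb
      (MeasurableEquiv.toLp 2 (Fin 2 → ℝ)).measurableEmbedding).2 h2
  have Ik : ∫ y, k y = ∫ x, g x := by
    rw [← integral_planeRotation_smul g hh φ]
    rfl
  have main := hasSum_sq_periodization mk bk (latticeBox N) hW ki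
  rw [Ik] at main
  have e1 : ∫ ξ in unitSquare, ((∫ x, g x) - latticeSum g h φ ξ) ^ 2 =
      ∫ x in unitCube, ((∫ x, g x) - ∑ w ∈ latticeBox N, k (intVec w - x)) ^ 2 := by
    rw [integral_unitSquare]
    refine setIntegral_congr_fun measurableSet_unitCube fun x hx => ?_
    beta_reduce
    rw [latticeSum_eq_sum hρ hh (N := N), Finset.mul_sum]
    · simp only [hk, hpt]
    · linarith [norm_le_two_of_mem_unitSquare (hsq x hx)]
  rw [e1]
  refine main.congr_fun fun n => ?_
  by_cases hn : n = 0
  · simp [hn]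
  rw [if_neg hn, if_neg hn]
  congr 2
  unfold polarFourier
  rw [← integral_planeRotation_smul _ hh φ]
  congr 1
  ext y
  rw [hk]
  simp only [Complex.real_smul]
  push_cast
  rw [← mul_assoc ((h : ℂ) ^ 2)]
  congr 2
  -- The frequency `-n` in polar form. In the rotated and scaled variable its modulus becomes `2π
  -- |n| / h` and its argument decreases by `φ`.
  set z : ℂ := ⟨-n 0, -n 1⟩ with hz
  have hc : ‖z‖ * Real.cos z.arg = -n 0 := by rw [Complex.norm_mul_cos_arg]
  have hs : ‖z‖ * Real.sin z.arg = -n 1 := by rw [Complex.norm_mul_sin_arg]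
  have h0 : (planeRotation (-φ) (h • WithLp.toLp 2 y)) 0 =
      h * (Real.cos φ * y 0 + Real.sin φ * y 1) := by simp [planeRotation]; ring
  have h1 : (planeRotation (-φ) (h • WithLp.toLp 2 y)) 1 =
      h * (-Real.sin φ * y 0 + Real.cos φ * y 1) := by simp [planeRotation]; ring
  rw [h0, h1, Real.cos_sub, Real.sin_sub]
  field_simp
  linear_combination y 0 * hc + y 1 * hs +
    (y 0 * (‖z‖ * Real.cos z.arg) + y 1 * (‖z‖ * Real.sin z.arg)) * Real.cos_sq_add_sin_sq φ

/-- The lattice error is square integrable over the rigid motions. -/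
lemma integrableOn_sq_latticeSum (hg : Measurable g) (hM : ∀ x, |g x| ≤ M)
    (hρ : ∀ x, ρ < ‖x‖ → g x = 0) {h : ℝ} (hh : 0 < h) (I : ℝ) :
    IntegrableOn (fun p : ℝ × Plane => (I - latticeSum g h p.1 p.2) ^ 2)
      (Icc 0 (2 * Real.pi) ×ˢ unitSquare) := by
  obtain ⟨N, hN⟩ := exists_nat_ge (ρ / h + 2)
  set G : ℝ × Plane → ℝ := fun p => h ^ 2 * ∑ w ∈ latticeBox N,
    g (planeRotation (-p.1) (latticePoint h w - h • p.2)) with hG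
  have mG : Measurable G := by
    refine Measurable.const_mul (Finset.measurable_sum _ fun w _ => hg.comp ?_) _
    refine Continuous.measurable ?_
    unfold planeRotation
    fun_prop
  have bG : ∀ p, |G p| ≤ h ^ 2 * ((latticeBox N).card * M) := fun p => by
    rw [hG, abs_mul, abs_of_pos (by positivity : 0 < h ^ 2)]
    refine mul_le_mul_of_nonneg_left ?_ (by positivity)
    refine (Finset.abs_sum_le_sum_abs _ _).trans ?_
    rw [← nsmul_eq_mul]
    exact Finset.sum_le_card_nsmul _ _ _ fun w _ => hM _
  have hfin : volume (Icc 0 (2 * Real.pi) ×ˢ unitSquare) ≠ ⊤ := by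
    rw [Measure.volume_eq_prod, Measure.prod_prod]
    exact ENNReal.mul_ne_top measure_Icc_lt_top.ne volume_unitSquare_lt_top.ne
  have : IntegrableOn (fun p => (I - G p) ^ 2) (Icc 0 (2 * Real.pi) ×ˢ unitSquare) :=
    Measure.integrableOn_of_bounded (M := (|I| + h ^ 2 * ((latticeBox N).card * M)) ^ 2) hfin
      ((mG.const_sub I).pow_const 2).aestronglyMeasurable
      (Eventually.of_forall fun p => by
        rw [norm_pow]
        refine pow_le_pow_left₀ (norm_nonneg _) ((norm_sub_le _ _).trans ?_) 2
        exact add_le_add le_rfl (bG p))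
  refine this.congr_fun (fun p hp => ?_) (measurableSet_Icc.prod measurableSet_unitSquare)
  beta_reduce
  rw [latticeSum_eq_sum hρ hh (N := N)]
  linarith [norm_le_two_of_mem_unitSquare hp.2]

lemma norm_le_norm_complex (n : Fin 2 → ℤ) : ‖n‖ ≤ ‖(⟨-n 0, -n 1⟩ : ℂ)‖ := by
  refine (pi_norm_le_iff_of_nonneg (norm_nonneg _)).2 fun i => ?_
  fin_cases i
  · have := Complex.abs_re_le_norm (⟨-n 0, -n 1⟩ : ℂ)
    simpa [Int.norm_eq_abs] using this
  · have := Complex.abs_im_le_norm (⟨-n 0, -n 1⟩ : ℂ)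
    simpa [Int.norm_eq_abs] using this

/-- Decay of the Fourier transform in the mean over all directions bounds the mean squared error
of lattice sums. -/
theorem integral_sq_latticeSum_le : ∃ C : ℝ, 0 ≤ C ∧ ∀ {g : Plane → ℝ} {M ρ A : ℝ},
    Measurable g → (∀ x, |g x| ≤ M) → (∀ x, ρ < ‖x‖ → g x = 0) →
    (∀ R, 0 < R → R ^ 3 * ∫ φ in (0 : ℝ)..(2 * Real.pi), ‖polarFourier g R φ‖ ^ 2 ≤ A) →
    ∀ {h : ℝ}, 0 < h →
    ∫ φ in (0 : ℝ)..(2 * Real.pi), ∫ ξ in unitSquare, ((∫ x, g x) - latticeSum g h φ ξ) ^ 2 ≤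
      C * A * h ^ 3 := by
  -- The decay exponent 3 exceeds the dimension 2 of the lattice.
  have hsum : Summable fun n : Fin 2 → ℤ => ‖n‖ ^ (-3 : ℝ) :=
    EisensteinSeries.summable_one_div_norm_rpow (by norm_num)
  refine ⟨∑' n : Fin 2 → ℤ, ‖n‖ ^ (-3 : ℝ), tsum_nonneg fun n => by positivity, ?_⟩
  intro g M ρ A hg hM hρ hA h hh
  have hi := integrable_of_bounded_of_support hg hM hρ
  have hA0 : 0 ≤ A := by
    refine le_trans ?_ (hA 1 one_pos)
    rw [one_pow, one_mul]
    exact intervalIntegral.integral_nonneg (by positivity) fun φ _ => by positivity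
  set a : (Fin 2 → ℤ) → ℝ → ℝ := fun n φ => if n = 0 then 0 else
      ‖polarFourier g (2 * Real.pi * ‖(⟨-n 0, -n 1⟩ : ℂ)‖ / h)
        ((⟨-n 0, -n 1⟩ : ℂ).arg - φ)‖ ^ 2 with ha
  have a0 : ∀ n φ, 0 ≤ a n φ := fun n φ => by
    rw [ha]; beta_reduce; split_ifs <;> positivity
  have ac : ∀ n, Continuous (a n) := fun n => by
    by_cases hn : n = 0
    · simp only [ha, hn, if_true]; exact continuous_const
    · simp only [ha, hn, if_false]
      exact ((continuous_polarFourier hi _).comp (continuous_const.sub continuous_id)).norm.pow 2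
  have ab : ∀ n, ∫ φ in (0 : ℝ)..(2 * Real.pi), a n φ ≤ A * h ^ 3 * ‖n‖ ^ (-3 : ℝ) := by
    intro n
    by_cases hn : n = 0
    · simp only [ha, hn, if_true, intervalIntegral.integral_zero]; positivity
    simp only [ha, hn, if_false]
    set z : ℂ := ⟨-n 0, -n 1⟩ with hz
    have n0 : 0 < ‖n‖ := norm_pos_iff.2 hn
    have nz : ‖n‖ ≤ ‖z‖ := norm_le_norm_complex n
    set R := 2 * Real.pi * ‖z‖ / h with hR
    have hRn : ‖n‖ / h ≤ R := by
      rw [hR]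
      gcongr
      nlinarith [Real.pi_gt_three, norm_nonneg z]
    have R0 : 0 < R := lt_of_lt_of_le (by positivity) hRn
    -- Reflection and shift of the angle: by periodicity every frequency sees the same integral over
    -- the full circle.
    rw [intervalIntegral.integral_comp_sub_left (fun φ => ‖polarFourier g R φ‖ ^ 2) z.arg]
    have per : Function.Periodic (fun φ => ‖polarFourier g R φ‖ ^ 2) (2 * Real.pi) := fun φ => by
      beta_reduce; rw [polarFourier_periodic R φ]
    have e := per.intervalIntegral_add_eq (z.arg - 2 * Real.pi) 0
    rw [sub_add_cancel, zero_add] at e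
    rw [sub_zero, e]
    have h1 := hA R R0
    set J := ∫ φ in (0 : ℝ)..(2 * Real.pi), ‖polarFourier g R φ‖ ^ 2
    have hJ : J ≤ A / R ^ 3 := by rw [le_div_iff₀ (by positivity)]; linarith
    refine hJ.trans ?_
    rw [Real.rpow_neg n0.le, show (3 : ℝ) = ((3 : ℕ) : ℝ) by norm_num, Real.rpow_natCast]
    calc A / R ^ 3 ≤ A / (‖n‖ / h) ^ 3 := by gcongr
      _ = A * h ^ 3 * (‖n‖ ^ 3)⁻¹ := by field_simp
  set E : ℝ → ℝ := fun φ => ∫ ξ in unitSquare, ((∫ x, g x) - latticeSum g h φ ξ) ^ 2 with hE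
  have hs : ∀ φ, HasSum (fun n => a n φ) (E φ) := fun φ => hasSum_sq_latticeSum hg hM hρ hh φ
  have E0 : ∀ φ, 0 ≤ E φ := fun φ => integral_nonneg fun ξ => sq_nonneg _
  rw [intervalIntegral.integral_of_le (by positivity)]
  -- In terms of lower Lebesgue integrals the sum over frequencies and the integral over rotations
  -- may be interchanged without knowing beforehand that `E` is integrable.
  refine (Real.le_norm_self _).trans ((norm_integral_le_lintegral_norm _).trans ?_)
  refine ENNReal.toReal_le_of_le_ofReal (mul_nonneg (mul_nonneg
    (tsum_nonneg fun n => by positivity) hA0) (by positivity)) ?_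
  calc ∫⁻ φ in Ioc 0 (2 * Real.pi), ENNReal.ofReal ‖E φ‖
      = ∫⁻ φ in Ioc 0 (2 * Real.pi), ∑' n, ENNReal.ofReal (a n φ) := by
        congr 1; ext φ
        rw [Real.norm_of_nonneg (E0 φ), ← (hs φ).tsum_eq,
          ENNReal.ofReal_tsum_of_nonneg (fun n => a0 n φ) (hs φ).summable]
    _ = ∑' n, ∫⁻ φ in Ioc 0 (2 * Real.pi), ENNReal.ofReal (a n φ) :=
        lintegral_tsum fun n => (ac n).measurable.ennreal_ofReal.aemeasurable
    _ ≤ ∑' n : Fin 2 → ℤ, ENNReal.ofReal (A * h ^ 3 * ‖n‖ ^ (-3 : ℝ)) := by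
        refine ENNReal.tsum_le_tsum fun n => ?_
        rw [← ofReal_integral_eq_lintegral_ofReal
          (((ac n).integrableOn_Icc).mono_set Ioc_subset_Icc_self)
          (Eventually.of_forall fun φ => a0 n φ), ← intervalIntegral.integral_of_le (by positivity)]
        exact ENNReal.ofReal_le_ofReal (ab n)
    _ = ENNReal.ofReal ((∑' n : Fin 2 → ℤ, ‖n‖ ^ (-3 : ℝ)) * A * h ^ 3) := by
        rw [← ENNReal.ofReal_tsum_of_nonneg (fun n => by positivity) (hsum.mul_left _),
          tsum_mul_left]
        congr 1; ring

end

/-! ### Plane curves and their tubes -/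

lemma inner_plane (x y : Plane) : inner ℝ x y = x 0 * y 0 + x 1 * y 1 := by
  rw [PiLp.inner_apply, Fin.sum_univ_two]
  simp [mul_comm]

lemma norm_sq_plane (x : Plane) : ‖x‖ ^ 2 = x 0 ^ 2 + x 1 ^ 2 := by
  rw [EuclideanSpace.norm_sq_eq, Fin.sum_univ_two]
  simp

lemma hasDerivAt_coord {f : ℝ → Plane} {f' : Plane} {t : ℝ} (h : HasDerivAt f f' t) (i : Fin 2) :
    HasDerivAt (fun s => f s i) (f' i) t :=
  (EuclideanSpace.proj (𝕜 := ℝ) i).hasFDerivAt.comp_hasDerivAt t h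

/-- A function with nonnegative second derivative is nonnegative near a zero that is critical. -/
lemma nonneg_of_second_deriv_nonneg {f f' f'' : ℝ → ℝ} {s δ : ℝ}
    (h1 : ∀ x, HasDerivAt f (f' x) x) (h2 : ∀ x, HasDerivAt f' (f'' x) x)
    (h0 : f s = 0) (h0' : f' s = 0) (h : ∀ x, |x - s| < δ → 0 ≤ f'' x) {x : ℝ}
    (hx : |x - s| < δ) : 0 ≤ f x := by
  have key : ∀ {a b : ℝ} (g g' : ℝ → ℝ), (∀ x, HasDerivAt g (g' x) x) → a < b →
      ∃ c ∈ Ioo a b, g b - g a = g' c * (b - a) := by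
    intro a b g g' hg hab
    obtain ⟨c, hc, e⟩ := exists_hasDerivAt_eq_slope g g' hab
      (fun x _ => (hg x).continuousAt.continuousWithinAt) fun x _ => hg x
    exact ⟨c, hc, by rw [e, div_mul_cancel₀ _ (sub_pos.2 hab).ne']⟩
  rcases lt_trichotomy x s with hxs | rfl | hxs
  · obtain ⟨c, hc, e⟩ := key f f' h1 hxs
    obtain ⟨d, hd, e'⟩ := key f' f'' h2 hc.2
    have hd0 : 0 ≤ f'' d := h d (by
      rw [abs_lt] at hx ⊢; constructor <;> linarith [hx.1, hd.1, hd.2, hc.1])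
    have h3 : f' c ≤ 0 := by nlinarith [mul_nonneg hd0 (sub_nonneg.2 hc.2.le)]
    nlinarith [mul_nonneg (neg_nonneg.2 h3) (sub_nonneg.2 hxs.le)]
  · exact h0.ge
  · obtain ⟨c, hc, e⟩ := key f f' h1 hxs
    obtain ⟨d, hd, e'⟩ := key f' f'' h2 hc.1
    have hd0 : 0 ≤ f'' d := h d (by
      rw [abs_lt] at hx ⊢; constructor <;> linarith [hx.1, hd.1, hd.2, hc.2])
    have h3 : 0 ≤ f' c := by nlinarith [mul_nonneg hd0 (sub_nonneg.2 hc.1.le)]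
    nlinarith [mul_nonneg h3 (sub_nonneg.2 hxs.le)]

namespace PlaneCurve

lemma normal_zero (Γ : PlaneCurve) (t : ℝ) : Γ.normal t 0 = deriv Γ.param t 1 := rfl

lemma normal_one (Γ : PlaneCurve) (t : ℝ) : Γ.normal t 1 = -deriv Γ.param t 0 := rfl

namespace IsAdmissible

variable {Γ : PlaneCurve} {κ : ℝ}

lemma Icc_subset_domain (Γ : PlaneCurve) : Icc 0 Γ.len ⊆ Γ.domain := fun _ ht => Or.inr ht


lemma differentiable (hΓ : Γ.IsAdmissible κ) : Differentiable ℝ Γ.param := hΓ.contDiff_two.differentiable (by norm_num)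

lemma contDiff_deriv (hΓ : Γ.IsAdmissible κ) : ContDiff ℝ 1 (deriv Γ.param) :=
  ((contDiff_succ_iff_deriv (n := 1)).1 (by simpa [one_add_one_eq_two] using hΓ.contDiff_two)).2.2

lemma hasDerivAt_param (hΓ : Γ.IsAdmissible κ) (t : ℝ) : HasDerivAt Γ.param (deriv Γ.param t) t :=
  (hΓ.differentiable t).hasDerivAt

lemma hasDerivAt_deriv (hΓ : Γ.IsAdmissible κ) (t : ℝ) : HasDerivAt (deriv Γ.param) (deriv (deriv Γ.param) t) t :=
  ((hΓ.contDiff_deriv.differentiable (by norm_num)) t).hasDerivAt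

lemma continuous_param (hΓ : Γ.IsAdmissible κ) : Continuous Γ.param := hΓ.contDiff_two.continuous

lemma continuous_deriv (hΓ : Γ.IsAdmissible κ) : Continuous (deriv Γ.param) := hΓ.contDiff_deriv.continuous

lemma continuous_deriv_deriv (hΓ : Γ.IsAdmissible κ) : Continuous (deriv (deriv Γ.param)) :=
  ((contDiff_succ_iff_deriv (n := 0)).1 (by simpa using hΓ.contDiff_deriv)).2.2.continuous

lemma continuous_curvature (hΓ : Γ.IsAdmissible κ) : Continuous Γ.curvature := by
  have h1 := hΓ.continuous_deriv
  have h2 := hΓ.continuous_deriv_deriv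
  unfold curvature
  fun_prop

lemma uniqueDiffOn_domain (hΓ : Γ.IsAdmissible κ) : UniqueDiffOn ℝ Γ.domain := by
  by_cases h : Γ.isLoop
  · have : Γ.domain = univ := by ext; simp [domain, h]
    rw [this]; exact uniqueDiffOn_univ
  · have : Γ.domain = Icc 0 Γ.len := by ext; simp [domain, h]
    rw [this]; exact uniqueDiffOn_Icc hΓ.len_pos

lemma sq_add_sq (hΓ : Γ.IsAdmissible κ) {t : ℝ} (ht : t ∈ Γ.domain) :
    deriv Γ.param t 0 ^ 2 + deriv Γ.param t 1 ^ 2 = 1 := by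
  rw [← norm_sq_plane, hΓ.unit_speed t ht, one_pow]

/-- Unit speed is known only on the domain, so `|γ'|² = 1` is differentiated within it. Uniqueness
of such derivatives covers the end points of an open arc. -/
lemma deriv_inner_deriv_deriv (hΓ : Γ.IsAdmissible κ) {t : ℝ} (ht : t ∈ Γ.domain) :
    deriv Γ.param t 0 * deriv (deriv Γ.param) t 0 +
      deriv Γ.param t 1 * deriv (deriv Γ.param) t 1 = 0 := by
  have h1 := (((hasDerivAt_coord (hΓ.hasDerivAt_deriv t) 0).fun_pow 2).fun_add
    ((hasDerivAt_coord (hΓ.hasDerivAt_deriv t) 1).fun_pow 2)).hasDerivWithinAt (s := Γ.domain)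
  have h2 : HasDerivWithinAt (fun s => deriv Γ.param s 0 ^ 2 + deriv Γ.param s 1 ^ 2) 0
      Γ.domain t :=
    (hasDerivWithinAt_const t Γ.domain (1 : ℝ)).congr (fun s hs => hΓ.sq_add_sq hs)
      (hΓ.sq_add_sq ht)
  have h3 := UniqueDiffWithinAt.eq_deriv _ (hΓ.uniqueDiffOn_domain t ht) h1 h2
  simp only [Nat.cast_ofNat, Nat.add_one_sub_one, pow_one] at h3
  linarith

lemma deriv_deriv_zero (hΓ : Γ.IsAdmissible κ) {t : ℝ} (ht : t ∈ Γ.domain) :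
    deriv (deriv Γ.param) t 0 = -(Γ.curvature t * deriv Γ.param t 1) := by
  unfold curvature
  linear_combination (-deriv (deriv Γ.param) t 0) * hΓ.sq_add_sq ht +
    deriv Γ.param t 0 * hΓ.deriv_inner_deriv_deriv ht

lemma deriv_deriv_one (hΓ : Γ.IsAdmissible κ) {t : ℝ} (ht : t ∈ Γ.domain) :
    deriv (deriv Γ.param) t 1 = Γ.curvature t * deriv Γ.param t 0 := by
  unfold curvature
  linear_combination (-deriv (deriv Γ.param) t 1) * hΓ.sq_add_sq ht +
    deriv Γ.param t 1 * hΓ.deriv_inner_deriv_deriv ht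

lemma norm_normal (hΓ : Γ.IsAdmissible κ) {t : ℝ} (ht : t ∈ Γ.domain) : ‖Γ.normal t‖ = 1 := by
  rw [← sq_eq_sq₀ (norm_nonneg _) zero_le_one, norm_sq_plane, normal_zero, normal_one, one_pow]
  linarith [hΓ.sq_add_sq ht]

lemma eq_or_of_param_eq (hΓ : Γ.IsAdmissible κ) {s t : ℝ} (hs : s ∈ Icc 0 Γ.len) (ht : t ∈ Icc 0 Γ.len)
    (h : Γ.param s = Γ.param t) :
    s = t ∨ Γ.isLoop ∧ (s = t + Γ.len ∨ t = s + Γ.len) := by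
  by_cases hl : Γ.isLoop
  swap
  · exact Or.inl (hΓ.simple_open hl hs ht h)
  obtain ⟨hp, hi⟩ := hΓ.simple_closed hl
  have hL := hΓ.len_pos
  have h0 : Γ.param Γ.len = Γ.param 0 := by simpa using hp 0
  rcases hs.2.lt_or_eq with hs' | rfl
  · rcases ht.2.lt_or_eq with ht' | rfl
    · exact Or.inl (hi ⟨hs.1, hs'⟩ ⟨ht.1, ht'⟩ h)
    · have : s = 0 := hi ⟨hs.1, hs'⟩ ⟨le_rfl, hL⟩ (h.trans h0)
      exact Or.inr ⟨hl, Or.inr (by rw [this, zero_add])⟩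
  · rcases ht.2.lt_or_eq with ht' | rfl
    · have : t = 0 := hi ⟨ht.1, ht'⟩ ⟨le_rfl, hL⟩ (h.symm.trans h0)
      exact Or.inr ⟨hl, Or.inl (by rw [this, zero_add])⟩
    · exact Or.inl rfl

lemma deriv_periodic (hΓ : Γ.IsAdmissible κ) (hl : Γ.isLoop) : Function.Periodic (deriv Γ.param) Γ.len := fun t => by
  rw [← deriv_comp_add_const]
  congr 1
  exact funext (hΓ.simple_closed hl).1

lemma deriv_deriv_periodic (hΓ : Γ.IsAdmissible κ) (hl : Γ.isLoop) :
    Function.Periodic (deriv (deriv Γ.param)) Γ.len := fun t => by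
  rw [← deriv_comp_add_const]
  congr 1
  exact funext (hΓ.deriv_periodic hl)

lemma deriv_eq_of_param_eq (hΓ : Γ.IsAdmissible κ) {s t : ℝ} (hs : s ∈ Icc 0 Γ.len) (ht : t ∈ Icc 0 Γ.len)
    (h : Γ.param s = Γ.param t) :
    deriv Γ.param s = deriv Γ.param t ∧ deriv (deriv Γ.param) s = deriv (deriv Γ.param) t := by
  rcases hΓ.eq_or_of_param_eq hs ht h with rfl | ⟨hl, rfl | rfl⟩
  · exact ⟨rfl, rfl⟩
  · exact ⟨hΓ.deriv_periodic hl t, hΓ.deriv_deriv_periodic hl t⟩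
  · exact ⟨(hΓ.deriv_periodic hl s).symm, (hΓ.deriv_deriv_periodic hl s).symm⟩

lemma normal_eq_of_param_eq (hΓ : Γ.IsAdmissible κ) {s t : ℝ} (hs : s ∈ Icc 0 Γ.len) (ht : t ∈ Icc 0 Γ.len)
    (h : Γ.param s = Γ.param t) : Γ.normal s = Γ.normal t := by
  unfold normal
  rw [(hΓ.deriv_eq_of_param_eq hs ht h).1]

lemma curvature_eq_of_param_eq (hΓ : Γ.IsAdmissible κ) {s t : ℝ} (hs : s ∈ Icc 0 Γ.len) (ht : t ∈ Icc 0 Γ.len)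
    (h : Γ.param s = Γ.param t) : Γ.curvature s = Γ.curvature t := by
  unfold curvature
  rw [(hΓ.deriv_eq_of_param_eq hs ht h).1, (hΓ.deriv_eq_of_param_eq hs ht h).2]

/-- The curve leaves its tangent lines at most quadratically in terms of the chord. -/
lemma exists_chord_bound (hΓ : Γ.IsAdmissible κ) : ∃ C > 0, ∀ t ∈ Icc 0 Γ.len, ∀ s ∈ Icc 0 Γ.len,
    |inner ℝ (Γ.normal t) (Γ.param s - Γ.param t)| ≤ C * ‖Γ.param s - Γ.param t‖ ^ 2 := by
  have hL := hΓ.len_pos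
  -- One period is added on each side of `[0, len]`, so that for a closed curve two points near the
  -- seam have close parameters in `J`.
  set J := Icc (-Γ.len) (2 * Γ.len) with hJ
  obtain ⟨B₀, hB₀⟩ := (isCompact_Icc (a := -Γ.len) (b := 2 * Γ.len)).exists_bound_of_continuousOn
    hΓ.continuous_deriv_deriv.continuousOn
  set B := max B₀ 1 with hBd
  have hB : ∀ r ∈ J, ‖deriv (deriv Γ.param) r‖ ≤ B := fun r hr => (hB₀ r hr).trans (le_max_left _ _)
  have B1 : 0 < B := lt_of_lt_of_le one_pos (le_max_right _ _)
  have step1 : ∀ s ∈ J, ∀ t ∈ J, ‖deriv Γ.param s - deriv Γ.param t‖ ≤ B * |s - t| := by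
    intro s hs t ht
    exact (convex_Icc _ _).norm_image_sub_le_of_norm_hasDerivWithin_le
      (fun r _ => (hΓ.hasDerivAt_deriv r).hasDerivWithinAt) hB ht hs
  have step2 : ∀ s ∈ J, ∀ t ∈ J,
      ‖Γ.param s - Γ.param t - (s - t) • deriv Γ.param t‖ ≤ B * |s - t| ^ 2 := by
    intro s hs t ht
    have hsub : uIcc t s ⊆ J := (convex_Icc _ _).ordConnected.uIcc_subset ht hs
    have h1 : ∀ r ∈ uIcc t s, HasDerivWithinAt (fun r => Γ.param r - r • deriv Γ.param t)
        (deriv Γ.param r - deriv Γ.param t) (uIcc t s) r := fun r _ => by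
      exact ((hΓ.hasDerivAt_param r).fun_sub ((hasDerivAt_id' r).smul_const
        (deriv Γ.param t))).hasDerivWithinAt.congr_deriv (by rw [one_smul])
    have h2 := (convex_uIcc t s).norm_image_sub_le_of_norm_hasDerivWithin_le h1
      (C := B * |s - t|) (fun r hr => (step1 r (hsub hr) t ht).trans
        (mul_le_mul_of_nonneg_left (abs_sub_left_of_mem_uIcc hr) B1.le))
      left_mem_uIcc right_mem_uIcc
    rw [Real.norm_eq_abs] at h2
    have e : Γ.param s - Γ.param t - (s - t) • deriv Γ.param t =
        (Γ.param s - s • deriv Γ.param t) - (Γ.param t - t • deriv Γ.param t) := by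
      rw [sub_smul]; abel
    rw [e]
    linarith [h2, sq (|s - t|)]
  have hIJ : Icc 0 Γ.len ⊆ J := Icc_subset_Icc (by linarith) (by linarith)
  -- close parameters
  have step3 : ∀ t ∈ Icc 0 Γ.len, ∀ s ∈ J, |s - t| ≤ 1 / (2 * B) →
      |inner ℝ (Γ.normal t) (Γ.param s - Γ.param t)| ≤ 4 * B * ‖Γ.param s - Γ.param t‖ ^ 2 := by
    intro t ht s hs hst
    have htd := Icc_subset_domain Γ ht
    have h2 := step2 s hs t (hIJ ht)
    have h3 : inner ℝ (Γ.normal t) (Γ.param s - Γ.param t) =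
        inner ℝ (Γ.normal t) (Γ.param s - Γ.param t - (s - t) • deriv Γ.param t) := by
      rw [inner_sub_right _ _ ((s - t) • _), inner_smul_right, inner_plane _ (deriv Γ.param t),
        normal_zero, normal_one]
      ring
    have h4 : |inner ℝ (Γ.normal t) (Γ.param s - Γ.param t)| ≤ B * |s - t| ^ 2 := by
      rw [h3]
      refine (abs_real_inner_le_norm _ _).trans ?_
      rw [hΓ.norm_normal htd, one_mul]; exact h2
    have h5 : |s - t| ≤ ‖Γ.param s - Γ.param t‖ + B * |s - t| ^ 2 := by
      have : ‖(s - t) • deriv Γ.param t‖ = |s - t| := by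
        rw [norm_smul, hΓ.unit_speed t htd, mul_one, Real.norm_eq_abs]
      rw [← this]
      have h6 := norm_sub_norm_le ((s - t) • deriv Γ.param t) (Γ.param s - Γ.param t)
      rw [norm_sub_rev ((s - t) • _)] at h6
      rw [this] at h6 ⊢
      linarith
    have h6 : B * |s - t| ^ 2 ≤ |s - t| / 2 := by
      rw [le_div_iff₀ (by positivity)] at hst
      nlinarith [abs_nonneg (s - t)]
    have h7 : |s - t| ≤ 2 * ‖Γ.param s - Γ.param t‖ := by linarith
    calc _ ≤ B * |s - t| ^ 2 := h4
      _ ≤ B * (2 * ‖Γ.param s - Γ.param t‖) ^ 2 := by gcongr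
      _ = _ := by ring
  set δ := 1 / (2 * B) with hδ
  have δ0 : 0 < δ := by positivity
  -- Pairs of parameters that are not close, for a closed curve also not close modulo the period. On
  -- this compact set simplicity bounds the chords from below, and the chord estimate is then
  -- trivial.
  set K : Set (ℝ × ℝ) := {p | p ∈ Icc 0 Γ.len ×ˢ Icc 0 Γ.len ∧ δ ≤ |p.1 - p.2| ∧
    (Γ.isLoop → |p.1 - p.2| ≤ Γ.len - δ)} with hK
  have Kc : IsCompact K := by
    have hd : Continuous fun p : ℝ × ℝ => |p.1 - p.2| := by fun_prop
    have h1 : IsClosed {p : ℝ × ℝ | δ ≤ |p.1 - p.2|} := isClosed_le continuous_const hd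
    have h2 : IsClosed {p : ℝ × ℝ | Γ.isLoop → |p.1 - p.2| ≤ Γ.len - δ} := by
      by_cases hl : Γ.isLoop
      · simp only [hl, forall_const]; exact isClosed_le hd continuous_const
      · simp [hl]
    exact (isCompact_Icc.prod isCompact_Icc).inter_right (h1.inter h2)
  have hne : ∀ p ∈ K, 0 < ‖Γ.param p.1 - Γ.param p.2‖ := by
    rintro ⟨s, t⟩ ⟨⟨hs, ht⟩, h1, h2⟩
    refine norm_pos_iff.2 (sub_ne_zero.2 fun h => ?_)
    simp only at hs ht h1 h2 h
    rcases hΓ.eq_or_of_param_eq hs ht h with rfl | ⟨hl, rfl | rfl⟩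
    · simp only [sub_self, abs_zero] at h1; linarith
    · have := h2 hl
      rw [add_sub_cancel_left, abs_of_pos hL] at this; linarith
    · have := h2 hl
      rw [sub_add_cancel_left, abs_neg, abs_of_pos hL] at this; linarith
  obtain ⟨μ, μ0, hμ⟩ : ∃ μ > 0, ∀ p ∈ K, μ ≤ ‖Γ.param p.1 - Γ.param p.2‖ := by
    rcases K.eq_empty_or_nonempty with hE | hE
    · exact ⟨1, one_pos, by simp [hE]⟩
    · have hc := hΓ.continuous_param
      obtain ⟨p, hp, hm⟩ := Kc.exists_isMinOn hE
        (f := fun p => ‖Γ.param p.1 - Γ.param p.2‖) (by fun_prop)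
      exact ⟨_, hne p hp, fun q hq => hm hq⟩
  refine ⟨max (4 * B) (1 / μ), lt_max_of_lt_left (by positivity), fun t ht s hs => ?_⟩
  have near : ∀ r ∈ J, |r - t| ≤ δ → Γ.param r = Γ.param s →
      |inner ℝ (Γ.normal t) (Γ.param s - Γ.param t)| ≤
        max (4 * B) (1 / μ) * ‖Γ.param s - Γ.param t‖ ^ 2 := by
    intro r hr hrt e
    rw [← e]
    exact (step3 t ht r hr hrt).trans (by gcongr; exact le_max_left _ _)
  rcases le_or_gt (|s - t|) δ with h1 | h1
  · exact near s (hIJ hs) h1 rfl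
  by_cases h2 : Γ.isLoop → |s - t| ≤ Γ.len - δ
  · have h3 := hμ (s, t) ⟨⟨hs, ht⟩, h1.le, h2⟩
    simp only at h3
    have h4 := abs_real_inner_le_norm (Γ.normal t) (Γ.param s - Γ.param t)
    rw [hΓ.norm_normal (Icc_subset_domain Γ ht), one_mul] at h4
    refine h4.trans ?_
    calc ‖Γ.param s - Γ.param t‖ = 1 / μ * (‖Γ.param s - Γ.param t‖ * μ) := by field_simp
      _ ≤ 1 / μ * (‖Γ.param s - Γ.param t‖ * ‖Γ.param s - Γ.param t‖) := by gcongr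
      _ ≤ max (4 * B) (1 / μ) * ‖Γ.param s - Γ.param t‖ ^ 2 := by
        rw [← sq]; gcongr; exact le_max_right _ _
  -- The two points lie on opposite sides of the seam of a closed curve; a shift by one period makes
  -- their parameters close.
  · push Not at h2
    obtain ⟨hl, h2⟩ := h2
    have hp := (hΓ.simple_closed hl).1
    rcases lt_abs.1 h2 with h3 | h3
    · refine near (s - Γ.len) ⟨by linarith [hs.1], by linarith [hs.2]⟩ ?_ (hp.sub_eq s)
      rw [abs_le]; constructor <;> linarith [hs.2, ht.1]
    · refine near (s + Γ.len) ⟨by linarith [hs.1], by linarith [hs.2]⟩ ?_ (hp s)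
      rw [abs_le]; constructor <;> linarith [hs.1, ht.2]

lemma dist_sq_eq (hΓ : Γ.IsAdmissible κ) {t : ℝ} (ht : t ∈ Icc 0 Γ.len) (u s : ℝ) :
    dist (Γ.param t + u • Γ.normal t) (Γ.param s) ^ 2 = u ^ 2 + 2 *
      (‖Γ.param s - Γ.param t‖ ^ 2 / 2 - u * inner ℝ (Γ.normal t) (Γ.param s - Γ.param t)) := by
  rw [dist_eq_norm, show Γ.param t + u • Γ.normal t - Γ.param s =
    u • Γ.normal t - (Γ.param s - Γ.param t) by abel, norm_sub_sq_real, norm_smul,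
    hΓ.norm_normal (Icc_subset_domain Γ ht), inner_smul_left]
  simp
  ring

lemma dist_normal (hΓ : Γ.IsAdmissible κ) {t : ℝ} (ht : t ∈ Icc 0 Γ.len) (u : ℝ) :
    dist (Γ.param t + u • Γ.normal t) (Γ.param t) = |u| := by
  rw [dist_eq_norm, add_sub_cancel_left, norm_smul, hΓ.norm_normal (Icc_subset_domain Γ ht),
    mul_one, Real.norm_eq_abs]

/-- Sufficiently thin tubes are regular. -/
theorem exists_tubeRegular (hΓ : Γ.IsAdmissible κ) : ∃ ε₁ > 0, ∀ ε ∈ Ioc 0 ε₁, Γ.TubeRegular ε := by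
  obtain ⟨C, C0, hC⟩ := hΓ.exists_chord_bound
  obtain ⟨B₀, hB₀⟩ := (isCompact_Icc (a := 0) (b := Γ.len)).exists_bound_of_continuousOn
    hΓ.continuous_curvature.continuousOn
  set B := max B₀ 1 with hBd
  have hB : ∀ t ∈ Icc 0 Γ.len, |Γ.curvature t| ≤ B := fun r hr =>
    (hB₀ r hr).trans (le_max_left _ _)
  have B1 : 0 < B := lt_of_lt_of_le one_pos (le_max_right _ _)
  refine ⟨min (1 / (4 * C)) (1 / (2 * B)), by positivity, fun ε hε => ⟨?_, ?_⟩⟩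
  · rintro x ⟨t, ht, u, hu, rfl⟩
    have hu4 : |u| * C ≤ 1 / 4 := by
      have : |u| ≤ 1 / (4 * C) := (abs_le.2 hu).trans (hε.2.trans (min_le_left _ _))
      rw [le_div_iff₀ (by positivity)] at this; linarith
    -- The squared distance is `u²` plus the squared chord minus `2 u` times the normal component of
    -- the chord. By the chord bound and `|u| C ≤ 1 / 4` the last term uses up at most half of the
    -- squared chord, so the foot is the unique minimizer.
    have key : ∀ s ∈ Icc 0 Γ.len, u ^ 2 + ‖Γ.param s - Γ.param t‖ ^ 2 / 2 ≤
        dist (Γ.param t + u • Γ.normal t) (Γ.param s) ^ 2 := by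
      intro s hs
      rw [hΓ.dist_sq_eq ht]
      have h1 := hC t ht s hs
      have h2 : u * inner ℝ (Γ.normal t) (Γ.param s - Γ.param t) ≤
          |u| * (C * ‖Γ.param s - Γ.param t‖ ^ 2) := by
        refine (le_abs_self _).trans ?_
        rw [abs_mul]; gcongr
      nlinarith [sq_nonneg ‖Γ.param s - Γ.param t‖]
    refine ⟨Γ.param t, ⟨⟨t, ht, rfl⟩, ?_⟩, ?_⟩
    · rintro _ ⟨s, hs, rfl⟩
      rw [hΓ.dist_normal ht]
      exact abs_le_of_sq_le_sq (by nlinarith [key s hs, sq_nonneg ‖Γ.param s - Γ.param t‖])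
        dist_nonneg
    · rintro _ ⟨⟨s, hs, rfl⟩, hmin⟩
      have h1 := hmin (Γ.param t) ⟨t, ht, rfl⟩
      rw [hΓ.dist_normal ht] at h1
      have h2 := pow_le_pow_left₀ dist_nonneg h1 2
      rw [sq_abs] at h2
      have h3 := key s hs
      have h4 : ‖Γ.param s - Γ.param t‖ ^ 2 ≤ 0 := by linarith
      exact sub_eq_zero.1 (norm_eq_zero.1 (pow_eq_zero_iff two_ne_zero |>.1
        (le_antisymm h4 (sq_nonneg _))))
  · intro t ht u hu
    have h1 : |u| ≤ 1 / (2 * B) := (abs_le.2 hu).trans (hε.2.trans (min_le_right _ _))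
    rw [le_div_iff₀ (by positivity)] at h1
    have h2 : |u * Γ.curvature t| ≤ |u| * B := by
      rw [abs_mul]; gcongr; exact hB t ht
    linarith [neg_abs_le (u * Γ.curvature t)]

end IsAdmissible

end PlaneCurve

/-! ### The integrand in normal coordinates -/

namespace PlaneCurve

namespace IsAdmissible

variable {Γ : PlaneCurve} {κ ε₀ : ℝ}

/-- The squared distance to `param s` of the point at height `v` on the normal at `t`, up to
constants. -/
def footEnergy (Γ : PlaneCurve) (t v s : ℝ) : ℝ :=
  ‖Γ.param s - Γ.param t‖ ^ 2 / 2 - v * inner ℝ (Γ.normal t) (Γ.param s - Γ.param t)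

lemma continuous_footEnergy (hΓ : Γ.IsAdmissible κ) (t : ℝ) :
    Continuous fun z : ℝ × ℝ => footEnergy Γ t z.1 z.2 := by
  have := hΓ.continuous_param
  unfold footEnergy
  fun_prop

lemma footEnergy_eq_zero {t s : ℝ} (v : ℝ) (h : Γ.param s = Γ.param t) :
    footEnergy Γ t v s = 0 := by simp [footEnergy, h]

lemma footEnergy_nonneg_iff (hΓ : Γ.IsAdmissible κ) {t : ℝ} (ht : t ∈ Icc 0 Γ.len) (v s : ℝ) :
    0 ≤ footEnergy Γ t v s ↔ dist (Γ.param t + v • Γ.normal t) (Γ.param t) ≤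
      dist (Γ.param t + v • Γ.normal t) (Γ.param s) := by
  have hdist : ∀ s, dist (Γ.param t + v • Γ.normal t) (Γ.param s) ^ 2 =
      v ^ 2 + 2 * footEnergy Γ t v s := fun s => hΓ.dist_sq_eq ht v s
  rw [← sq_le_sq₀ dist_nonneg dist_nonneg, hdist, hdist, footEnergy_eq_zero v rfl]
  constructor <;> intro h <;> linarith

/-- At any parameter representing the foot point the energy and its first derivative in `s` vanish
for every height, and the second derivative is `1 + v c > 0`. The latter stays positive for nearby
heights and parameters, so the energy has a local minimum there, uniformly in the height. -/
lemma footEnergy_eventually_nonneg (hΓ : Γ.IsAdmissible κ) {t v s : ℝ} (ht : t ∈ Icc 0 Γ.len)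
    (hs : s ∈ Icc 0 Γ.len) (hst : Γ.param s = Γ.param t) (hv : 0 < 1 + v * Γ.curvature t) :
    ∀ᶠ z : ℝ × ℝ in 𝓝 (v, s), 0 ≤ footEnergy Γ t z.1 z.2 := by
  have htd := Icc_subset_domain Γ ht
  have cparam := hΓ.continuous_param
  have cd := hΓ.continuous_deriv
  have cdd := hΓ.continuous_deriv_deriv
  obtain ⟨e1, e2⟩ := hΓ.deriv_eq_of_param_eq hs ht hst
  let Φ' : ℝ → ℝ → ℝ := fun v r =>
    (Γ.param r 0 - Γ.param t 0) * deriv Γ.param r 0 +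
    (Γ.param r 1 - Γ.param t 1) * deriv Γ.param r 1 -
    v * (deriv Γ.param t 1 * deriv Γ.param r 0 - deriv Γ.param t 0 * deriv Γ.param r 1)
  let Φ'' : ℝ → ℝ → ℝ := fun v r =>
    deriv Γ.param r 0 ^ 2 + deriv Γ.param r 1 ^ 2 +
    (Γ.param r 0 - Γ.param t 0) * deriv (deriv Γ.param) r 0 +
    (Γ.param r 1 - Γ.param t 1) * deriv (deriv Γ.param) r 1 -
    v * (deriv Γ.param t 1 * deriv (deriv Γ.param) r 0 -
      deriv Γ.param t 0 * deriv (deriv Γ.param) r 1)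
  have Φform : ∀ v r, footEnergy Γ t v r = ((Γ.param r 0 - Γ.param t 0) ^ 2 +
      (Γ.param r 1 - Γ.param t 1) ^ 2) / 2 - v *
      (deriv Γ.param t 1 * (Γ.param r 0 - Γ.param t 0) -
        deriv Γ.param t 0 * (Γ.param r 1 - Γ.param t 1)) := fun v r => by
    rw [footEnergy, norm_sq_plane, inner_plane, normal_zero, normal_one]
    simp only [PiLp.sub_apply]
    ring
  have d1 : ∀ v r, HasDerivAt (footEnergy Γ t v) (Φ' v r) r := fun v r => by
    have h0 := (hasDerivAt_coord (hΓ.hasDerivAt_param r) 0).sub_const (Γ.param t 0)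
    have h1 := (hasDerivAt_coord (hΓ.hasDerivAt_param r) 1).sub_const (Γ.param t 1)
    have := ((((h0.fun_pow 2).fun_add (h1.fun_pow 2)).div_const 2)).fun_sub
      (((h0.const_mul (deriv Γ.param t 1)).fun_sub
        (h1.const_mul (deriv Γ.param t 0))).const_mul v)
    rw [show footEnergy Γ t v = _ from funext (Φform v)]
    exact this.congr_deriv (by simp only [Φ']; push_cast; ring)
  have d2 : ∀ v r, HasDerivAt (Φ' v) (Φ'' v r) r := fun v r => by
    have h0 := (hasDerivAt_coord (hΓ.hasDerivAt_param r) 0).sub_const (Γ.param t 0)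
    have h1 := (hasDerivAt_coord (hΓ.hasDerivAt_param r) 1).sub_const (Γ.param t 1)
    have k0 := hasDerivAt_coord (hΓ.hasDerivAt_deriv r) 0
    have k1 := hasDerivAt_coord (hΓ.hasDerivAt_deriv r) 1
    exact (((h0.fun_mul k0).fun_add (h1.fun_mul k1)).fun_sub
      (((k0.const_mul (deriv Γ.param t 1)).fun_sub
        (k1.const_mul (deriv Γ.param t 0))).const_mul v)).congr_deriv
        (by simp only [Φ'']; ring)
  have Φ2c : Continuous fun z : ℝ × ℝ => Φ'' z.1 z.2 := by
    simp only [Φ'']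
    fun_prop
  have hpos : 0 < Φ'' v s := by
    simp only [Φ'']
    rw [e1, e2, hst, hΓ.deriv_deriv_zero htd, hΓ.deriv_deriv_one htd]
    have h2 := hΓ.sq_add_sq htd
    calc (0 : ℝ) < 1 + v * Γ.curvature t := hv
      _ = _ := by linear_combination (-1 - v * Γ.curvature t) * h2
  obtain ⟨δ, δ0, hδ⟩ := Metric.mem_nhds_iff.1
    ((isOpen_lt continuous_const Φ2c).mem_nhds (x := (v, s)) hpos)
  refine Metric.eventually_nhds_iff.2 ⟨δ, δ0, fun z hz => ?_⟩
  rw [Prod.dist_eq, max_lt_iff] at hz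
  refine nonneg_of_second_deriv_nonneg (d1 z.1) (d2 z.1) (s := s) (δ := δ)
    (footEnergy_eq_zero _ hst) ?_ (fun r hr => ?_) hz.2
  · simp only [Φ']; rw [hst, e1]; ring
  · have : (z.1, r) ∈ Metric.ball (v, s) δ := by
      rw [Metric.mem_ball, Prod.dist_eq, max_lt_iff]
      exact ⟨hz.1, hr⟩
    exact le_of_lt (hδ this)

/-- In a regular tube, the foot point of a normal segment is a nearest point. -/
theorem dist_foot_le (hΓ : Γ.IsAdmissible κ) (hreg : Γ.TubeRegular ε₀) {t u : ℝ}
    (ht : t ∈ Icc 0 Γ.len) (hu : u ∈ Icc (-ε₀) ε₀) {s : ℝ} (hs : s ∈ Icc 0 Γ.len) :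
    dist (Γ.param t + u • Γ.normal t) (Γ.param t) ≤
      dist (Γ.param t + u • Γ.normal t) (Γ.param s) := by
  have Φc := hΓ.continuous_footEnergy t
  -- Continuity method along the normal segment: `A` holds the fractions `v` for which the foot is a
  -- nearest point to the point at height `v u`. It contains 0, is closed, and is open to the right.
  let A : Set ℝ := {v | ∀ s ∈ Icc 0 Γ.len, 0 ≤ footEnergy Γ t (v * u) s}
  have Ac : IsClosed (A ∩ Icc 0 1) := by
    refine IsClosed.inter ?_ isClosed_Icc
    have : A = ⋂ s ∈ Icc 0 Γ.len, {v | 0 ≤ footEnergy Γ t (v * u) s} := by ext v; simp [A]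
    rw [this]
    have hc : ∀ s, Continuous fun v : ℝ => footEnergy Γ t (v * u) s := fun s => by
      unfold footEnergy
      fun_prop
    exact isClosed_biInter fun s _ => isClosed_le continuous_const (hc s)
  have A0 : (0 : ℝ) ∈ A := fun s _ => by
    rw [footEnergy, zero_mul, zero_mul, sub_zero]; positivity
  have step : ∀ v ∈ A ∩ Ico 0 1, A ∈ 𝓝[>] v := by
    rintro v ⟨hvA, hv⟩
    have hv' : v * u ∈ Icc (-ε₀) ε₀ := by
      refine abs_le.1 ?_
      rw [abs_mul, abs_of_nonneg hv.1]
      exact (mul_le_of_le_one_left (abs_nonneg u) hv.2.le).trans (abs_le.2 hu)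
    suffices hev : ∀ᶠ v' in 𝓝 (v * u), ∀ s ∈ Icc 0 Γ.len, 0 ≤ footEnergy Γ t v' s by
      refine mem_nhdsWithin_of_mem_nhds ?_
      exact ((continuous_mul_const u).tendsto v).eventually hev
    refine (isCompact_Icc (a := 0) (b := Γ.len)).eventually_forall_of_forall_eventually
      fun s hs => ?_
    by_cases hst : Γ.param s = Γ.param t
    · exact hΓ.footEnergy_eventually_nonneg ht hs hst (hreg.2 t ht _ hv')
    -- If the energy vanished, `param s` would be a second nearest point, against uniqueness in the
    -- tube. Strict positivity persists nearby.
    have hpos : 0 < footEnergy Γ t (v * u) s := by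
      refine lt_of_le_of_ne (hvA s hs) fun h0 => hst ?_
      obtain ⟨y, -, hy⟩ := hreg.1 _ ⟨t, ht, v * u, hv', rfl⟩
      have hmin : ∀ z ∈ Γ.trace, dist (Γ.param t + (v * u) • Γ.normal t) (Γ.param t) ≤
          dist (Γ.param t + (v * u) • Γ.normal t) z := by
        rintro _ ⟨r, hr, rfl⟩
        exact (hΓ.footEnergy_nonneg_iff ht _ r).1 (hvA r hr)
      have heq : dist (Γ.param t + (v * u) • Γ.normal t) (Γ.param s) ≤
          dist (Γ.param t + (v * u) • Γ.normal t) (Γ.param t) := by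
        rw [← sq_le_sq₀ dist_nonneg dist_nonneg, hΓ.dist_sq_eq ht, hΓ.dist_sq_eq ht]
        change (v * u) ^ 2 + 2 * footEnergy Γ t (v * u) s ≤
          (v * u) ^ 2 + 2 * footEnergy Γ t (v * u) t
        rw [footEnergy_eq_zero (s := t) _ rfl, ← h0]
      exact (hy _ ⟨⟨s, hs, rfl⟩, fun z hz => heq.trans (hmin z hz)⟩).trans
        (hy _ ⟨⟨t, ht, rfl⟩, hmin⟩).symm
    have hopen : ∀ᶠ z : ℝ × ℝ in 𝓝 (v * u, s), 0 < footEnergy Γ t z.1 z.2 :=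
      (isOpen_lt continuous_const Φc).mem_nhds (x := (v * u, s)) hpos
    exact hopen.mono fun z hz => hz.le
  have h1 := Ac.Icc_subset_of_forall_mem_nhdsWithin A0 step (right_mem_Icc.2 zero_le_one)
  have h2 := h1 s hs
  rw [one_mul] at h2
  exact (hΓ.footEnergy_nonneg_iff ht u s).1 h2

lemma param_eq_of_nearest (hΓ : Γ.IsAdmissible κ) (hreg : Γ.TubeRegular ε₀) {t u : ℝ}
    (ht : t ∈ Icc 0 Γ.len) (hu : u ∈ Icc (-ε₀) ε₀) {r : ℝ} (hr : r ∈ Icc 0 Γ.len)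
    (hmin : ∀ s ∈ Icc 0 Γ.len, dist (Γ.param t + u • Γ.normal t) (Γ.param r) ≤
      dist (Γ.param t + u • Γ.normal t) (Γ.param s)) : Γ.param r = Γ.param t := by
  obtain ⟨y, -, hy⟩ := hreg.1 _ ⟨t, ht, u, hu, rfl⟩
  have h1 : Γ.param r = y := hy _ ⟨⟨r, hr, rfl⟩, by rintro _ ⟨s, hs, rfl⟩; exact hmin s hs⟩
  have h2 : Γ.param t = y := hy _ ⟨⟨t, ht, rfl⟩, by
    rintro _ ⟨s, hs, rfl⟩; exact hΓ.dist_foot_le hreg ht hu hs⟩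
  rw [h1, h2]

/-- The chosen parameter is not determined where a closed curve has both 0 and `len` for the same
point. Only the point it represents is, and normal and curvature depend on that point alone. -/
lemma projParam_spec (hΓ : Γ.IsAdmissible κ) (hreg : Γ.TubeRegular ε₀) {t u : ℝ}
    (ht : t ∈ Icc 0 Γ.len) (hu : u ∈ Icc (-ε₀) ε₀) :
    Γ.projParam (Γ.param t + u • Γ.normal t) ∈ Icc 0 Γ.len ∧
      Γ.param (Γ.projParam (Γ.param t + u • Γ.normal t)) = Γ.param t := by
  have h := Classical.epsilon_spec (p := fun r => r ∈ Icc 0 Γ.len ∧ ∀ s ∈ Icc 0 Γ.len,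
    dist (Γ.param t + u • Γ.normal t) (Γ.param r) ≤ dist (Γ.param t + u • Γ.normal t) (Γ.param s))
    ⟨t, ht, fun s hs => hΓ.dist_foot_le hreg ht hu hs⟩
  exact ⟨h.1, hΓ.param_eq_of_nearest hreg ht hu h.1 h.2⟩

lemma signedDist_eq (hΓ : Γ.IsAdmissible κ) (hreg : Γ.TubeRegular ε₀) {t u : ℝ}
    (ht : t ∈ Icc 0 Γ.len) (hu : u ∈ Icc (-ε₀) ε₀) :
    Γ.signedDist (Γ.param t + u • Γ.normal t) = u := by
  obtain ⟨h1, h2⟩ := hΓ.projParam_spec hreg ht hu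
  unfold signedDist proj
  rw [hΓ.normal_eq_of_param_eq h1 ht h2, h2, add_sub_cancel_left, inner_smul_right,
    real_inner_self_eq_norm_sq, hΓ.norm_normal (Icc_subset_domain Γ ht)]
  ring

/-- `1 - u c / (1 + u c) = (1 + u c)⁻¹` is the reciprocal of the area element of the normal
coordinates, and cancels it in all integrals over the tube. -/
lemma jacobian_eq (hΓ : Γ.IsAdmissible κ) (hreg : Γ.TubeRegular ε₀) {t u : ℝ}
    (ht : t ∈ Icc 0 Γ.len) (hu : u ∈ Icc (-ε₀) ε₀) :
    Γ.jacobian (Γ.param t + u • Γ.normal t) = (1 + u * Γ.curvature t)⁻¹ := by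
  obtain ⟨h1, h2⟩ := hΓ.projParam_spec hreg ht hu
  unfold jacobian levelCurvature
  rw [hΓ.signedDist_eq hreg ht hu, hΓ.curvature_eq_of_param_eq h1 ht h2]
  have := hreg.2 t ht u hu
  field_simp
  ring

lemma integrand_eq (hΓ : Γ.IsAdmissible κ) (hreg : Γ.TubeRegular ε₀) {t u : ℝ}
    (ht : t ∈ Icc 0 Γ.len) (hu : u ∈ Icc (-ε₀) ε₀) (f : Plane → ℝ) (θ : ℝ → ℝ) (ε : ℝ) :
    Γ.integrand f θ ε (Γ.param t + u • Γ.normal t) =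
      f (Γ.param t) * (ε⁻¹ * θ (ε⁻¹ * u)) * (1 + u * Γ.curvature t)⁻¹ := by
  unfold integrand proj
  rw [hΓ.signedDist_eq hreg ht hu, hΓ.jacobian_eq hreg ht hu, (hΓ.projParam_spec hreg ht hu).2]

end IsAdmissible

/-- Parameters that represent each point of the curve once. -/
def fundamentalDomain (Γ : PlaneCurve) : Set ℝ := {t ∈ Icc 0 Γ.len | Γ.isLoop → t ≠ Γ.len}

lemma measurableSet_fundamentalDomain (Γ : PlaneCurve) : MeasurableSet Γ.fundamentalDomain := by
  refine measurableSet_Icc.inter ?_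
  by_cases h : Γ.isLoop
  · simp only [h, forall_const]; exact (measurableSet_singleton _).compl
  · simp only [h, false_imp_iff]; exact MeasurableSet.univ

lemma fundamentalDomain_ae_eq (Γ : PlaneCurve) :
    Γ.fundamentalDomain =ᵐ[volume] Ioc 0 Γ.len := by
  refine Filter.EventuallyEq.trans ?_ Ioc_ae_eq_Icc.symm
  have h : ∀ᵐ t : ℝ, t ≠ Γ.len := by simp [ae_iff]
  filter_upwards [h] with t ht
  exact propext ⟨fun h => h.1, fun h => ⟨h, fun _ => ht⟩⟩

/-- Normal coordinates. -/
def normalMap (Γ : PlaneCurve) (p : ℝ × ℝ) : Plane := Γ.param p.1 + p.2 • Γ.normal p.1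

/-- Normal coordinates on the coordinate plane. -/
def normalMapCoord (Γ : PlaneCurve) (p : ℝ × ℝ) : ℝ × ℝ :=
  (Γ.param p.1 0 + p.2 * deriv Γ.param p.1 1, Γ.param p.1 1 - p.2 * deriv Γ.param p.1 0)

lemma normalMap_zero (Γ : PlaneCurve) (p : ℝ × ℝ) :
    Γ.normalMap p 0 = Γ.param p.1 0 + p.2 * deriv Γ.param p.1 1 := by
  simp [normalMap, normal_zero]

lemma normalMap_one (Γ : PlaneCurve) (p : ℝ × ℝ) :
    Γ.normalMap p 1 = Γ.param p.1 1 - p.2 * deriv Γ.param p.1 0 := by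
  simp [normalMap, normal_one, sub_eq_add_neg]

/-- The plane in coordinates. -/
def planeCoord : Plane ≃ᵐ ℝ × ℝ :=
  (MeasurableEquiv.toLp 2 (Fin 2 → ℝ)).symm.trans MeasurableEquiv.finTwoArrow

lemma planeCoord_apply (x : Plane) : planeCoord x = (x 0, x 1) := rfl

lemma measurePreserving_planeCoord : MeasurePreserving planeCoord volume volume :=
  (volume_preserving_finTwoArrow ℝ).comp (PiLp.volume_preserving_ofLp (Fin 2))

lemma planeCoord_normalMap (Γ : PlaneCurve) (p : ℝ × ℝ) :
    planeCoord (Γ.normalMap p) = Γ.normalMapCoord p := by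
  rw [planeCoord_apply, normalMap_zero, normalMap_one]; rfl

/-- The part of the normal coordinates that represents the tube. -/
def tubeCoord (Γ : PlaneCurve) (ε : ℝ) : Set (ℝ × ℝ) := Γ.fundamentalDomain ×ˢ Icc (-ε) ε

lemma measurableSet_tubeCoord (Γ : PlaneCurve) (ε : ℝ) : MeasurableSet (Γ.tubeCoord ε) :=
  Γ.measurableSet_fundamentalDomain.prod measurableSet_Icc

/-- The integrand, extended by zero. -/
def extendedIntegrand (Γ : PlaneCurve) (f : Plane → ℝ) (θ : ℝ → ℝ) (ε : ℝ) : Plane → ℝ :=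
  (Γ.tube ε).indicator (Γ.integrand f θ ε)

namespace IsAdmissible

variable {Γ : PlaneCurve} {κ ε₀ ε : ℝ}

lemma continuous_normal (hΓ : Γ.IsAdmissible κ) : Continuous Γ.normal := by
  have := hΓ.continuous_deriv
  unfold normal
  fun_prop

lemma continuous_normalMap (hΓ : Γ.IsAdmissible κ) : Continuous Γ.normalMap := by
  have := hΓ.continuous_normal
  have := hΓ.continuous_param
  unfold normalMap
  fun_prop

lemma injOn_normalMap (hΓ : Γ.IsAdmissible κ) (hreg : Γ.TubeRegular ε₀) (hε : ε ≤ ε₀) :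
    InjOn Γ.normalMap (Γ.tubeCoord ε) := by
  rintro ⟨t, u⟩ ⟨ht, hu⟩ ⟨s, v⟩ ⟨hs, hv⟩ h
  have hsub := Icc_subset_Icc (neg_le_neg hε) hε
  simp only at ht hu hs hv
  have hd : u = v := by
    rw [← hΓ.signedDist_eq hreg ht.1 (hsub hu), ← hΓ.signedDist_eq hreg hs.1 (hsub hv)]
    exact congrArg _ h
  subst hd
  have hp : Γ.param t = Γ.param s := by
    rw [← (hΓ.projParam_spec hreg ht.1 (hsub hu)).2, ← (hΓ.projParam_spec hreg hs.1 (hsub hv)).2]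
    exact congrArg _ (congrArg _ h)
  have hL := hΓ.len_pos
  rcases hΓ.eq_or_of_param_eq ht.1 hs.1 hp with rfl | ⟨hl, e | e⟩
  · rfl
  · exact absurd (le_antisymm ht.1.2 (by linarith [hs.1.1])) (ht.2 hl)
  · exact absurd (le_antisymm hs.1.2 (by linarith [ht.1.1])) (hs.2 hl)

lemma image_normalMap (hΓ : Γ.IsAdmissible κ) (ε : ℝ) :
    Γ.normalMap '' Γ.tubeCoord ε = Γ.tube ε := by
  ext x
  constructor
  · rintro ⟨⟨t, u⟩, ⟨ht, hu⟩, rfl⟩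
    exact ⟨t, ht.1, u, hu, rfl⟩
  · rintro ⟨t, ht, u, hu, rfl⟩
    by_cases h : Γ.isLoop ∧ t = Γ.len
    · refine ⟨(0, u), ⟨⟨⟨le_rfl, hΓ.len_pos.le⟩, fun _ => hΓ.len_pos.ne⟩, hu⟩, ?_⟩
      have h0 : Γ.param 0 = Γ.param t := by
        rw [h.2]; simpa using ((hΓ.simple_closed h.1).1 0).symm
      change Γ.param 0 + u • Γ.normal 0 = _
      rw [h0, hΓ.normal_eq_of_param_eq ⟨le_rfl, hΓ.len_pos.le⟩ ht h0]
    · exact ⟨(t, u), ⟨⟨ht, fun hl hc => h ⟨hl, hc⟩⟩, hu⟩, rfl⟩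

lemma measurableSet_tube (hΓ : Γ.IsAdmissible κ) (hreg : Γ.TubeRegular ε₀) (hε : ε ≤ ε₀) :
    MeasurableSet (Γ.tube ε) := by
  rw [← hΓ.image_normalMap]
  exact (Γ.measurableSet_tubeCoord ε).image_of_continuousOn_injOn
    hΓ.continuous_normalMap.continuousOn (hΓ.injOn_normalMap hreg hε)

/-- The derivative of the normal coordinates. -/
lemma hasFDerivAt_normalMapCoord (hΓ : Γ.IsAdmissible κ) {p : ℝ × ℝ} (hp : p.1 ∈ Γ.domain) :
    HasFDerivAt Γ.normalMapCoord (Matrix.toLin (.finTwoProd ℝ) (.finTwoProd ℝ)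
      !![(1 + p.2 * Γ.curvature p.1) * deriv Γ.param p.1 0, deriv Γ.param p.1 1;
        (1 + p.2 * Γ.curvature p.1) * deriv Γ.param p.1 1,
          -deriv Γ.param p.1 0]).toContinuousLinearMap p := by
  rw [Matrix.toLin_finTwoProd_toContinuousLinearMap]
  have f1 : HasFDerivAt (fun p : ℝ × ℝ => p.1) (ContinuousLinearMap.fst ℝ ℝ ℝ) p := hasFDerivAt_fst
  have f2 : HasFDerivAt (fun p : ℝ × ℝ => p.2) (ContinuousLinearMap.snd ℝ ℝ ℝ) p := hasFDerivAt_snd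
  have h0 := (hasDerivAt_coord (hΓ.hasDerivAt_param p.1) 0).comp_hasFDerivAt p f1
  have h1 := (hasDerivAt_coord (hΓ.hasDerivAt_param p.1) 1).comp_hasFDerivAt p f1
  have k0 := (hasDerivAt_coord (hΓ.hasDerivAt_deriv p.1) 0).comp_hasFDerivAt p f1
  have k1 := (hasDerivAt_coord (hΓ.hasDerivAt_deriv p.1) 1).comp_hasFDerivAt p f1
  refine ((h0.add (f2.mul k1)).prodMk (h1.sub (f2.mul k0))).congr_fderiv ?_
  rw [hΓ.deriv_deriv_zero hp, hΓ.deriv_deriv_one hp]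
  ext <;> simp <;> ring

/-- Change of variables: the normal coordinates are injective on the regular tube and their
determinant is `-(1 + u c)`, of constant sign by regularity. -/
lemma integral_tube (hΓ : Γ.IsAdmissible κ) (hreg : Γ.TubeRegular ε₀) (hε : ε ≤ ε₀)
    (G : Plane → ℂ) :
    ∫ x in Γ.tube ε, G x =
      ∫ p in Γ.tubeCoord ε, (1 + p.2 * Γ.curvature p.1) • G (Γ.normalMap p) := by
  have e1 : Γ.tube ε = planeCoord ⁻¹' (Γ.normalMapCoord '' Γ.tubeCoord ε) := by
    have : Γ.normalMapCoord = planeCoord ∘ Γ.normalMap := funext fun p =>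
      (Γ.planeCoord_normalMap p).symm
    rw [this, image_comp, preimage_image_eq _ planeCoord.injective, hΓ.image_normalMap]
  have inj : InjOn Γ.normalMapCoord (Γ.tubeCoord ε) := fun p hp q hq h => by
    rw [← planeCoord_normalMap, ← planeCoord_normalMap] at h
    exact hΓ.injOn_normalMap hreg hε hp hq (planeCoord.injective h)
  have e2 := measurePreserving_planeCoord.setIntegral_preimage_emb planeCoord.measurableEmbedding
    (fun z => G (planeCoord.symm z)) (Γ.normalMapCoord '' Γ.tubeCoord ε)
  simp only [MeasurableEquiv.symm_apply_apply] at e2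
  rw [e1, e2, integral_image_eq_integral_abs_det_fderiv_smul volume (Γ.measurableSet_tubeCoord ε)
    (fun p hp => (hΓ.hasFDerivAt_normalMapCoord
      (Icc_subset_domain Γ hp.1.1)).hasFDerivWithinAt) inj]
  refine setIntegral_congr_fun (Γ.measurableSet_tubeCoord ε) fun p hp => ?_
  beta_reduce
  rw [← planeCoord_normalMap, MeasurableEquiv.symm_apply_apply]
  congr 1
  have hpos := hreg.2 p.1 hp.1.1 p.2 (Icc_subset_Icc (neg_le_neg hε) hε hp.2)
  refine Eq.trans ?_ (abs_of_pos hpos)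
  rw [← abs_neg (1 + _)]
  simp only [LinearMap.det_toContinuousLinearMap, LinearMap.det_toLin, Matrix.det_fin_two_of]
  congr 1
  linear_combination (-(1 + p.2 * Γ.curvature p.1)) *
    hΓ.sq_add_sq (Icc_subset_domain Γ hp.1.1)

end IsAdmissible

end PlaneCurve

/-! ### Fourier transform and rigid motions of the integrand -/

namespace PlaneCurve

/-- The integrand in normal coordinates. -/
def coordIntegrand (Γ : PlaneCurve) (F : Plane → ℝ) (θ : ℝ → ℝ) (ε : ℝ) (p : ℝ × ℝ) : ℝ :=
  F (Γ.param p.1) * (ε⁻¹ * θ (ε⁻¹ * p.2)) * (1 + p.2 * Γ.curvature p.1)⁻¹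

namespace IsAdmissible

variable {Γ : PlaneCurve} {κ ε₀ ε : ℝ} {f F : Plane → ℝ} {θ : ℝ → ℝ}

lemma integrand_normalMap (hΓ : Γ.IsAdmissible κ) (hreg : Γ.TubeRegular ε₀) (hε : ε ≤ ε₀)
    (hf : EqOn f F Γ.trace) (θ : ℝ → ℝ) {p : ℝ × ℝ} (hp : p ∈ Γ.tubeCoord ε) :
    Γ.integrand f θ ε (Γ.normalMap p) = Γ.coordIntegrand F θ ε p := by
  rw [normalMap, hΓ.integrand_eq hreg hp.1.1 (Icc_subset_Icc (neg_le_neg hε) hε hp.2),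
    hf ⟨p.1, hp.1.1, rfl⟩]
  rfl

lemma measurable_coordIntegrand (hΓ : Γ.IsAdmissible κ) (hF : Continuous F) (hθ : Measurable θ) :
    Measurable (Γ.coordIntegrand F θ ε) := by
  have h1 := hΓ.continuous_param
  have h2 := hΓ.continuous_curvature
  unfold coordIntegrand
  refine Measurable.mul (Measurable.mul ?_ ?_) (Measurable.inv ?_)
  · exact (hF.comp (h1.comp continuous_fst)).measurable
  · exact (hθ.comp (measurable_snd.const_mul _)).const_mul _
  · exact (by fun_prop : Continuous fun p : ℝ × ℝ => 1 + p.2 * Γ.curvature p.1).measurable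

lemma exists_bound_coordIntegrand (hΓ : Γ.IsAdmissible κ) (hreg : Γ.TubeRegular ε₀) (hε : 0 < ε)
    (hε' : ε ≤ ε₀) (hF : Continuous F) (hθ : PiecewiseC1 θ) :
    ∃ M, ∀ p ∈ Γ.tubeCoord ε, |Γ.coordIntegrand F θ ε p| ≤ M := by
  have h1 := hΓ.continuous_param
  have h2 := hΓ.continuous_curvature
  obtain ⟨B, hB⟩ := hθ.exists_bound (show (-1 : ℝ) ≤ 1 by norm_num)
  have hc : ContinuousOn (fun p : ℝ × ℝ => F (Γ.param p.1) * (1 + p.2 * Γ.curvature p.1)⁻¹)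
      (Icc 0 Γ.len ×ˢ Icc (-ε) ε) := by
    refine ContinuousOn.mul (by fun_prop) (ContinuousOn.inv₀ (by fun_prop) fun p hp => ?_)
    exact (hreg.2 p.1 hp.1 p.2 (Icc_subset_Icc (neg_le_neg hε') hε' hp.2)).ne'
  obtain ⟨C, hC⟩ := (isCompact_Icc.prod isCompact_Icc).exists_bound_of_continuousOn hc
  refine ⟨C * (ε⁻¹ * B), fun p hp => ?_⟩
  have hθp : |θ (ε⁻¹ * p.2)| ≤ B := by
    refine hB _ (abs_le.1 ?_)
    rw [abs_mul, abs_of_pos (inv_pos.2 hε), inv_mul_le_iff₀ hε, mul_one]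
    exact abs_le.2 hp.2
  have hCp := hC p ⟨hp.1.1, hp.2⟩
  have e : Γ.coordIntegrand F θ ε p =
      (F (Γ.param p.1) * (1 + p.2 * Γ.curvature p.1)⁻¹) * (ε⁻¹ * θ (ε⁻¹ * p.2)) := by
    unfold coordIntegrand; ring
  rw [e, abs_mul, abs_mul ε⁻¹, abs_of_pos (inv_pos.2 hε)]
  have hC0 : 0 ≤ C := (norm_nonneg _).trans hCp
  rw [Real.norm_eq_abs] at hCp
  gcongr

/-- The projection is defined through a choice, so measurability is not visible in the definition.
In normal coordinates the integrand is explicit, and the coordinate map is a measurable embedding,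
being continuous and injective on a Borel set. -/
lemma extendedIntegrand_eq_extend (hΓ : Γ.IsAdmissible κ) (hreg : Γ.TubeRegular ε₀) (hε : ε ≤ ε₀)
    (hf : EqOn f F Γ.trace) (θ : ℝ → ℝ) :
    Γ.extendedIntegrand f θ ε = Function.extend ((Γ.tubeCoord ε).domRestrict Γ.normalMap)
      (fun p => Γ.coordIntegrand F θ ε p.1) 0 := by
  have hinj : Function.Injective ((Γ.tubeCoord ε).domRestrict Γ.normalMap) :=
    injOn_iff_injective.1 (hΓ.injOn_normalMap hreg hε)
  ext x
  by_cases hx : x ∈ Γ.tube ε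
  · rw [extendedIntegrand, indicator_of_mem hx]
    rw [← hΓ.image_normalMap] at hx
    obtain ⟨p, hp, rfl⟩ := hx
    rw [hΓ.integrand_normalMap hreg hε hf θ hp]
    exact (hinj.extend_apply (fun p => Γ.coordIntegrand F θ ε p.1) 0 ⟨p, hp⟩).symm
  · rw [extendedIntegrand, indicator_of_notMem hx, Function.extend_apply']
    · rfl
    · rintro ⟨⟨p, hp⟩, rfl⟩
      exact hx (hΓ.image_normalMap ε ▸ ⟨p, hp, rfl⟩)

lemma measurable_extendedIntegrand (hΓ : Γ.IsAdmissible κ) (hreg : Γ.TubeRegular ε₀)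
    (hε : ε ≤ ε₀) (hf : EqOn f F Γ.trace) (hF : Continuous F) (hθ : Measurable θ) :
    Measurable (Γ.extendedIntegrand f θ ε) := by
  rw [hΓ.extendedIntegrand_eq_extend hreg hε hf]
  exact (hΓ.continuous_normalMap.continuousOn.measurableEmbedding (Γ.measurableSet_tubeCoord ε)
    (hΓ.injOn_normalMap hreg hε)).measurable_extend
      ((hΓ.measurable_coordIntegrand hF hθ).comp measurable_subtype_coe) measurable_const

lemma exists_bound_extendedIntegrand (hΓ : Γ.IsAdmissible κ) (hreg : Γ.TubeRegular ε₀)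
    (hε : 0 < ε) (hε' : ε ≤ ε₀) (hf : EqOn f F Γ.trace) (hF : Continuous F) (hθ : PiecewiseC1 θ) :
    ∃ M, ∀ x, |Γ.extendedIntegrand f θ ε x| ≤ M := by
  obtain ⟨M, hM⟩ := hΓ.exists_bound_coordIntegrand hreg hε hε' hF hθ
  refine ⟨max M 0, fun x => ?_⟩
  by_cases hx : x ∈ Γ.tube ε
  · rw [extendedIntegrand, indicator_of_mem hx]
    rw [← hΓ.image_normalMap] at hx
    obtain ⟨p, hp, rfl⟩ := hx
    rw [hΓ.integrand_normalMap hreg hε' hf θ hp]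
    exact (hM p hp).trans (le_max_left _ _)
  · rw [extendedIntegrand, indicator_of_notMem hx, abs_zero]
    exact le_max_right _ _

lemma exists_radius_extendedIntegrand (hΓ : Γ.IsAdmissible κ) (f : Plane → ℝ) (θ : ℝ → ℝ) (ε : ℝ) :
    ∃ ρ, ∀ x, ρ < ‖x‖ → Γ.extendedIntegrand f θ ε x = 0 := by
  obtain ⟨C, hC⟩ := (isCompact_Icc (a := 0) (b := Γ.len) |>.prod (isCompact_Icc (a := -ε)
    (b := ε))).exists_bound_of_continuousOn hΓ.continuous_normalMap.continuousOn
  refine ⟨C, fun x hx => indicator_of_notMem (fun hx' => ?_) _⟩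
  obtain ⟨t, ht, u, hu, rfl⟩ := hx'
  exact absurd (hC (t, u) ⟨ht, hu⟩) (not_le.2 hx)

/-- The normal coordinates of a regular tube. -/
def toNormalStrip (hΓ : Γ.IsAdmissible κ) (hreg : Γ.TubeRegular ε₀) (hε₀ : 0 < ε₀)
    (hF : ContDiff ℝ 1 F) {S : Set ℝ} (hS : S.Countable)
    (hd : ∀ t ∈ Ioo 0 Γ.len \ S, DifferentiableAt ℝ Γ.curvature t)
    (hi : IntervalIntegrable (deriv Γ.curvature) volume 0 Γ.len) : NormalStrip where
  X t := Γ.param t 0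
  Y t := Γ.param t 1
  p t := deriv Γ.param t 0
  q t := deriv Γ.param t 1
  c := Γ.curvature
  c' := deriv Γ.curvature
  F t := F (Γ.param t)
  F' := deriv fun t => F (Γ.param t)
  len := Γ.len
  width := ε₀
  S := S
  len_pos := hΓ.len_pos
  width_pos := hε₀
  cont_X := by have := hΓ.continuous_param; fun_prop
  cont_Y := by have := hΓ.continuous_param; fun_prop
  cont_p := by have := hΓ.continuous_deriv; fun_prop
  cont_q := by have := hΓ.continuous_deriv; fun_prop
  cont_c := hΓ.continuous_curvature
  cont_F := hF.continuous.comp hΓ.continuous_param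
  cont_F' := (hF.comp (hΓ.contDiff_two.of_le (by norm_num))).continuous_deriv le_rfl
  deriv_X t _ := hasDerivAt_coord (hΓ.hasDerivAt_param t) 0
  deriv_Y t _ := hasDerivAt_coord (hΓ.hasDerivAt_param t) 1
  deriv_p t ht := (hasDerivAt_coord (hΓ.hasDerivAt_deriv t) 0).congr_deriv
    (hΓ.deriv_deriv_zero (Icc_subset_domain Γ ht))
  deriv_q t ht := (hasDerivAt_coord (hΓ.hasDerivAt_deriv t) 1).congr_deriv
    (hΓ.deriv_deriv_one (Icc_subset_domain Γ ht))
  deriv_F t _ := ((hF.comp (hΓ.contDiff_two.of_le (by norm_num))).differentiable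
    (by norm_num) t).hasDerivAt
  unit t ht := hΓ.sq_add_sq (Icc_subset_domain Γ ht)
  countable := hS
  deriv_c t ht := (hd t ht).hasDerivAt
  int_c' := hi
  regular := hreg.2

/-- The Fourier transform of the integrand as an oscillatory integral in normal coordinates. -/
theorem polarFourier_extendedIntegrand (hΓ : Γ.IsAdmissible κ) (hreg : Γ.TubeRegular ε₀)
    (hε₀ : 0 < ε₀) (hε : 0 < ε) (hε' : ε ≤ ε₀) (hf : EqOn f F Γ.trace) (hF : ContDiff ℝ 1 F)
    (hθ : PiecewiseC1 θ) {S : Set ℝ} (hS : S.Countable)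
    (hd : ∀ t ∈ Ioo 0 Γ.len \ S, DifferentiableAt ℝ Γ.curvature t)
    (hi : IntervalIntegrable (deriv Γ.curvature) volume 0 Γ.len) (R φ : ℝ) :
    polarFourier (Γ.extendedIntegrand f θ ε) R φ =
      (hΓ.toNormalStrip hreg hε₀ hF hS hd hi).weightInt θ ε R (-1) 1 φ := by
  set A := hΓ.toNormalStrip hreg hε₀ hF hS hd hi with hA
  have e1 : polarFourier (Γ.extendedIntegrand f θ ε) R φ = ∫ x in Γ.tube ε,
      (Γ.integrand f θ ε x : ℂ) * osc (R * (Real.cos φ * x 0 + Real.sin φ * x 1)) := by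
    rw [← integral_indicator (hΓ.measurableSet_tube hreg hε')]
    unfold polarFourier extendedIntegrand
    congr 1; ext x
    by_cases hx : x ∈ Γ.tube ε
    · rw [indicator_of_mem hx, indicator_of_mem hx]
    · rw [indicator_of_notMem hx, indicator_of_notMem hx, Complex.ofReal_zero, zero_mul]
  -- The area element has cancelled the Jacobian factor: neither is left in `W`.
  set W : ℝ × ℝ → ℂ := fun p => ((ε⁻¹ * θ (ε⁻¹ * p.2) : ℝ) : ℂ) *
    ((A.F p.1 : ℂ) * osc (R * A.phase p.2 p.1 φ)) with hW
  have e2 : polarFourier (Γ.extendedIntegrand f θ ε) R φ = ∫ p in Γ.tubeCoord ε, W p := by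
    rw [e1, hΓ.integral_tube hreg hε']
    refine setIntegral_congr_fun (Γ.measurableSet_tubeCoord ε) fun p hp => ?_
    beta_reduce
    have hpos := hreg.2 p.1 hp.1.1 p.2 (Icc_subset_Icc (neg_le_neg hε') hε' hp.2)
    rw [hΓ.integrand_normalMap hreg hε' hf θ hp, normalMap_zero, normalMap_one, Complex.real_smul,
      ← mul_assoc, ← Complex.ofReal_mul, hW]
    beta_reduce
    rw [← mul_assoc, ← Complex.ofReal_mul]
    congr 2
    unfold coordIntegrand
    rw [show A.F p.1 = F (Γ.param p.1) from rfl]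
    field_simp
  have hbound : ∃ M, ∀ p ∈ Γ.tubeCoord ε, ‖W p‖ ≤ M := by
    obtain ⟨B, hB⟩ := hθ.exists_bound (show (-1 : ℝ) ≤ 1 by norm_num)
    obtain ⟨C, hC⟩ := (isCompact_Icc (a := 0) (b := Γ.len)).exists_bound_of_continuousOn
      A.cont_F.continuousOn
    refine ⟨(ε⁻¹ * B) * C, fun p hp => ?_⟩
    have hθp : |θ (ε⁻¹ * p.2)| ≤ B := by
      refine hB _ (abs_le.1 ?_)
      rw [abs_mul, abs_of_pos (inv_pos.2 hε), inv_mul_le_iff₀ hε, mul_one]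
      exact abs_le.2 hp.2
    have hCp := hC p.1 hp.1.1
    rw [hW]
    beta_reduce
    rw [norm_mul, norm_mul, norm_osc, mul_one, Complex.norm_real, Complex.norm_real, norm_mul,
      Real.norm_eq_abs, Real.norm_eq_abs, abs_of_pos (inv_pos.2 hε)]
    have hB0 : 0 ≤ B := (abs_nonneg _).trans hθp
    gcongr
  have hWm : Measurable W := by
    have h1 := A.cont_F
    have h2 : Continuous fun p : ℝ × ℝ => osc (R * A.phase p.2 p.1 φ) := by
      have := A.cont_X
      have := A.cont_Y
      have := A.cont_p
      have := A.cont_q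
      refine continuous_osc.comp ?_
      unfold NormalStrip.phase
      fun_prop
    refine Measurable.mul ?_ (Measurable.mul ?_ h2.measurable)
    · exact Complex.measurable_ofReal.comp
        ((hθ.measurable.comp (measurable_snd.const_mul _)).const_mul _)
    · exact Complex.measurable_ofReal.comp (h1.measurable.comp measurable_fst)
  have hfd : volume Γ.fundamentalDomain < ⊤ :=
    (measure_mono fun t ht => ht.1).trans_lt (measure_Icc_lt_top (a := 0) (b := Γ.len))
  have hWi : IntegrableOn W (Γ.tubeCoord ε) := by
    obtain ⟨M, hM⟩ := hbound
    refine Measure.integrableOn_of_bounded (M := M) ?_ hWm.aestronglyMeasurable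
      ((ae_restrict_mem (Γ.measurableSet_tubeCoord ε)).mono hM)
    rw [tubeCoord, Measure.volume_eq_prod, Measure.prod_prod]
    exact ENNReal.mul_ne_top hfd.ne measure_Icc_lt_top.ne
  have inner : ∀ u, ∫ t in Γ.fundamentalDomain, W (t, u) =
      ((ε⁻¹ * θ (ε⁻¹ * u) : ℝ) : ℂ) * A.curveInt R 0 A.len u φ := fun u => by
    rw [setIntegral_congr_set Γ.fundamentalDomain_ae_eq, NormalStrip.curveInt,
      intervalIntegral.integral_of_le A.len_pos.le]
    rw [← integral_const_mul]
    rfl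
  rw [e2, tubeCoord, Measure.volume_eq_prod, ← Measure.prod_restrict]
  rw [tubeCoord, IntegrableOn, Measure.volume_eq_prod, ← Measure.prod_restrict] at hWi
  rw [integral_prod_symm _ hWi]
  simp only [inner]
  rw [integral_Icc_eq_integral_Ioc, ← intervalIntegral.integral_of_le (by linarith)]
  -- The substitution `u = ε s` maps `[-1, 1]` onto the strip and absorbs the factor `ε⁻¹` of the
  -- scaled weight.
  have h3 := intervalIntegral.integral_comp_mul_left (a := -1) (b := 1)
    (fun u => ((θ (ε⁻¹ * u) : ℝ) : ℂ) * A.curveInt R 0 A.len u φ) hε.ne'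
  rw [NormalStrip.weightInt]
  have h4 : ∀ s, ε⁻¹ * (ε * s) = s := fun s => by field_simp
  simp only [h4, mul_neg, mul_one] at h3
  rw [h3, ← intervalIntegral.integral_smul]
  congr 1; ext u
  rw [Complex.real_smul]
  push_cast
  ring

/-- The integral of the extended integrand is the line integral. -/
lemma integral_extendedIntegrand (hΓ : Γ.IsAdmissible κ) (hreg : Γ.TubeRegular ε₀)
    (hε₀ : 0 < ε₀) (hε : 0 < ε) (hε' : ε ≤ ε₀) (hf : EqOn f F Γ.trace) (hF : ContDiff ℝ 1 F)
    (hθ : PiecewiseC1 θ) (hθ1 : ∫ s in (-1 : ℝ)..1, θ s = 1) {S : Set ℝ} (hS : S.Countable)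
    (hd : ∀ t ∈ Ioo 0 Γ.len \ S, DifferentiableAt ℝ Γ.curvature t)
    (hi : IntervalIntegrable (deriv Γ.curvature) volume 0 Γ.len) :
    ∫ x, Γ.extendedIntegrand f θ ε x = ∫ t in (0 : ℝ)..Γ.len, f (Γ.param t) := by
  -- At frequency zero the Fourier transform is the integral itself, and its expression in normal
  -- coordinates factors into `∫ θ = 1` and the line integral.
  have h := hΓ.polarFourier_extendedIntegrand hreg hε₀ hε hε' hf hF hθ hS hd hi 0 0
  have osc0 : osc 0 = 1 := by simp [osc]
  unfold polarFourier NormalStrip.weightInt NormalStrip.curveInt at h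
  simp only [zero_mul, osc0, mul_one] at h
  rw [intervalIntegral.integral_mul_const, integral_complex_ofReal, intervalIntegral.integral_ofReal,
    intervalIntegral.integral_ofReal, hθ1, Complex.ofReal_one, one_mul] at h
  rw [Complex.ofReal_injective h]
  refine intervalIntegral.integral_congr fun t ht => ?_
  have ht' : t ∈ uIcc 0 Γ.len := ht
  rw [uIcc_of_le hΓ.len_pos.le] at ht'
  exact (hf ⟨t, ht', rfl⟩).symm

section Move

variable (φ : ℝ) (v : Plane)

lemma deriv_move (hΓ : Γ.IsAdmissible κ) :
    deriv (Γ.move φ v).param = fun t => planeRotation φ (deriv Γ.param t) := by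
  ext1 t
  exact (((rotationIsometry φ).toContinuousLinearEquiv.toContinuousLinearMap.hasFDerivAt.comp_hasDerivAt
    t (hΓ.hasDerivAt_param t)).add_const v).deriv

lemma deriv_deriv_move (hΓ : Γ.IsAdmissible κ) :
    deriv (deriv (Γ.move φ v).param) = fun t => planeRotation φ (deriv (deriv Γ.param) t) := by
  rw [hΓ.deriv_move]
  ext1 t
  exact ((rotationIsometry φ).toContinuousLinearEquiv.toContinuousLinearMap.hasFDerivAt.comp_hasDerivAt
    t (hΓ.hasDerivAt_deriv t)).deriv

lemma normal_move (hΓ : Γ.IsAdmissible κ) (t : ℝ) :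
    (Γ.move φ v).normal t = planeRotation φ (Γ.normal t) := by
  unfold normal
  rw [hΓ.deriv_move]
  ext i
  fin_cases i <;> simp [planeRotation] <;> ring

lemma curvature_move (hΓ : Γ.IsAdmissible κ) (t : ℝ) :
    (Γ.move φ v).curvature t = Γ.curvature t := by
  unfold curvature
  rw [hΓ.deriv_deriv_move, hΓ.deriv_move]
  simp only [planeRotation, PiLp.toLp_apply, Matrix.cons_val_zero, Matrix.cons_val_one]
  linear_combination (deriv Γ.param t 0 * deriv (deriv Γ.param) t 1 -
    deriv Γ.param t 1 * deriv (deriv Γ.param) t 0) * Real.cos_sq_add_sin_sq φ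

lemma sub_move_param (x : Plane) (t : ℝ) : x - (Γ.move φ v).param t =
    planeRotation φ (planeRotation (-φ) (x - v) - Γ.param t) := by
  have := map_sub (rotationIsometry φ) (planeRotation (-φ) (x - v)) (Γ.param t)
  rw [coe_rotationIsometry, planeRotation_apply_neg] at this
  rw [this]
  change x - (planeRotation φ (Γ.param t) + v) = _
  abel

lemma projParam_move (x : Plane) :
    (Γ.move φ v).projParam x = Γ.projParam (planeRotation (-φ) (x - v)) := by
  have hd : ∀ t, dist x ((Γ.move φ v).param t) =
      dist (planeRotation (-φ) (x - v)) (Γ.param t) := fun t => by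
    rw [dist_eq_norm, dist_eq_norm, sub_move_param, norm_planeRotation]
  unfold projParam
  simp only [hd]
  rfl

lemma signedDist_move (hΓ : Γ.IsAdmissible κ) (x : Plane) :
    (Γ.move φ v).signedDist x = Γ.signedDist (planeRotation (-φ) (x - v)) := by
  unfold signedDist proj
  rw [projParam_move, sub_move_param, hΓ.normal_move]
  exact (rotationIsometry φ).inner_map_map _ _

lemma integrand_move (hΓ : Γ.IsAdmissible κ) (f : Plane → ℝ) (θ : ℝ → ℝ) (ε : ℝ) (x : Plane) :
    (Γ.move φ v).integrand (fun y => f (planeRotation (-φ) (y - v))) θ ε x =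
      Γ.integrand f θ ε (planeRotation (-φ) (x - v)) := by
  unfold integrand jacobian levelCurvature
  rw [hΓ.signedDist_move, projParam_move, hΓ.curvature_move]
  congr 3
  unfold proj
  rw [projParam_move]
  beta_reduce
  congr 1
  change planeRotation (-φ) (planeRotation φ (Γ.param _) + v - v) = _
  rw [add_sub_cancel_right, planeRotation_neg_apply]

lemma mem_tube_move (hΓ : Γ.IsAdmissible κ) (ε : ℝ) (x : Plane) :
    x ∈ (Γ.move φ v).tube ε ↔ planeRotation (-φ) (x - v) ∈ Γ.tube ε := by
  have key : ∀ t u : ℝ, x = (Γ.move φ v).param t + u • (Γ.move φ v).normal t ↔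
      planeRotation (-φ) (x - v) = Γ.param t + u • Γ.normal t := fun t u => by
    rw [hΓ.normal_move]
    have h1 : planeRotation φ (Γ.param t + u • Γ.normal t) =
        planeRotation φ (Γ.param t) + u • planeRotation φ (Γ.normal t) := by
      rw [← coe_rotationIsometry, map_add, map_smul]
    constructor
    · intro h
      have : x - v = planeRotation φ (Γ.param t + u • Γ.normal t) := by
        rw [h, h1]
        change planeRotation φ (Γ.param t) + v + _ - v = _
        abel
      rw [this, planeRotation_neg_apply]
    · intro h
      have h2 := congrArg (planeRotation φ) h
      rw [planeRotation_apply_neg, h1] at h2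
      change x = planeRotation φ (Γ.param t) + v + _
      rw [← sub_add_cancel x v, h2]
      abel
  constructor
  · rintro ⟨t, ht, u, hu, h⟩
    exact ⟨t, ht, u, hu, (key t u).1 h⟩
  · rintro ⟨t, ht, u, hu, h⟩
    exact ⟨t, ht, u, hu, (key t u).2 h⟩

lemma extendedIntegrand_move (hΓ : Γ.IsAdmissible κ) (f : Plane → ℝ) (θ : ℝ → ℝ) (ε : ℝ)
    (x : Plane) :
    ((Γ.move φ v).tube ε).indicator
      ((Γ.move φ v).integrand (fun y => f (planeRotation (-φ) (y - v))) θ ε) x =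
      Γ.extendedIntegrand f θ ε (planeRotation (-φ) (x - v)) := by
  unfold extendedIntegrand
  by_cases hx : x ∈ (Γ.move φ v).tube ε
  · rw [indicator_of_mem hx, indicator_of_mem ((hΓ.mem_tube_move φ v ε x).1 hx), hΓ.integrand_move]
  · rw [indicator_of_notMem hx,
      indicator_of_notMem fun h => hx ((hΓ.mem_tube_move φ v ε x).2 h)]

end Move

end IsAdmissible

end PlaneCurve

/-! ### The derivative of the curvature is integrable -/

lemma intervalIntegrable_of_abs_le {f g : ℝ → ℝ} {a b : ℝ} (hab : a ≤ b) (hf : Measurable f)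
    (hg : IntervalIntegrable g volume a b) (h : ∀ t ∈ Ioo a b, |f t| ≤ g t) :
    IntervalIntegrable f volume a b := by
  rw [intervalIntegrable_iff_integrableOn_Ioo_of_le hab] at hg ⊢
  exact Integrable.mono' hg hf.aestronglyMeasurable ((ae_restrict_mem measurableSet_Ioo).mono h)

/-- A power times a smooth function has the expected singularities at the origin. -/
lemma exists_deriv_bounds_rpow_mul {k : ℝ → ℝ} {r : ℝ} (β : ℝ) (hr : 0 < r)
    (hk : ContDiffOn ℝ 3 k (Ioo (-r) r)) : ∃ (G₁ G₂ G₃ : ℝ → ℝ) (ρ C : ℝ), 0 < ρ ∧ 0 ≤ C ∧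
      ∀ w ∈ Ioo 0 ρ, HasDerivAt (fun w => w ^ β * k w) (G₁ w) w ∧ HasDerivAt G₁ (G₂ w) w ∧
        HasDerivAt G₂ (G₃ w) w ∧ |G₂ w| ≤ C * w ^ (β - 3) ∧ |G₃ w| ≤ C * w ^ (β - 3) := by
  have hk1 : ContDiffOn ℝ 2 (deriv k) (Ioo (-r) r) := hk.deriv_of_isOpen isOpen_Ioo (by norm_num)
  have hk2 : ContDiffOn ℝ 1 (deriv (deriv k)) (Ioo (-r) r) :=
    hk1.deriv_of_isOpen isOpen_Ioo (by norm_num)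
  have hk3 : ContDiffOn ℝ 0 (deriv (deriv (deriv k))) (Ioo (-r) r) :=
    hk2.deriv_of_isOpen isOpen_Ioo (by norm_num)
  have der : ∀ {f : ℝ → ℝ} {n : WithTop ℕ∞}, ContDiffOn ℝ n f (Ioo (-r) r) → n ≠ 0 →
      ∀ w ∈ Ioo 0 (min (r / 2) 1), HasDerivAt f (deriv f w) w := fun hf hn w hw =>
    ((hf.differentiableOn hn).differentiableAt (isOpen_Ioo.mem_nhds
      ⟨by linarith [hw.1], by linarith [hw.2, min_le_left (r / 2) 1]⟩)).hasDerivAt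
  have bd : ∀ {f : ℝ → ℝ}, ContinuousOn f (Ioo (-r) r) →
      ∃ M, 0 ≤ M ∧ ∀ w ∈ Ioo 0 (min (r / 2) 1), |f w| ≤ M := fun hf => by
    obtain ⟨M, hM⟩ := (isCompact_Icc (a := 0) (b := r / 2)).exists_bound_of_continuousOn
      (hf.mono fun w hw => ⟨by linarith [hw.1], by linarith [hw.2]⟩)
    exact ⟨M, (norm_nonneg _).trans (hM 0 ⟨le_rfl, by linarith⟩), fun w hw =>
      hM w ⟨hw.1.le, hw.2.le.trans (min_le_left _ _)⟩⟩
  obtain ⟨M₀, p0, hM₀⟩ := bd hk.continuousOn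
  obtain ⟨M₁, p1, hM₁⟩ := bd hk1.continuousOn
  obtain ⟨M₂, p2, hM₂⟩ := bd hk2.continuousOn
  obtain ⟨M₃, p3, hM₃⟩ := bd hk3.continuousOn
  set k₁ := deriv k
  set k₂ := deriv k₁
  set k₃ := deriv k₂
  refine ⟨fun w => β * w ^ (β - 1) * k w + w ^ β * k₁ w,
    fun w => β * (β - 1) * w ^ (β - 2) * k w + 2 * β * w ^ (β - 1) * k₁ w + w ^ β * k₂ w,
    fun w => β * (β - 1) * (β - 2) * w ^ (β - 3) * k w + 3 * β * (β - 1) * w ^ (β - 2) * k₁ w +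
      3 * β * w ^ (β - 1) * k₂ w + w ^ β * k₃ w, min (r / 2) 1,
    |β * (β - 1)| * M₀ + |2 * β| * M₁ + M₂ + (|β * (β - 1) * (β - 2)| * M₀ +
      |3 * β * (β - 1)| * M₁ + |3 * β| * M₂ + M₃), by positivity, by positivity, fun w hw => ?_⟩
  have w0 : 0 < w := hw.1
  have pw : ∀ γ δ : ℝ, δ = γ - 1 → HasDerivAt (fun w : ℝ => w ^ γ) (γ * w ^ δ) w := fun γ δ h => by
    rw [h]; exact Real.hasDerivAt_rpow_const (Or.inl w0.ne')
  have d0 := der hk (by norm_num) w hw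
  have d1 := der hk1 (by norm_num) w hw
  have d2 := der hk2 (by norm_num) w hw
  have q0 := pw β (β - 1) rfl
  have q1 := pw (β - 1) (β - 2) (by ring)
  have q2 := pw (β - 2) (β - 3) (by ring)
  -- Since `w < 1`, the most singular power dominates all others.
  have le : ∀ γ, β - 3 ≤ γ → w ^ γ ≤ w ^ (β - 3) := fun γ h =>
    Real.rpow_le_rpow_of_exponent_ge w0 (hw.2.le.trans (min_le_right _ _)) h
  have term : ∀ (a γ z M : ℝ), β - 3 ≤ γ → |z| ≤ M → |a * w ^ γ * z| ≤ |a| * M * w ^ (β - 3) := by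
    intro a γ z M hγ hz
    rw [abs_mul, abs_mul, abs_of_pos (Real.rpow_pos_of_pos w0 γ)]
    calc |a| * w ^ γ * |z| ≤ |a| * w ^ (β - 3) * M := by
          have := le γ hγ
          gcongr |a| * ?_ * ?_
      _ = _ := by ring
  have term1 : ∀ (γ z M : ℝ), β - 3 ≤ γ → |z| ≤ M → |w ^ γ * z| ≤ M * w ^ (β - 3) := by
    intro γ z M hγ hz
    simpa using term 1 γ z M hγ hz
  have wp : 0 < w ^ (β - 3) := Real.rpow_pos_of_pos w0 _
  have b2 : |β * (β - 1) * w ^ (β - 2) * k w + 2 * β * w ^ (β - 1) * k₁ w + w ^ β * k₂ w| ≤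
      (|β * (β - 1)| * M₀ + |2 * β| * M₁ + M₂) * w ^ (β - 3) := by
    refine (abs_add_three _ _ _).trans ?_
    have t1 := term (β * (β - 1)) (β - 2) (k w) M₀ (by linarith) (hM₀ w hw)
    have t2 := term (2 * β) (β - 1) (k₁ w) M₁ (by linarith) (hM₁ w hw)
    have t3 := term1 β (k₂ w) M₂ (by linarith) (hM₂ w hw)
    linarith
  have b3 : |β * (β - 1) * (β - 2) * w ^ (β - 3) * k w + 3 * β * (β - 1) * w ^ (β - 2) * k₁ w +
      3 * β * w ^ (β - 1) * k₂ w + w ^ β * k₃ w| ≤ (|β * (β - 1) * (β - 2)| * M₀ +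
      |3 * β * (β - 1)| * M₁ + |3 * β| * M₂ + M₃) * w ^ (β - 3) := by
    refine (abs_add_le _ _).trans ((add_le_add (abs_add_three _ _ _) le_rfl).trans ?_)
    have t1 := term (β * (β - 1) * (β - 2)) (β - 3) (k w) M₀ le_rfl (hM₀ w hw)
    have t2 := term (3 * β * (β - 1)) (β - 2) (k₁ w) M₁ (by linarith) (hM₁ w hw)
    have t3 := term (3 * β) (β - 1) (k₂ w) M₂ (by linarith) (hM₂ w hw)
    have t4 := term1 β (k₃ w) M₃ (by linarith) (hM₃ w hw)
    linarith
  refine ⟨(q0.fun_mul d0).congr_deriv (by ring), ?_, ?_, b2.trans ?_, b3.trans ?_⟩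
  · exact (((q1.const_mul β).fun_mul d0).fun_add (q0.fun_mul d1)).congr_deriv (by ring)
  · exact (((((q2.const_mul (β * (β - 1))).fun_mul d0).fun_add
      ((q1.const_mul (2 * β)).fun_mul d1)).fun_add (q0.fun_mul d2))).congr_deriv (by ring)
  · refine mul_le_mul_of_nonneg_right ?_ wp.le
    exact le_add_of_nonneg_right (by positivity)
  · refine mul_le_mul_of_nonneg_right ?_ wp.le
    exact le_add_of_nonneg_left (by positivity)

/-- The derivative of the curvature of a graph in terms of the profile. -/
lemma abs_deriv_curvature_graph_le {W W₁ W₂ y y₁ y₂ c G G₁ G₂ G₃ : ℝ → ℝ} {a b ρ C β B η : ℝ}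
    (hG : ∀ w ∈ Ioo 0 ρ, HasDerivAt G (G₁ w) w ∧ HasDerivAt G₁ (G₂ w) w ∧
        HasDerivAt G₂ (G₃ w) w ∧ |G₂ w| ≤ C * w ^ (β - 3) ∧ |G₃ w| ≤ C * w ^ (β - 3))
    (hW : ∀ t, HasDerivAt W (W₁ t) t) (hW₁ : ∀ t, HasDerivAt W₁ (W₂ t) t)
    (hy : ∀ t, HasDerivAt y (y₁ t) t) (hy₁ : ∀ t, HasDerivAt y₁ (y₂ t) t)
    (hWρ : ∀ t ∈ Ioo a b, W t ∈ Ioo 0 ρ) (hyW : ∀ t ∈ Ioo a b, y t = G (W t))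
    (hc : ∀ t ∈ Ioo a b, c t = η * (W₁ t * y₂ t - y₁ t * W₂ t)) (hη : |η| ≤ 1)
    (h1 : ∀ t ∈ Ioo a b, |W₁ t| ≤ 1) (hB : ∀ t ∈ Ioo a b, |W₂ t| ≤ B)
    {t : ℝ} (ht : t ∈ Ioo a b) : |deriv c t| ≤ (3 * B + 1) * C * W t ^ (β - 3) := by
  have e1 : ∀ s ∈ Ioo a b, y₁ s = G₁ (W s) * W₁ s := fun s hs => by
    refine (hy s).unique (HasDerivAt.congr_of_eventuallyEq ?_
      (mem_of_superset (isOpen_Ioo.mem_nhds hs) hyW))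
    exact (hG _ (hWρ s hs)).1.comp s (hW s)
  have e2 : ∀ s ∈ Ioo a b, y₂ s = G₂ (W s) * W₁ s * W₁ s + G₁ (W s) * W₂ s := fun s hs => by
    refine (hy₁ s).unique (HasDerivAt.congr_of_eventuallyEq ?_
      (mem_of_superset (isOpen_Ioo.mem_nhds hs) e1))
    exact ((hG _ (hWρ s hs)).2.1.comp s (hW s)).fun_mul (hW₁ s)
  -- The terms with `G₁` cancel, so the curvature involves only `G₂` and its derivative only `G₂`
  -- and `G₃`.
  have e3 : ∀ s ∈ Ioo a b, c s = η * (W₁ s ^ 3 * G₂ (W s)) := fun s hs => by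
    rw [hc s hs, e1 s hs, e2 s hs]; ring
  obtain ⟨-, -, g3, g4, g5⟩ := hG _ (hWρ t ht)
  have d : HasDerivAt c (η * (3 * W₁ t ^ 2 * W₂ t * G₂ (W t) + W₁ t ^ 3 * (G₃ (W t) * W₁ t))) t := by
    refine HasDerivAt.congr_of_eventuallyEq ?_ (mem_of_superset (isOpen_Ioo.mem_nhds ht) e3)
    exact ((((hW₁ t).fun_pow 3).fun_mul (g3.comp t (hW t))).const_mul η).congr_deriv
      (by push_cast; simp)
  rw [d.deriv, abs_mul]
  have n1 := h1 t ht
  have n2 := hB t ht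
  have hB0 : 0 ≤ B := (abs_nonneg _).trans n2
  have wp := Real.rpow_nonneg (hWρ t ht).1.le (β - 3)
  have pw : ∀ n : ℕ, |W₁ t| ^ n ≤ 1 := fun n => pow_le_one₀ (abs_nonneg _) n1
  calc |η| * |3 * W₁ t ^ 2 * W₂ t * G₂ (W t) + W₁ t ^ 3 * (G₃ (W t) * W₁ t)|
      ≤ 1 * (3 * |W₁ t| ^ 2 * |W₂ t| * |G₂ (W t)| + |W₁ t| ^ 4 * |G₃ (W t)|) := by
        refine mul_le_mul hη ((abs_add_le _ _).trans (le_of_eq ?_)) (abs_nonneg _) zero_le_one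
        simp only [abs_mul, abs_pow]
        rw [abs_of_pos (by norm_num : (0 : ℝ) < 3)]
        ring
    _ ≤ 1 * (3 * 1 * B * (C * W t ^ (β - 3)) + 1 * (C * W t ^ (β - 3))) := by
        gcongr
        · exact pw 2
        · exact pw 4
    _ = _ := by ring

/-- The exponent satisfies `β - 3 > -1`. The summand 1 serves the case `β ≥ 3`, and the factor `1 /
2` comes from comparing arc length with the abscissa of the graph. -/
lemma intervalIntegrable_singular {β : ℝ} (hβ : 2 < β) (s r : ℝ) :
    IntervalIntegrable (fun t => 1 + ((t - s) / 2) ^ (β - 3)) volume s r ∧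
      IntervalIntegrable (fun t => 1 + ((s - t) / 2) ^ (β - 3)) volume r s := by
  have h : ∀ b, IntervalIntegrable (fun t : ℝ => (t / 2) ^ (β - 3)) volume 0 b := fun b => by
    have := (intervalIntegral.intervalIntegrable_rpow' (a := 0) (b := b / 2)
      (r := β - 3) (by linarith) : IntervalIntegrable (fun t : ℝ => t ^ (β - 3)) volume 0
        (b / 2)).comp_mul_right (c := (2 : ℝ)⁻¹)
    simpa [div_eq_mul_inv] using this
  constructor
  · have := (h (r - s)).comp_sub_right s
    simp only [zero_add, sub_add_cancel] at this
    exact intervalIntegrable_const.add this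
  · have := (h (s - r)).comp_sub_left s
    simp only [sub_zero, sub_sub_cancel] at this
    exact intervalIntegrable_const.add this.symm

namespace PlaneCurve

namespace IsAdmissible

variable {Γ : PlaneCurve} {κ : ℝ}

/-- The derivative of the curvature is integrable along a smooth piece. -/
lemma intervalIntegrable_deriv_curvature_of_contDiffOn {a b : ℝ} (hab : a ≤ b)
    (h : ContDiffOn ℝ 3 Γ.param (Icc a b)) :
    IntervalIntegrable (deriv Γ.curvature) volume a b := by
  rcases hab.eq_or_lt with rfl | hab'
  · exact IntervalIntegrable.refl
  have hu := uniqueDiffOn_Icc hab'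
  set g₁ := derivWithin Γ.param (Icc a b)
  have h1 : ContDiffOn ℝ 2 g₁ (Icc a b) := h.derivWithin hu (by norm_num)
  set g₂ := derivWithin g₁ (Icc a b)
  have h2 : ContDiffOn ℝ 1 g₂ (Icc a b) := h1.derivWithin hu (by norm_num)
  have hco : ∀ {f : ℝ → Plane}, ContDiffOn ℝ 1 f (Icc a b) → ∀ i : Fin 2,
      ContDiffOn ℝ 1 (fun t => f t i) (Icc a b) := fun hf i =>
    (EuclideanSpace.proj (𝕜 := ℝ) i).contDiff.comp_contDiffOn hf
  have h1' : ContDiffOn ℝ 1 g₁ (Icc a b) := h1.of_le (by norm_num)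
  set k : ℝ → ℝ := fun t => g₁ t 0 * g₂ t 1 - g₁ t 1 * g₂ t 0
  have hk : ContDiffOn ℝ 1 k (Icc a b) :=
    ((hco h1' 0).mul (hco h2 1)).sub ((hco h1' 1).mul (hco h2 0))
  have hk' := hk.continuousOn_derivWithin hu le_rfl
  obtain ⟨M, hM⟩ := isCompact_Icc.exists_bound_of_continuousOn hk'
  have e1 : ∀ t ∈ Ioo a b, g₁ t = deriv Γ.param t := fun t ht =>
    derivWithin_of_mem_nhds (Icc_mem_nhds ht.1 ht.2)
  have e2 : ∀ t ∈ Ioo a b, g₂ t = deriv (deriv Γ.param) t := fun t ht => by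
    have : g₁ =ᶠ[𝓝 t] deriv Γ.param := mem_of_superset (isOpen_Ioo.mem_nhds ht) e1
    rw [← this.deriv_eq]
    exact derivWithin_of_mem_nhds (Icc_mem_nhds ht.1 ht.2)
  refine intervalIntegrable_of_abs_le hab (measurable_deriv _)
    (intervalIntegrable_const (c := M)) fun t ht => ?_
  have : k =ᶠ[𝓝 t] Γ.curvature := mem_of_superset (isOpen_Ioo.mem_nhds ht) fun s hs => by
    change g₁ s 0 * g₂ s 1 - g₁ s 1 * g₂ s 0 = Γ.curvature s
    rw [e1 s hs, e2 s hs]; rfl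
  rw [← this.deriv_eq, ← derivWithin_of_mem_nhds (Icc_mem_nhds ht.1 ht.2)]
  exact hM t (Ioo_subset_Icc_self ht)

lemma exists_side_of_curvature_ne_zero (hΓ : Γ.IsAdmissible κ) {s : ℝ} (hs : s ∈ Icc 0 Γ.len)
    (hc : Γ.curvature s ≠ 0) : ∃ δ > 0,
    (∀ r ∈ Ioo s (s + δ), r ≤ Γ.len → IntervalIntegrable (deriv Γ.curvature) volume s r) ∧
    ∀ r ∈ Ioo (s - δ) s, 0 ≤ r → IntervalIntegrable (deriv Γ.curvature) volume r s := by
  have hsd := Icc_subset_domain Γ hs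
  have h1 : ContDiffWithinAt ℝ (3 : ℕ) Γ.param Γ.domain s :=
    contDiffWithinAt_infty.1 (hΓ.smooth s hsd hc) 3
  obtain ⟨U, hU, hsub⟩ := h1.contDiffOn' (m := (3 : ℕ)) le_rfl (by simp)
  rw [insert_eq_of_mem hsd] at hsub
  obtain ⟨δ, δ0, hδ⟩ := Metric.isOpen_iff.1 hU s hsub.1
  have key : ∀ {a b : ℝ}, a ∈ Icc 0 Γ.len → b ∈ Icc 0 Γ.len → |a - s| < δ → |b - s| < δ → a ≤ b →
      IntervalIntegrable (deriv Γ.curvature) volume a b := by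
    intro a b ha hb has hbs hab
    refine intervalIntegrable_deriv_curvature_of_contDiffOn hab (hsub.2.mono fun t ht => ?_)
    refine ⟨Icc_subset_domain Γ ⟨ha.1.trans ht.1, ht.2.trans hb.2⟩, hδ ?_⟩
    rw [Metric.mem_ball, Real.dist_eq]
    rw [abs_lt] at *
    constructor <;> linarith [ht.1, ht.2]
  refine ⟨δ, δ0, fun r hr hrL => ?_, fun r hr hr0 => ?_⟩
  · refine key hs ⟨hs.1.trans hr.1.le, hrL⟩ (by simpa using δ0) ?_ hr.1.le
    rw [abs_lt]; constructor <;> linarith [hr.1, hr.2]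
  · refine key ⟨hr0, hr.2.le.trans hs.2⟩ hs ?_ (by simpa using δ0) hr.2.le
    rw [abs_lt]; constructor <;> linarith [hr.1, hr.2]

/-- Orthonormal frames of the plane in coordinates. -/
lemma frame_coords {e₁ e₂ : Plane} (h1 : ‖e₁‖ = 1) (h2 : ‖e₂‖ = 1) (h : inner ℝ e₁ e₂ = 0) :
    ∃ η : ℝ, η ^ 2 = 1 ∧ e₂ 0 = -(η * e₁ 1) ∧ e₂ 1 = η * e₁ 0 := by
  have n1 : e₁ 0 ^ 2 + e₁ 1 ^ 2 = 1 := by rw [← norm_sq_plane, h1, one_pow]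
  have n2 : e₂ 0 ^ 2 + e₂ 1 ^ 2 = 1 := by rw [← norm_sq_plane, h2, one_pow]
  rw [inner_plane] at h
  refine ⟨e₁ 0 * e₂ 1 - e₁ 1 * e₂ 0, ?_, ?_, ?_⟩
  · linear_combination n1 * (e₂ 0 ^ 2 + e₂ 1 ^ 2) + n2 - (e₁ 0 * e₂ 0 + e₁ 1 * e₂ 1) * h
  · linear_combination (-e₂ 0) * n1 + e₁ 0 * h
  · linear_combination (-e₂ 1) * n1 + e₁ 1 * h

/-- Near a point where the curvature vanishes, the derivative of the curvature has an integrable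
singularity. -/
lemma exists_bound_deriv_curvature_of_flat (hΓ : Γ.IsAdmissible κ) {s β : ℝ}
    (hs : s ∈ Icc 0 Γ.len) (hβ : 2 < β) (hflat : Γ.IsFlatAt β s) : ∃ δ > 0, ∃ K : ℝ,
    (∀ t ∈ Ioo s (s + δ), t < Γ.len → |deriv Γ.curvature t| ≤ K * (1 + ((t - s) / 2) ^ (β - 3))) ∧
    ∀ t ∈ Ioo (s - δ) s, 0 < t → |deriv Γ.curvature t| ≤ K * (1 + ((s - t) / 2) ^ (β - 3)) := by
  obtain ⟨e₁, e₂, n1, n2, horth, r, g, h, hr, hh, -, hg, hev⟩ := hflat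
  obtain ⟨η, hη, c0, c1⟩ := frame_coords n1 n2 horth
  have m1 : e₁ 0 ^ 2 + e₁ 1 ^ 2 = 1 := by rw [← norm_sq_plane, n1, one_pow]
  have hsd := Icc_subset_domain Γ hs
  -- coordinates in the frame
  have hcoord : ∀ e : Plane, ∀ t, HasDerivAt (fun t => inner ℝ (Γ.param t - Γ.param s) e)
      (inner ℝ (deriv Γ.param t) e) t := fun e t => by
    simp only [inner_plane, PiLp.sub_apply]
    exact (((hasDerivAt_coord (hΓ.hasDerivAt_param t) 0).sub_const _).mul_const _).fun_add
      (((hasDerivAt_coord (hΓ.hasDerivAt_param t) 1).sub_const _).mul_const _)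
  have hcoord1 : ∀ e : Plane, ∀ t, HasDerivAt (fun t => inner ℝ (deriv Γ.param t) e)
      (inner ℝ (deriv (deriv Γ.param) t) e) t := fun e t => by
    simp only [inner_plane]
    exact ((hasDerivAt_coord (hΓ.hasDerivAt_deriv t) 0).mul_const _).fun_add
      ((hasDerivAt_coord (hΓ.hasDerivAt_deriv t) 1).mul_const _)
  have hcoord2 : ∀ e : Plane, Continuous fun t => inner ℝ (deriv (deriv Γ.param) t) e := fun e => by
    have := hΓ.continuous_deriv_deriv
    fun_prop
  set x : ℝ → ℝ := fun t => inner ℝ (Γ.param t - Γ.param s) e₁ with hx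
  set y : ℝ → ℝ := fun t => inner ℝ (Γ.param t - Γ.param s) e₂ with hy
  set x₁ : ℝ → ℝ := fun t => inner ℝ (deriv Γ.param t) e₁ with hx₁
  set y₁ : ℝ → ℝ := fun t => inner ℝ (deriv Γ.param t) e₂ with hy₁
  set x₂ : ℝ → ℝ := fun t => inner ℝ (deriv (deriv Γ.param) t) e₁ with hx₂
  set y₂ : ℝ → ℝ := fun t => inner ℝ (deriv (deriv Γ.param) t) e₂ with hy₂
  have xs : x s = 0 := by simp [hx]
  have ys : y s = 0 := by simp [hy]
  have unit : ∀ t ∈ Γ.domain, x₁ t ^ 2 + y₁ t ^ 2 = 1 := fun t ht => by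
    have := hΓ.sq_add_sq ht
    simp only [hx₁, hy₁, inner_plane, c0, c1]
    linear_combination (deriv Γ.param t 0 ^ 2 + deriv Γ.param t 1 ^ 2) * m1 + this +
      (-(deriv Γ.param t 0) * e₁ 1 + deriv Γ.param t 1 * e₁ 0) ^ 2 * hη
  have curv : ∀ t, Γ.curvature t = η * (x₁ t * y₂ t - y₁ t * x₂ t) := fun t => by
    simp only [hx₁, hy₁, hx₂, hy₂, inner_plane, c0, c1, curvature]
    linear_combination (-(deriv Γ.param t 0 * deriv (deriv Γ.param) t 1 -
      deriv Γ.param t 1 * deriv (deriv Γ.param) t 0)) * m1 -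
      (deriv Γ.param t 0 * deriv (deriv Γ.param) t 1 -
      deriv Γ.param t 1 * deriv (deriv Γ.param) t 0) * (e₁ 0 ^ 2 + e₁ 1 ^ 2) * hη
  -- the tangent at the flat point
  have hys : y₁ s = 0 := by
    obtain ⟨H, hH⟩ := isCompact_Icc.exists_bound_of_continuousOn hh.continuousOn
    have xO : x =O[𝓝[Γ.domain] s] fun t => t - s := by
      have := (hcoord e₁ s).isBigO_sub.mono (nhdsWithin_le_nhds (s := Γ.domain))
      simpa [hx] using this
    -- For small abscissas `|x| ^ β ≤ x ^ 2`, so `y` is quadratically small along the curve. Its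
    -- derivative at `s` vanishes, and the curve is tangent to `e₁`.
    have yO : y =O[𝓝[Γ.domain] s] fun t => x t ^ 2 := by
      refine IsBigO.of_bound H ?_
      have xc : Tendsto x (𝓝[Γ.domain] s) (𝓝 0) := by
        have := (hcoord e₁ s).continuousAt.tendsto.mono_left
          (nhdsWithin_le_nhds (s := Γ.domain))
        simpa [hx] using this
      filter_upwards [hev, xc.abs.eventually_le_const (show |(0 : ℝ)| < 1 by simp)] with t ht hx1
      have ht2 : y t = g (x t) := ht.2
      have hHx := hH (x t) ht.1
      have hp : |x t| ^ β ≤ |x t| ^ 2 := by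
        rw [← Real.rpow_natCast]
        rcases (abs_nonneg (x t)).eq_or_lt with h0 | h0
        · rw [← h0, Real.zero_rpow (by linarith), Real.zero_rpow (by norm_num)]
        · exact Real.rpow_le_rpow_of_exponent_ge h0 hx1 (by push_cast; linarith)
      have hgx : |g (x t)| ≤ |x t| ^ β * |h (x t)| := by
        have hpos : 0 ≤ |x t| ^ β := Real.rpow_nonneg (abs_nonneg _) _
        rcases hg with hg | hg
        · rw [hg _ ht.1, abs_mul, abs_of_nonneg hpos]
        · rw [hg _ ht.1, abs_mul, abs_mul, abs_of_nonneg hpos]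
          have : |Real.sign (x t)| ≤ 1 := by
            rcases Real.sign_apply_eq (x t) with h | h | h <;> rw [h] <;> norm_num
          exact mul_le_mul_of_nonneg_right (mul_le_of_le_one_left hpos this) (abs_nonneg _)
      rw [ht2, Real.norm_eq_abs, norm_pow, Real.norm_eq_abs]
      rw [Real.norm_eq_abs] at hHx
      calc |g (x t)| ≤ |x t| ^ β * |h (x t)| := hgx
        _ ≤ |x t| ^ 2 * H := by gcongr
        _ = _ := mul_comm _ _
    have yo : y =o[𝓝[Γ.domain] s] fun t => t - s :=
      (yO.trans (xO.pow 2).norm_right).trans_isLittleO (by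
        simpa only [norm_pow] using
          (isLittleO_pow_sub_sub s (by norm_num : 1 < 2)).mono nhdsWithin_le_nhds)
    have d0 : HasDerivWithinAt y 0 Γ.domain s := by
      rw [hasDerivWithinAt_iff_isLittleO]
      simpa [ys] using yo
    exact UniqueDiffWithinAt.eq_deriv _ (hΓ.uniqueDiffOn_domain s hsd)
      (hcoord e₂ s).hasDerivWithinAt d0
  have hxs : x₁ s ^ 2 = 1 := by have := unit s hsd; rw [hys] at this; linarith
  -- `τ = ±1` is the sense in which the curve runs along `e₁`. Near `s` the quantity `τ x` is
  -- positive after `s` and `-τ x` is positive before it, and each serves as the variable of a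
  -- one-sided profile.
  set τ := x₁ s with hτ
  -- the profile on one side
  have side : ∀ σ : ℝ, σ ^ 2 = 1 → ∃ ρ C : ℝ, 0 < ρ ∧ 0 ≤ C ∧ ∃ G G₁ G₂ G₃ : ℝ → ℝ,
      (∀ w ∈ Ioo 0 ρ, HasDerivAt G (G₁ w) w ∧ HasDerivAt G₁ (G₂ w) w ∧
        HasDerivAt G₂ (G₃ w) w ∧ |G₂ w| ≤ C * w ^ (β - 3) ∧ |G₃ w| ≤ C * w ^ (β - 3)) ∧
      ∀ w > 0, σ * w ∈ Icc (-r) r → g (σ * w) = G w := by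
    intro σ hσ
    have hσ' : σ = 1 ∨ σ = -1 := by
      have h0 : (σ - 1) * (σ + 1) = 0 := by linear_combination hσ
      rcases mul_eq_zero.1 h0 with h1 | h1
      · exact Or.inl (by linarith)
      · exact Or.inr (by linarith)
    -- On one side the sign factor of the odd normal form is constant; `ζ` absorbs it, so both
    -- normal forms are treated alike.
    obtain ⟨ζ, hζ⟩ : ∃ ζ : ℝ, ∀ w > 0, σ * w ∈ Icc (-r) r →
        g (σ * w) = w ^ β * (ζ * h (σ * w)) := by
      have habs : ∀ w : ℝ, 0 < w → |σ * w| = w := fun w hw => by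
        rcases hσ' with rfl | rfl <;> simp [abs_of_pos hw]
      rcases hg with hg | hg
      · exact ⟨1, fun w hw hmem => by rw [hg _ hmem, habs w hw, one_mul]⟩
      · refine ⟨σ, fun w hw hmem => ?_⟩
        have hsign : Real.sign (σ * w) = σ := by
          rcases hσ' with rfl | rfl
          · rw [one_mul, Real.sign_of_pos hw]
          · rw [neg_one_mul, Real.sign_of_neg (by linarith)]
        rw [hg _ hmem, habs w hw, hsign]; ring
    have hk : ContDiffOn ℝ 3 (fun w => ζ * h (σ * w)) (Ioo (-r) r) := by
      refine contDiffOn_const.mul ((contDiffOn_infty.1 hh 3).comp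
        (by fun_prop) fun w hw => ?_)
      rcases hσ' with rfl | rfl
      · rw [one_mul]; exact Ioo_subset_Icc_self hw
      · rw [neg_one_mul]; exact ⟨by linarith [hw.2], by linarith [hw.1]⟩
    obtain ⟨G₁, G₂, G₃, ρ, C, hρ, hC, hG⟩ := exists_deriv_bounds_rpow_mul β hr hk
    exact ⟨ρ, C, hρ, hC, _, G₁, G₂, G₃, hG, hζ⟩
  have hτ2 : (-τ) ^ 2 = 1 := by rw [neg_sq]; exact hxs
  obtain ⟨ρ, C, hρ, hC, G, G₁, G₂, G₃, hG, hgG⟩ := side τ hxs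
  obtain ⟨ρ', C', hρ', hC', G', G₁', G₂', G₃', hG', hgG'⟩ := side (-τ) hτ2
  -- a neighbourhood
  set B := |x₂ s| + 1 with hB
  have x₁c : Continuous x₁ := continuous_iff_continuousAt.2 fun t => (hcoord1 e₁ t).continuousAt
  have ev1 : ∀ᶠ t in 𝓝 s, 1 / 2 < τ * x₁ t := by
    have h0 : Continuous fun t => τ * x₁ t := continuous_const.mul x₁c
    have h2 : 1 / 2 < τ * x₁ s := by rw [← hτ, ← sq, hxs]; norm_num
    exact h0.continuousAt.eventually (lt_mem_nhds h2)
  have ev2 : ∀ᶠ t in 𝓝 s, |x₂ t| < B :=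
    (hcoord2 e₁).abs.continuousAt.eventually (gt_mem_nhds (by rw [hB]; exact lt_add_one _))
  obtain ⟨δ₀, δ00, hδ₀⟩ := Metric.eventually_nhds_iff.1
    ((ev1.and ev2).and (eventually_nhdsWithin_iff.1 hev))
  set δ := min δ₀ (min 1 (min ρ ρ')) with hδ
  have δ0 : 0 < δ := by positivity
  have near : ∀ t ∈ Γ.domain, |t - s| < δ → 1 / 2 < τ * x₁ t ∧ |x₂ t| ≤ B ∧ |x₁ t| ≤ 1 ∧
      x t ∈ Icc (-r) r ∧ y t = g (x t) := fun t ht hts => by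
    obtain ⟨⟨a1, a2⟩, a3⟩ := hδ₀ (y := t) (by
      rw [Real.dist_eq]; exact hts.trans_le (min_le_left _ _))
    refine ⟨a1, a2.le, ?_, (a3 ht).1, (a3 ht).2⟩
    rw [← sq_le_one_iff_abs_le_one]
    linarith [unit t ht, sq_nonneg (y₁ t)]
  have δ1 : δ ≤ 1 := (min_le_right _ _).trans (min_le_left _ _)
  have δρ : δ ≤ ρ := (min_le_right _ _).trans ((min_le_right _ _).trans (min_le_left _ _))
  have δρ' : δ ≤ ρ' := (min_le_right _ _).trans ((min_le_right _ _).trans (min_le_right _ _))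
  have B0 : 0 ≤ B := by positivity
  have η1 : |η| ≤ 1 := by rw [← sq_le_one_iff_abs_le_one]; exact hη.le
  have τ1 : |τ| ≤ 1 := by rw [← sq_le_one_iff_abs_le_one]; exact hxs.le
  -- Near `s` the speed `τ x₁` lies between `1 / 2` and 1, so by the mean value theorem the abscissa
  -- is comparable to arc length.
  have cauchy : ∀ {a b : ℝ}, a < b → Icc a b ⊆ Γ.domain → (∀ t ∈ Icc a b, |t - s| < δ) →
      (b - a) / 2 ≤ τ * (x b - x a) ∧ τ * (x b - x a) ≤ b - a := by
    intro a b hab hsub hnear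
    obtain ⟨ξ, hξ, e⟩ := exists_hasDerivAt_eq_slope x x₁ hab
      (fun t _ => (hcoord e₁ t).continuousAt.continuousWithinAt) fun t _ => hcoord e₁ t
    have hba : 0 < b - a := sub_pos.2 hab
    have e' : x b - x a = x₁ ξ * (b - a) := by rw [e, div_mul_cancel₀ _ hba.ne']
    have hξ' := Ioo_subset_Icc_self hξ
    obtain ⟨b1, -, b2, -, -⟩ := near ξ (hsub hξ') (hnear ξ hξ')
    have b3 : τ * x₁ ξ ≤ 1 := by
      refine (le_abs_self _).trans ?_
      rw [abs_mul]
      exact mul_le_one₀ τ1 (abs_nonneg _) b2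
    rw [e', ← mul_assoc]
    constructor
    · nlinarith
    · nlinarith
  -- For `β ≤ 3` the power is decreasing and is bounded by its value at `a`; for `β ≥ 3` it is at
  -- most 1.
  have power : ∀ {a w : ℝ}, 0 < a → a ≤ w → w ≤ 1 → w ^ (β - 3) ≤ 1 + a ^ (β - 3) := by
    intro a w ha haw hw1
    have h0 := Real.rpow_nonneg ha.le (β - 3)
    rcases le_total β 3 with h3 | h3
    · have := Real.rpow_le_rpow_of_nonpos ha haw (by linarith : β - 3 ≤ 0)
      linarith
    · have := Real.rpow_le_one (ha.le.trans haw) hw1 (by linarith : 0 ≤ β - 3)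
      linarith
  have cτ : ∀ σ : ℝ, σ ^ 2 = 1 → ∀ t, Γ.curvature t = η * σ * (σ * x₁ t * y₂ t - y₁ t * (σ * x₂ t)) :=
    fun σ hσ t => by
      rw [curv t]
      linear_combination (-(η * (x₁ t * y₂ t - y₁ t * x₂ t))) * hσ
  have ab1 : ∀ {σ z M : ℝ}, |σ| ≤ 1 → |z| ≤ M → |σ * z| ≤ M := by
    intro σ z M h1 h2
    rw [abs_mul]
    exact (mul_le_of_le_one_left (abs_nonneg z) h1).trans h2
  refine ⟨δ, δ0, (3 * B + 1) * (C + C'), fun t ht htL => ?_, fun t ht htL => ?_⟩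
  · have hI : ∀ t ∈ Ioo s (min (s + δ) Γ.len), t ∈ Γ.domain ∧ |t - s| < δ ∧
        (t - s) / 2 ≤ τ * x t ∧ τ * x t ≤ t - s := fun t ht => by
      have hts := ht.2.trans_le (min_le_left _ _)
      have htL := ht.2.trans_le (min_le_right _ _)
      have hb := cauchy ht.1 (fun r hr => Icc_subset_domain Γ ⟨hs.1.trans hr.1, hr.2.trans htL.le⟩)
        fun r hr => by rw [abs_lt]; constructor <;> linarith [hr.1, hr.2]
      rw [xs, sub_zero] at hb
      exact ⟨Icc_subset_domain Γ ⟨hs.1.trans ht.1.le, htL.le⟩,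
        by rw [abs_lt]; constructor <;> linarith [ht.1], hb.1, hb.2⟩
    have htI : t ∈ Ioo s (min (s + δ) Γ.len) := ⟨ht.1, lt_min ht.2 htL⟩
    have hpos : ∀ t ∈ Ioo s (min (s + δ) Γ.len), τ * x t ∈ Ioo 0 ρ := fun t ht => by
      obtain ⟨-, a2, a3, a4⟩ := hI t ht
      exact ⟨by linarith [ht.1], by linarith [le_abs_self (t - s)]⟩
    have main := abs_deriv_curvature_graph_le (η := η * τ) (c := Γ.curvature) (y := y) (y₁ := y₁)
      (y₂ := y₂) (W := fun t => τ * x t) (W₁ := fun t => τ * x₁ t) (W₂ := fun t => τ * x₂ t)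
      (B := B) hG (fun t => (hcoord e₁ t).const_mul τ) (fun t => (hcoord1 e₁ t).const_mul τ)
      (hcoord e₂) (hcoord1 e₂) hpos
      (fun t ht => by
        obtain ⟨a1, a2, -, -⟩ := hI t ht
        obtain ⟨-, -, -, a3, a4⟩ := near t a1 a2
        have e : τ * (τ * x t) = x t := by linear_combination x t * hxs
        have := hgG (τ * x t) (hpos t ht).1 (by rw [e]; exact a3)
        rw [a4, ← this, e])
      (fun t _ => cτ τ hxs t) (ab1 η1 τ1)
      (fun t ht => ab1 τ1 (near t (hI t ht).1 (hI t ht).2.1).2.2.1)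
      (fun t ht => ab1 τ1 (near t (hI t ht).1 (hI t ht).2.1).2.1) htI
    obtain ⟨-, a2, a3, a4⟩ := hI t htI
    have hp := power (by linarith [ht.1] : 0 < (t - s) / 2) a3
      (by linarith [le_abs_self (t - s)])
    have hp0 := Real.rpow_nonneg (by linarith [ht.1] : 0 ≤ (t - s) / 2) (β - 3)
    have hw0 := Real.rpow_nonneg (hpos t htI).1.le (β - 3)
    refine main.trans ?_
    gcongr
    linarith
  · have hI : ∀ t ∈ Ioo (max (s - δ) 0) s, t ∈ Γ.domain ∧ |t - s| < δ ∧
        (s - t) / 2 ≤ -τ * x t ∧ -τ * x t ≤ s - t := fun t ht => by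
      have hts := (le_max_left _ _).trans_lt ht.1
      have htL := (le_max_right _ _).trans_lt ht.1
      have hb := cauchy ht.2 (fun r hr => Icc_subset_domain Γ ⟨htL.le.trans hr.1, hr.2.trans hs.2⟩)
        fun r hr => by rw [abs_lt]; constructor <;> linarith [hr.1, hr.2]
      rw [xs, zero_sub] at hb
      exact ⟨Icc_subset_domain Γ ⟨htL.le, ht.2.le.trans hs.2⟩,
        by rw [abs_lt]; constructor <;> linarith [ht.2], by linarith [hb.1], by linarith [hb.2]⟩
    have htI : t ∈ Ioo (max (s - δ) 0) s := ⟨max_lt ht.1 htL, ht.2⟩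
    have hpos : ∀ t ∈ Ioo (max (s - δ) 0) s, -τ * x t ∈ Ioo 0 ρ' := fun t ht => by
      obtain ⟨-, a2, a3, a4⟩ := hI t ht
      exact ⟨by linarith [ht.2], by linarith [neg_abs_le (t - s)]⟩
    have τ1' : |-τ| ≤ 1 := by rwa [abs_neg]
    have main := abs_deriv_curvature_graph_le (η := η * -τ) (c := Γ.curvature) (y := y) (y₁ := y₁)
      (y₂ := y₂) (W := fun t => -τ * x t) (W₁ := fun t => -τ * x₁ t) (W₂ := fun t => -τ * x₂ t)
      (B := B) hG' (fun t => (hcoord e₁ t).const_mul (-τ)) (fun t => (hcoord1 e₁ t).const_mul (-τ))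
      (hcoord e₂) (hcoord1 e₂) hpos
      (fun t ht => by
        obtain ⟨a1, a2, -, -⟩ := hI t ht
        obtain ⟨-, -, -, a3, a4⟩ := near t a1 a2
        have e : -τ * (-τ * x t) = x t := by linear_combination x t * hxs
        have := hgG' (-τ * x t) (hpos t ht).1 (by rw [e]; exact a3)
        rw [a4, ← this, e])
      (fun t _ => cτ (-τ) hτ2 t) (ab1 η1 τ1')
      (fun t ht => ab1 τ1' (near t (hI t ht).1 (hI t ht).2.1).2.2.1)
      (fun t ht => ab1 τ1' (near t (hI t ht).1 (hI t ht).2.1).2.1) htI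
    obtain ⟨-, a2, a3, a4⟩ := hI t htI
    have hp := power (by linarith [ht.2] : 0 < (s - t) / 2) a3
      (by linarith [neg_abs_le (t - s)])
    have hp0 := Real.rpow_nonneg (by linarith [ht.2] : 0 ≤ (s - t) / 2) (β - 3)
    have hw0 := Real.rpow_nonneg (hpos t htI).1.le (β - 3)
    refine main.trans ?_
    gcongr
    linarith

lemma differentiableAt_curvature (hΓ : Γ.IsAdmissible κ) {t : ℝ} (ht : t ∈ Ioo 0 Γ.len)
    (hc : Γ.curvature t ≠ 0) : DifferentiableAt ℝ Γ.curvature t := by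
  have htd := Icc_subset_domain Γ (Ioo_subset_Icc_self ht)
  have h3 : ContDiffAt ℝ (3 : ℕ) Γ.param t :=
    (contDiffWithinAt_infty.1 (hΓ.smooth t htd hc) 3).contDiffAt
      (mem_of_superset (Icc_mem_nhds ht.1 ht.2) (Icc_subset_domain Γ))
  have h2 : ContDiffAt ℝ (2 : ℕ) (deriv Γ.param) t := h3.derivWithin (by norm_num)
  have h1 : ContDiffAt ℝ (1 : ℕ) (deriv (deriv Γ.param)) t := h2.derivWithin (by norm_num)
  have d1 := h2.differentiableAt (by norm_num)
  have d2 := h1.differentiableAt (by norm_num)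
  have co : ∀ {f : ℝ → Plane}, DifferentiableAt ℝ f t → ∀ i : Fin 2,
      DifferentiableAt ℝ (fun s => f s i) t := fun hf i =>
    (hasDerivAt_coord hf.hasDerivAt i).differentiableAt
  exact ((co d1 0).mul (co d2 1)).sub ((co d1 1).mul (co d2 0))

/-- The derivative of the curvature is integrable along the curve. -/
theorem intervalIntegrable_deriv_curvature (hΓ : Γ.IsAdmissible κ) :
    IntervalIntegrable (deriv Γ.curvature) volume 0 Γ.len := by
  refine interval_induction (P := fun a b => IntervalIntegrable (deriv Γ.curvature) volume a b)
    hΓ.len_pos.le IntervalIntegrable.refl (fun x y z _ _ _ _ h1 h2 => h1.trans h2) fun s hs => ?_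
  by_cases hc : Γ.curvature s = 0
  swap
  · exact hΓ.exists_side_of_curvature_ne_zero hs hc
  obtain ⟨β, hβ, -, hflat⟩ := hΓ.flat s (Icc_subset_domain Γ hs) hc
  obtain ⟨δ, δ0, K, h1, h2⟩ := hΓ.exists_bound_deriv_curvature_of_flat hs hβ hflat
  refine ⟨δ, δ0, fun r hr hrL => ?_, fun r hr hr0 => ?_⟩
  · exact intervalIntegrable_of_abs_le hr.1.le (measurable_deriv _)
      ((intervalIntegrable_singular hβ s r).1.const_mul K)
      fun t ht => h1 t ⟨ht.1, ht.2.trans hr.2⟩ (ht.2.trans_le hrL)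
  · exact intervalIntegrable_of_abs_le hr.2.le (measurable_deriv _)
      ((intervalIntegrable_singular hβ s r).2.const_mul K)
      fun t ht => h2 t ⟨hr.1.trans ht.1, ht.2⟩ (hr0.trans_lt ht.1)

end IsAdmissible

end PlaneCurve

/-! ### The mean squared error -/

section

variable {m : ℕ} {Γ : Fin m → PlaneCurve} {κ ε₀ ε : ℝ} {f : Plane → ℝ} {θ : ℝ → ℝ}

/-- The sum of the extended integrands. -/
def totalIntegrand (Γ : Fin m → PlaneCurve) (f : Plane → ℝ) (θ : ℝ → ℝ) (ε : ℝ) (x : Plane) : ℝ :=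
  ∑ k, (Γ k).extendedIntegrand f θ ε x

/-- Projection, distance and curvature are equivariant under rigid motions, so the sum over the
moved curves samples one fixed function at the inversely moved lattice. -/
lemma ibimMoved_eq_latticeSum (hΓ : ∀ k, (Γ k).IsAdmissible κ) {h : ℝ} (hh : 0 < h) (φ : ℝ)
    (ξ : Plane) : ibimMoved Γ f θ h ε φ ξ = latticeSum (totalIntegrand Γ f θ ε) h φ ξ := by
  unfold ibimMoved ibim latticeSum totalIntegrand
  congr 1
  rw [Summable.tsum_finsetSum fun k _ => by
    obtain ⟨ρ, hρ⟩ := (hΓ k).exists_radius_extendedIntegrand f θ ε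
    exact summable_lattice hρ hh ξ φ]
  refine Finset.sum_congr rfl fun k _ => tsum_congr fun w => ?_
  exact (hΓ k).extendedIntegrand_move φ (h • ξ) f θ ε _

/-- The properties of the integrand that the mean squared error depends on. -/
lemma exists_bound_totalIntegrand (hΓ : ∀ k, (Γ k).IsAdmissible κ)
    (hreg : ∀ k, (Γ k).TubeRegular ε₀) (hε₀ : 0 < ε₀) (hθ : PiecewiseC1 θ)
    (hθ1 : ∫ s in (-1 : ℝ)..1, θ s = 1)
    (hf : ∀ k, ∃ F : Plane → ℝ, ContDiff ℝ ∞ F ∧ EqOn f F (Γ k).trace) :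
    ∃ C : ℝ, 0 ≤ C ∧ ∀ ε : ℝ, 0 < ε → ε ≤ ε₀ → Measurable (totalIntegrand Γ f θ ε) ∧
      (∃ M, ∀ x, |totalIntegrand Γ f θ ε x| ≤ M) ∧
      (∃ ρ, ∀ x, ρ < ‖x‖ → totalIntegrand Γ f θ ε x = 0) ∧
      ∫ x, totalIntegrand Γ f θ ε x = lineIntegral Γ f ∧
      ∀ R, 0 < R → R ^ 3 * ∫ φ in (0 : ℝ)..(2 * Real.pi),
        ‖polarFourier (totalIntegrand Γ f θ ε) R φ‖ ^ 2 ≤ C / ε ^ 2 := by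
  choose F hF hfF using hf
  have hF1 : ∀ k, ContDiff ℝ 1 (F k) := fun k => (hF k).of_le (by exact_mod_cast le_top)
  have hFc : ∀ k, Continuous (F k) := fun k => (hF k).continuous
  have hS : ∀ k, {t ∈ Icc 0 (Γ k).len | (Γ k).curvature t = 0}.Countable := fun k =>
    (hΓ k).finite_flat.countable
  have hd : ∀ k, ∀ t ∈ Ioo 0 (Γ k).len \ {t ∈ Icc 0 (Γ k).len | (Γ k).curvature t = 0},
      DifferentiableAt ℝ (Γ k).curvature t := fun k t ht =>
    (hΓ k).differentiableAt_curvature ht.1 fun hc => ht.2 ⟨Ioo_subset_Icc_self ht.1, hc⟩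
  have hi := fun k => (hΓ k).intervalIntegrable_deriv_curvature
  have hstrip := fun k => ((hΓ k).toNormalStrip (hreg k) hε₀ (hF1 k) (hS k) (hd k)
    (hi k)).exists_weightInt_bound hθ
  choose C hC0 hC using hstrip
  -- The factor `m` comes from Cauchy-Schwarz for the sum over the curves. The constants `C k` are
  -- chosen before `ε`, so the bound is uniform in the tube width.
  refine ⟨m * ∑ k, C k, mul_nonneg (Nat.cast_nonneg _) (Finset.sum_nonneg fun k _ => hC0 k),
    fun ε hε hε' => ?_⟩
  have hmeas := fun k => (hΓ k).measurable_extendedIntegrand (hreg k) hε' (hfF k) (hFc k)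
    hθ.measurable
  have hbd := fun k => (hΓ k).exists_bound_extendedIntegrand (hreg k) hε hε' (hfF k) (hFc k) hθ
  have hrad := fun k => (hΓ k).exists_radius_extendedIntegrand f θ ε
  choose M hM using hbd
  choose ρ hρ using hrad
  have hint := fun k => integrable_of_bounded_of_support (hmeas k) (hM k) (hρ k)
  refine ⟨Finset.measurable_sum _ fun k _ => hmeas k, ⟨∑ k, M k, fun x => ?_⟩,
    ⟨∑ k, |ρ k|, fun x hx => ?_⟩, ?_, fun R hR => ?_⟩
  · exact (Finset.abs_sum_le_sum_abs _ _).trans (Finset.sum_le_sum fun k _ => hM k x)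
  · refine Finset.sum_eq_zero fun k _ => hρ k x (lt_of_le_of_lt ?_ hx)
    exact (le_abs_self _).trans
      (Finset.single_le_sum (f := fun k => |ρ k|) (fun _ _ => abs_nonneg _) (Finset.mem_univ k))
  · unfold totalIntegrand lineIntegral
    rw [integral_finsetSum _ fun k _ => hint k]
    exact Finset.sum_congr rfl fun k _ => (hΓ k).integral_extendedIntegrand (hreg k) hε₀ hε hε'
      (hfF k) (hF1 k) hθ hθ1 (hS k) (hd k) (hi k)
  · have hpol : ∀ φ, polarFourier (totalIntegrand Γ f θ ε) R φ =
        ∑ k, polarFourier ((Γ k).extendedIntegrand f θ ε) R φ := fun φ => by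
      unfold polarFourier totalIntegrand
      rw [← integral_finsetSum]
      · congr 1; ext x
        push_cast
        rw [Finset.sum_mul]
      · intro k _
        refine (hint k).ofReal.mul_bdd (c := 1) ?_ (Eventually.of_forall fun y => (norm_osc _).le)
        exact (continuous_osc.comp (by fun_prop)).aestronglyMeasurable
    have hsq : ∀ φ, ‖polarFourier (totalIntegrand Γ f θ ε) R φ‖ ^ 2 ≤
        m * ∑ k, ‖polarFourier ((Γ k).extendedIntegrand f θ ε) R φ‖ ^ 2 := fun φ => by
      rw [hpol]
      refine (pow_le_pow_left₀ (norm_nonneg _) (norm_sum_le _ _) 2).trans ?_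
      simpa using sq_sum_le_card_mul_sum_sq (s := (Finset.univ : Finset (Fin m)))
        (f := fun k => ‖polarFourier ((Γ k).extendedIntegrand f θ ε) R φ‖)
    have hcont : ∀ k, Continuous fun φ =>
        ‖polarFourier ((Γ k).extendedIntegrand f θ ε) R φ‖ ^ 2 := fun k =>
      (continuous_polarFourier (hint k) R).norm.pow 2
    have hk : ∀ k, R ^ 3 * ∫ φ in (0 : ℝ)..(2 * Real.pi),
        ‖polarFourier ((Γ k).extendedIntegrand f θ ε) R φ‖ ^ 2 ≤ C k / ε ^ 2 := fun k => by
      simp only [(hΓ k).polarFourier_extendedIntegrand (hreg k) hε₀ hε hε' (hfF k) (hF1 k) hθ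
        (hS k) (hd k) (hi k)]
      exact hC k ε hε hε' R hR
    have hcontT : Continuous fun φ => ‖polarFourier (totalIntegrand Γ f θ ε) R φ‖ ^ 2 := by
      simp only [hpol]
      exact (continuous_finsetSum _ fun k _ => continuous_polarFourier (hint k) R).norm.pow 2
    have h1 : ∫ φ in (0 : ℝ)..(2 * Real.pi), ‖polarFourier (totalIntegrand Γ f θ ε) R φ‖ ^ 2 ≤
        ∫ φ in (0 : ℝ)..(2 * Real.pi),
          m * ∑ k, ‖polarFourier ((Γ k).extendedIntegrand f θ ε) R φ‖ ^ 2 :=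
      intervalIntegral.integral_mono_on (μ := volume) (by positivity) (hcontT.intervalIntegrable _ _)
        ((continuous_const.mul (continuous_finsetSum _ fun k _ => hcont k)).intervalIntegrable _ _)
        fun φ _ => hsq φ
    rw [intervalIntegral.integral_const_mul, intervalIntegral.integral_finsetSum
      fun k _ => (hcont k).intervalIntegrable _ _] at h1
    calc R ^ 3 * ∫ φ in (0 : ℝ)..(2 * Real.pi), ‖polarFourier (totalIntegrand Γ f θ ε) R φ‖ ^ 2
        ≤ R ^ 3 * (m * ∑ k, ∫ φ in (0 : ℝ)..(2 * Real.pi),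
          ‖polarFourier ((Γ k).extendedIntegrand f θ ε) R φ‖ ^ 2) := by gcongr
      _ = m * ∑ k, R ^ 3 * ∫ φ in (0 : ℝ)..(2 * Real.pi),
          ‖polarFourier ((Γ k).extendedIntegrand f θ ε) R φ‖ ^ 2 := by
        rw [← Finset.mul_sum]; ring
      _ ≤ m * ∑ k, C k / ε ^ 2 := by
        gcongr with k
        exact hk k
      _ = m * (∑ k, C k) / ε ^ 2 := by rw [← Finset.sum_div, mul_div_assoc]

end

/-- The exponent of the quadrature error. -/
lemma exponent_le {κ α : ℝ} (hκ : 2 ≤ κ) (hα : α ≤ 1) :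
    2 / κ + 2 * (1 - α) / (κ - 1) ≤ 3 - 2 * α := by
  -- Both terms are largest at `κ = 2`, where equality holds.
  have h1 : 2 / κ ≤ 1 := by rw [div_le_one (by linarith)]; exact hκ
  have h2 : 2 * (1 - α) / (κ - 1) ≤ 2 * (1 - α) :=
    div_le_self (by linarith) (by linarith)
  linarith

end

theorem theorem4p1 {m : ℕ} (Γ : Fin m → PlaneCurve) (κ : ℝ)
    (hκ : κ ∈ Ico (2 : ℝ) ((3 + Real.sqrt 5) / 2))
    (hΓ : ∀ k, (Γ k).IsAdmissible κ) :
    (∃ ε₀ : ℝ, 0 < ε₀ ∧ ∀ k, (Γ k).TubeRegular ε₀) ∧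
    ∀ ε₀ : ℝ, 0 < ε₀ → (∀ k, (Γ k).TubeRegular ε₀) →
    ∀ (q : ℕ) (θ : ℝ → ℝ), IsWeight q θ →
    ∀ f : Plane → ℝ,
      (∀ k, ∃ F : Plane → ℝ, ContDiff ℝ ∞ F ∧ EqOn f F (Γ k).trace) →
    ∀ α ∈ Icc (0 : ℝ) 1, ∀ ε : ℝ → ℝ,
      (ε =Θ[𝓝[>] 0] fun h => h ^ α) →
      (∀ᶠ h in 𝓝[>] 0, 0 < ε h ∧ ε h ≤ ε₀) →
      (∀ᶠ h in 𝓝[>] 0, IntegrableOn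
        (fun p : ℝ × Plane => squaredError Γ f θ h (ε h) p.1 p.2)
        (Icc 0 (2 * Real.pi) ×ˢ unitSquare)) ∧
      (fun h => meanSquaredError Γ f θ h (ε h)) =O[𝓝[>] 0]
        fun h => h ^ (2 / κ + 2 * (1 - α) / (κ - 1)) := by
  constructor
  · have hev : ∀ᶠ ε in 𝓝[>] (0 : ℝ), ∀ k, (Γ k).TubeRegular ε := by
      rw [eventually_all]
      intro k
      obtain ⟨ε₁, h0, h1⟩ := (hΓ k).exists_tubeRegular
      exact mem_of_superset (Ioc_mem_nhdsGT h0) h1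
    obtain ⟨ε, h1, h2⟩ := (hev.and self_mem_nhdsWithin).exists
    exact ⟨ε, h2, h1⟩
  intro ε₀ hε₀ hreg q θ hθ f hf α hα ε hεΘ hε
  obtain ⟨C, hC0, hC⟩ := exists_bound_totalIntegrand hΓ hreg hε₀ hθ.piecewiseC1 hθ.integral_eq hf
  obtain ⟨C₀, hC₀0, hC₀⟩ := integral_sq_latticeSum_le
  have hsq : ∀ h, 0 < h → 0 < ε h → ε h ≤ ε₀ → ∀ φ ξ, squaredError Γ f θ h (ε h) φ ξ =
      ((∫ x, totalIntegrand Γ f θ (ε h) x) -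
        latticeSum (totalIntegrand Γ f θ (ε h)) h φ ξ) ^ 2 := by
    intro h hh h1 h2 φ ξ
    obtain ⟨-, -, -, hI, -⟩ := hC (ε h) h1 h2
    rw [squaredError, ibimMoved_eq_latticeSum hΓ hh, hI, sq_abs]
  constructor
  · filter_upwards [hε, self_mem_nhdsWithin] with h hεh hh
    obtain ⟨hm, ⟨M, hM⟩, ⟨ρ, hρ⟩, -, -⟩ := hC (ε h) hεh.1 hεh.2
    simp only [hsq h hh hεh.1 hεh.2]
    exact integrableOn_sq_latticeSum hm hM hρ hh _
  · obtain ⟨c, hc⟩ := hεΘ.2.bound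
    have hsmall : ∀ᶠ h in 𝓝[>] (0 : ℝ), h ≤ 1 :=
      mem_of_superset (Ioc_mem_nhdsGT one_pos) fun h hh => hh.2
    refine IsBigO.of_bound ((2 * Real.pi)⁻¹ * (C₀ * C * c ^ 2)) ?_
    filter_upwards [hε, self_mem_nhdsWithin, hc, hsmall] with h hεh hh hch h1
    have hh : 0 < h := hh
    obtain ⟨hm, ⟨M, hM⟩, ⟨ρ, hρ⟩, -, hF⟩ := hC (ε h) hεh.1 hεh.2
    have key := hC₀ hm hM hρ hF hh
    have hnn : 0 ≤ meanSquaredError Γ f θ h (ε h) := by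
      unfold meanSquaredError
      refine mul_nonneg (by positivity) (intervalIntegral.integral_nonneg (by positivity)
        fun φ _ => integral_nonneg fun ξ => ?_)
      unfold squaredError
      positivity
    rw [Real.norm_of_nonneg hnn, Real.norm_of_nonneg (by positivity)]
    rw [Real.norm_of_nonneg (by positivity), Real.norm_of_nonneg hεh.1.le] at hch
    unfold meanSquaredError
    simp only [hsq h hh hεh.1 hεh.2]
    rw [mul_assoc]
    refine mul_le_mul_of_nonneg_left (key.trans ?_) (by positivity)
    have hpow : (h ^ α) ^ 2 ≤ c ^ 2 * ε h ^ 2 := by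
      rw [← mul_pow]
      exact pow_le_pow_left₀ (by positivity) hch 2
    have hα2 : (h ^ α) ^ 2 = h ^ (2 * α) := by
      rw [← Real.rpow_natCast, ← Real.rpow_mul hh.le]
      congr 1; push_cast; ring
    -- Splitting off `h ^ (2α) ≤ c² ε²` turns `h³ / ε²` into the rate `h ^ (3 - 2α)`; as `h ≤ 1`, a
    -- smaller exponent only weakens it.
    have h3 : h ^ 3 = h ^ (3 - 2 * α) * (h ^ α) ^ 2 := by
      rw [hα2, ← Real.rpow_add hh, ← Real.rpow_natCast]
      congr 1; push_cast; ring
    have hε2 : 0 < ε h ^ 2 := pow_pos hεh.1 2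
    calc C₀ * (C / ε h ^ 2) * h ^ 3
        = C₀ * C * h ^ (3 - 2 * α) * ((h ^ α) ^ 2 / ε h ^ 2) := by rw [h3]; ring
      _ ≤ C₀ * C * h ^ (3 - 2 * α) * c ^ 2 := by
        gcongr
        rw [div_le_iff₀ hε2]; exact hpow
      _ ≤ C₀ * C * h ^ (2 / κ + 2 * (1 - α) / (κ - 1)) * c ^ 2 := by
        gcongr C₀ * C * ?_ * c ^ 2
        exact Real.rpow_le_rpow_of_exponent_ge hh h1 (exponent_le hκ.1 hα.2)
      _ = _ := by ring
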